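/- Let $m_1,m_2,m_3>0$ and let $\mathbf J_0\in\mathbb R^3$, $\mathbf J_0\neq 0$, $J_0=\|\mathbf J_0\|$. Let $\tilde Q^*$ be the manifold of oriented triangles: pairs $(q,\mathbf n)$ with $q=(\mathbf q_1,\mathbf q_2,\mathbf q_3)\in(\mathbb R^3)^3$, $q\ne 0$, $\sum_a m_a\mathbf q_a=0$, and $\mathbf n$ a unit vector orthogonal to all $\mathbf q_a$. Let $I(q)=\sum_a m_a\|\mathbf q_a\|^2$, let $\tilde S^5=\{I=1\}\subset\tilde Q^*$, let $S_{\mathbf J_0}=\tilde S^5/G(\mathbf J_0)$, where $G(\mathbf J_0)$ is the group of rotations about $\mathbf J_0$, and let $\pi:\tilde Q^*\to S_{\mathbf J_0}$ send $(q,\mathbf n)$ to the class of $(q/\sqrt{I(q)},\mathbf n)$. Let $\mathbb I(q)=\sum_a m_a(\|\mathbf q_a\|^2\,1-\mathbf q_a\otimes\mathbf q_a)$ be the inertia tensor, $\mathbf J=\sum_a m_a\,\mathbf q_a\times d\mathbf q_a$ the angular momentum, and $\mathbf A=\mathbb I^{-1}\mathbf J$ the natural mechanical connection, defined at noncollinear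 triangles. Theorem. (1) The one-form $\mathbf J_0\cdot\mathbf A$ extends in exactly one way from the noncollinear triangles to a smooth one-form $\alpha_{\mathbf J_0}$ on $\tilde Q^*$. (2) There is exactly one smooth two-form $\Omega_{\mathbf J_0}$ on $S_{\mathbf J_0}$ with $\pi^*\Omega_{\mathbf J_0}=d\alpha_{\mathbf J_0}$, and $\Omega_{\mathbf J_0}$ is closed. (3) Near every point of $S_{\mathbf J_0}$ with $z_1\neq\pm1$ and $z_2\ne\pm1$ there are local coordinates $(z_1,\theta_1,z_2,\theta_2)$ from the inertia eigenframe, as described below, and in all such coordinates $$\Omega_{\mathbf J_0}=J_0\left\{\tfrac12\,d(z_1z_2)\wedge d\theta_1+dz_2\wedge d\theta_2\right\}.$$ The coordinates are as follows. With $\Delta=\tfrac12\,\mathbf n\cdot(\mathbf q_2-\mathbf q_1)\times(\mathbf q_3-\mathbf q_1)$ put $z_1=4\sqrt{\tfrac{m_1m_2m_3}{m_1+m_2+m_3}}\,\tfrac{\Delta}{I}$ and $z_2=\tfrac1{J_0}\mathbf J_0\cdot\mathbf n$. With the normalized Jacobi vectors $\zeta_1=\sqrt{\mu_1}(\mathbf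 q_1-\mathbf q_3)$, $\zeta_2=\sqrt{\mu_2}\left(\mathbf q_2-\tfrac{m_1\mathbf q_1+m_3\mathbf q_3}{m_1+m_3}\right)$, where $\tfrac1{\mu_1}=\tfrac1{m_1}+\tfrac1{m_3}$ and $\tfrac1{\mu_2}=\tfrac1{m_1+m_3}+\tfrac1{m_2}$, put $w_1=\tfrac{1}{2I}(\|\zeta_1\|^2-\|\zeta_2\|^2)$ and $w_2=\tfrac1I\,\zeta_1\cdot\zeta_2$, so that $(w_1,w_2,\tfrac12z_1)$ lies on the sphere of radius $\tfrac12$. Let $(\mathbf U_1,\mathbf U_2,\mathbf n)$ be a right-handed orthonormal frame of eigenvectors of $\mathbb I(q)$. The angles are those for which $$(w_1,w_2)=\tfrac12\sqrt{1-z_1^2}\,(\cos\theta_1,-\sin\theta_1),\qquad(\mathbf J_0\cdot\mathbf U_1,\mathbf J_0\cdot\mathbf U_2)=J_0\sqrt{1-z_2^2}\,(\cos\theta_2,-\sin\theta_2);$$ that is, they are oriented so that $dz_i\wedge d\theta_i$ is the outward oriented solid angle form of the respective sphere. -/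

import Mathlib

open Matrix Topology ContDiff Diffeology

noncomputable section

/-! ## Differential forms on diffeological spaces

Plots are Mathlib's global plots `ℝⁿ → X`.  For a smooth manifold (with its smooth maps as plots)
the objects defined here are the ordinary smooth differential forms. -/

/-- A differential `k`-form on a diffeological space: a smooth `k`-form on `ℝⁿ` for every plot
`p : ℝⁿ → X` (to be thought of as the pull-back of the form by `p`), compatible with smooth
changes of parameters. -/
@[ext]
structure DForm (X : Type*) [DiffeologicalSpace X] (k : ℕ) where
  toFun : ∀ {n : ℕ} (p : EuclideanSpace ℝ (Fin n) → X), IsPlot p →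
    EuclideanSpace ℝ (Fin n) → (EuclideanSpace ℝ (Fin n)) [⋀^Fin k]→L[ℝ] ℝ
  smooth : ∀ {n : ℕ} (p : EuclideanSpace ℝ (Fin n) → X) (hp : IsPlot p), ContDiff ℝ ∞ (toFun p hp)
  compat : ∀ {n l : ℕ} (p : EuclideanSpace ℝ (Fin n) → X) (hp : IsPlot p)
    (f : EuclideanSpace ℝ (Fin l) → EuclideanSpace ℝ (Fin n)) (hf : ContDiff ℝ ∞ f)
    (x : EuclideanSpace ℝ (Fin l)),
    toFun (p ∘ f) (isPlot_reparam hp hf) x =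
      (toFun p hp (f x)).compContinuousLinearMap (fderiv ℝ f x)

namespace DForm

variable {X Y : Type*} [DiffeologicalSpace X] [DiffeologicalSpace Y] {k : ℕ}

/-- The exterior derivative of a differential form. -/
def d (η : DForm X k) : DForm X (k + 1) where
  toFun p hp := extDeriv (η.toFun p hp)
  smooth {n} p hp := by
    have h : ContDiff ℝ ∞ (fderiv ℝ (η.toFun p hp)) := (η.smooth p hp).fderiv_right (by simp)
    exact (ContinuousAlternatingMap.alternatizeUncurryFinCLM ℝ
      (EuclideanSpace ℝ (Fin n)) ℝ).contDiff.comp h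
  compat p hp f hf x := by
    have h : η.toFun (p ∘ f) (isPlot_reparam hp hf) =
        fun x => (η.toFun p hp (f x)).compContinuousLinearMap (fderiv ℝ f x) :=
      funext (η.compat p hp f hf)
    rw [h]
    exact extDeriv_pullback ((η.smooth p hp).differentiable (by simp) _)
      hf.contDiffAt
      (by rw [minSmoothness_of_isRCLikeNormedField]; exact WithTop.coe_le_coe.2 le_top)

/-- A closed differential form. -/
def Closed (η : DForm X k) : Prop :=
  ∀ {n : ℕ} (p : EuclideanSpace ℝ (Fin n) → X) (hp : IsPlot p) (x : EuclideanSpace ℝ (Fin n)),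
    η.d.toFun p hp x = 0

/-- The pull-back of a differential form by a smooth map. -/
def pullback (η : DForm Y k) (f : X → Y) (hf : DSmooth f) : DForm X k where
  toFun p hp := η.toFun (f ∘ p) (hf _ p hp)
  smooth p hp := η.smooth (f ∘ p) (hf _ p hp)
  compat p hp g hg x := η.compat (f ∘ p) (hf _ p hp) g hg x

end DForm

/-- The wedge product `φ ∧ ψ` of two covectors, evaluated on a pair of vectors. -/
def wedge {E : Type*} [NormedAddCommGroup E] [NormedSpace ℝ E] (φ ψ : E →L[ℝ] ℝ)
    (v : Fin 2 → E) : ℝ :=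
  φ (v 0) * ψ (v 1) - φ (v 1) * ψ (v 0)

/-- A system of `l` local coordinates on a diffeological space: `c` restricts to a diffeomorphism
from the open set `W` onto an open subset of `ℝˡ`. -/
def IsLocalCoordinates {X : Type*} [DiffeologicalSpace X] {l : ℕ} (W : Set X)
    (c : X → EuclideanSpace ℝ (Fin l)) : Prop :=
  IsOpen[dTopology] W ∧ IsOpen (c '' W) ∧ Set.InjOn c W ∧
  (∀ {n : ℕ} (p : EuclideanSpace ℝ (Fin n) → X), IsPlot p →
    ∀ x, p x ∈ W → ContDiffAt ℝ ∞ (c ∘ p) x) ∧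
  (∀ {n : ℕ} (p : EuclideanSpace ℝ (Fin n) → X), (∀ x, p x ∈ W) →
    ContDiff ℝ ∞ (c ∘ p) → IsPlot p)

/-! ## Subset and quotient diffeologies -/

lemma exists_smooth_localizer {n : ℕ} (u : Set (EuclideanSpace ℝ (Fin n))) (hu : IsOpen u)
    (x : EuclideanSpace ℝ (Fin n)) (hx : x ∈ u) :
    ∃ f : EuclideanSpace ℝ (Fin n) → EuclideanSpace ℝ (Fin n),
      (∀ y, f y ∈ u) ∧ ContDiff ℝ ∞ f ∧ ∀ᶠ y in 𝓝 x, f y = y := by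
  obtain ⟨ε, hε, hb⟩ := Metric.isOpen_iff.mp hu x hx
  let χ : ContDiffBump x := ⟨ε / 2, ε, by positivity, by linarith⟩
  refine ⟨fun y => x + χ y • (y - x), fun y => hb ?_, ?_, ?_⟩
  · rw [Metric.mem_ball, dist_eq_norm, add_sub_cancel_left, norm_smul, Real.norm_of_nonneg χ.nonneg]
    by_cases hy : dist y x < ε
    · rw [dist_eq_norm] at hy
      calc χ y * ‖y - x‖ ≤ 1 * ‖y - x‖ := by gcongr; exact χ.le_one
        _ < ε := by simpa using hy
    · rw [χ.zero_of_le_dist (not_lt.mp hy)]; simpa using hε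
  · exact contDiff_const.add (χ.contDiff.smul (contDiff_id.sub contDiff_const))
  · filter_upwards [χ.eventuallyEq_one] with y hy
    simp [hy]

/-- The subset diffeology: plots are the maps that are smooth into the ambient space. -/
@[reducible]
def subsetDiffeology {V : Type*} [NormedAddCommGroup V] [NormedSpace ℝ V] (s : Set V) :
    DiffeologicalSpace s where
  plots _ := {p | ContDiff ℝ ∞ fun x => (p x : V)}
  constant_plots _ := by
    rw [Set.mem_ofPred_eq]; exact contDiff_const
  plot_reparam {_ _ p _} hp hf := by
    rw [Set.mem_ofPred_eq] at hp ⊢; exact hp.comp hf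
  locality {n p} h := by
    rw [Set.mem_ofPred_eq]
    refine contDiff_iff_contDiffAt.2 fun x => ?_
    obtain ⟨u, hu, hxu, H⟩ := h x
    obtain ⟨f, hfu, hf, he⟩ := exists_smooth_localizer u hu x hxu
    have h1 : ContDiff ℝ ∞ fun y => ((p ∘ f) y : V) := H hfu hf
    refine h1.contDiffAt.congr_of_eventuallyEq ?_
    filter_upwards [he] with y hy
    simp [hy]

/-- The quotient diffeology: plots are the maps that locally lift to plots upstairs. -/
@[reducible]
def quotientDiffeology {X : Type*} [DiffeologicalSpace X] (r : Setoid X) :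
    DiffeologicalSpace (Quotient r) where
  plots n := {p | ∀ x, ∃ p' : EuclideanSpace ℝ (Fin n) → X, IsPlot p' ∧
    ∀ᶠ y in 𝓝 x, (Quotient.mk r (p' y)) = p y}
  constant_plots {n} x := fun _ => by
    obtain ⟨a, rfl⟩ := Quotient.exists_rep x
    exact ⟨fun _ => a, isPlot_const, Filter.Eventually.of_forall fun _ => rfl⟩
  plot_reparam {n m p f} hp hf := fun x => by
    obtain ⟨p', hp', he⟩ := hp (f x)
    exact ⟨p' ∘ f, isPlot_reparam hp' hf, hf.continuous.continuousAt.eventually he⟩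
  locality {n p} h := fun x => by
    obtain ⟨u, hu, hxu, H⟩ := h x
    obtain ⟨f, hfu, hf, he⟩ := exists_smooth_localizer u hu x hxu
    obtain ⟨p', hp', he'⟩ := H hfu hf x
    refine ⟨p', hp', ?_⟩
    filter_upwards [he, he'] with y hy hy'
    simpa [hy] using hy'

/-! ## Oriented triangles -/

/-- Vectors of `ℝ³`, with dot product `⬝ᵥ` and cross product `⨯₃`. -/
abbrev Vec := Fin 3 → ℝ

/-- The polar moment of inertia `I(q) = ∑ mₐ |qₐ|²`. -/
def polarInertia (m : Fin 3 → ℝ) (q : Fin 3 → Vec) : ℝ := ∑ a, m a * (q a ⬝ᵥ q a)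

/-- The moment of inertia tensor `𝕀(q) = ∑ mₐ (|qₐ|² 1 - qₐ ⊗ qₐ)`. -/
def inertiaTensor (m : Fin 3 → ℝ) (q : Fin 3 → Vec) : Matrix (Fin 3) (Fin 3) ℝ :=
  ∑ a, m a • ((q a ⬝ᵥ q a) • (1 : Matrix (Fin 3) (Fin 3) ℝ) - vecMulVec (q a) (q a))

/-- `u ⬝ 𝕀(q) u = ∑ mₐ |u × qₐ|²`. -/
lemma dot_inertiaTensor (m : Fin 3 → ℝ) (q : Fin 3 → Vec) (u : Vec) :
    u ⬝ᵥ (inertiaTensor m q *ᵥ u) = polarInertia m (fun a => u ⨯₃ q a) := by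
  simp [inertiaTensor, polarInertia,
    Fin.sum_univ_three, cross_apply, dotProduct, vecMulVec, Matrix.mulVec]
  ring

/-- The angular momentum `𝐉(q, q̇) = ∑ mₐ qₐ × q̇ₐ`. -/
def angularMomentum (m : Fin 3 → ℝ) (q v : Fin 3 → Vec) : Vec := ∑ a, m a • (q a ⨯₃ v a)

/-- The natural mechanical connection `𝐀(q)(q̇) = 𝕀(q)⁻¹ 𝐉(q, q̇)`, at a noncollinear triangle. -/
def mechanicalConnection (m : Fin 3 → ℝ) (q v : Fin 3 → Vec) : Vec :=
  (inertiaTensor m q)⁻¹ *ᵥ angularMomentum m q v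

/-- Oriented triangles `(q, n)` with centre of mass at the origin. -/
def orientedTriangles (m : Fin 3 → ℝ) : Set ((Fin 3 → Vec) × Vec) :=
  {x | ∑ a, m a • x.1 a = 0 ∧ x.2 ⬝ᵥ x.2 = 1 ∧ ∀ a, x.2 ⬝ᵥ x.1 a = 0}

/-- `Q̃*`: the oriented triangles that are not triple collisions. -/
def qStar (m : Fin 3 → ℝ) : Set ((Fin 3 → Vec) × Vec) := {x ∈ orientedTriangles m | x.1 ≠ 0}

/-- `S̃⁵`: the oriented triangles with `I = 1`. -/
def sFive (m : Fin 3 → ℝ) : Set ((Fin 3 → Vec) × Vec) :=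
  {x ∈ orientedTriangles m | polarInertia m x.1 = 1}

instance (m : Fin 3 → ℝ) : DiffeologicalSpace (qStar m) := subsetDiffeology _

instance (m : Fin 3 → ℝ) : DiffeologicalSpace (sFive m) := subsetDiffeology _

/-- Two points of `S̃⁵` are equivalent if they differ by a rotation that fixes `𝐉₀`. -/
def rotationSetoid (m : Fin 3 → ℝ) (J₀ : Vec) : Setoid (sFive m) where
  r x y := ∃ R ∈ Matrix.specialOrthogonalGroup (Fin 3) ℝ, R *ᵥ J₀ = J₀ ∧
    (∀ a, R *ᵥ x.1.1 a = y.1.1 a) ∧ R *ᵥ x.1.2 = y.1.2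
  iseqv := by
    refine ⟨fun x => ⟨1, one_mem _, by simp⟩, ?_, ?_⟩
    · rintro x y ⟨R, hR, h0, h1, h2⟩
      have hR' : Rᵀ * R = 1 :=
        (Matrix.mem_orthogonalGroup_iff' (Fin 3) ℝ).1 (Matrix.mem_specialOrthogonalGroup_iff.1 hR).1
      have key : ∀ u w, R *ᵥ u = w → Rᵀ *ᵥ w = u := by
        rintro u w rfl
        rw [Matrix.mulVec_mulVec, hR', Matrix.one_mulVec]
      refine ⟨Rᵀ, ?_, key _ _ h0, fun a => key _ _ (h1 a), key _ _ h2⟩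
      exact (star (⟨R, hR⟩ : Matrix.specialOrthogonalGroup (Fin 3) ℝ)).2
    · rintro x y z ⟨R, hR, h0, h1, h2⟩ ⟨T, hT, k0, k1, k2⟩
      exact ⟨T * R, mul_mem hT hR, by rw [← Matrix.mulVec_mulVec, h0, k0],
        fun a => by rw [← Matrix.mulVec_mulVec, h1, k1], by rw [← Matrix.mulVec_mulVec, h2, k2]⟩

/-- `S_{𝐉₀} = S̃⁵ / G(𝐉₀)`. -/
def ReducedSphereBundle (m : Fin 3 → ℝ) (J₀ : Vec) : Type := Quotient (rotationSetoid m J₀)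

instance (m : Fin 3 → ℝ) (J₀ : Vec) : DiffeologicalSpace (ReducedSphereBundle m J₀) :=
  quotientDiffeology (rotationSetoid m J₀)

/-- The class in `S_{𝐉₀}` of a point of `S̃⁵`. -/
def reducedClass (m : Fin 3 → ℝ) (J₀ : Vec) (x : sFive m) : ReducedSphereBundle m J₀ :=
  Quotient.mk (rotationSetoid m J₀) x

lemma polarInertia_pos {m : Fin 3 → ℝ} (hm : ∀ a, 0 < m a) {q : Fin 3 → Vec} (hq : q ≠ 0) :
    0 < polarInertia m q := by
  obtain ⟨a, ha⟩ := Function.ne_iff.1 hq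
  obtain ⟨i, hi⟩ := Function.ne_iff.1 ha
  have hnn : ∀ b, 0 ≤ q b ⬝ᵥ q b := fun b => Finset.sum_nonneg fun j _ => mul_self_nonneg _
  refine Finset.sum_pos' (fun b _ => mul_nonneg (hm b).le (hnn b)) ⟨a, Finset.mem_univ _, ?_⟩
  refine mul_pos (hm a) (Finset.sum_pos' (fun j _ => mul_self_nonneg _) ⟨i, Finset.mem_univ _, ?_⟩)
  exact mul_self_pos.2 hi

/-- Rescaling an oriented triangle to `I = 1`. -/
def rescale (m : Fin 3 → ℝ) (hm : ∀ a, 0 < m a) (x : qStar m) : sFive m :=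
  ⟨((√(polarInertia m x.1.1))⁻¹ • x.1.1, x.1.2), by
    obtain ⟨⟨q, n⟩, ⟨h1, h2, h3⟩, h4⟩ := x
    have hI := polarInertia_pos hm h4
    refine ⟨⟨?_, h2, fun a => ?_⟩, ?_⟩
    · simp only [Pi.smul_apply, smul_comm (m _), ← Finset.smul_sum]
      simp only at h1
      rw [h1, smul_zero]
    · simp only at h3
      simp [h3 a]
    · have : polarInertia m ((√(polarInertia m q))⁻¹ • q) =
          (√(polarInertia m q))⁻¹ * (√(polarInertia m q))⁻¹ * polarInertia m q := by
        simp only [polarInertia, Pi.smul_apply, dotProduct_smul, smul_dotProduct, smul_eq_mul,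
          Finset.mul_sum]
        exact Finset.sum_congr rfl fun _ _ => by ring
      simp only
      rw [this, ← mul_inv, Real.mul_self_sqrt hI.le, inv_mul_cancel₀ hI.ne']⟩

/-- The projection `Q̃* → S_{𝐉₀}`, that is, the quotient map by rotations about `𝐉₀` and
homotheties. -/
def reducedProj (m : Fin 3 → ℝ) (hm : ∀ a, 0 < m a) (J₀ : Vec) (x : qStar m) :
    ReducedSphereBundle m J₀ :=
  reducedClass m J₀ (rescale m hm x)

lemma dSmooth_reducedProj (m : Fin 3 → ℝ) (hm : ∀ a, 0 < m a) (J₀ : Vec) :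
    DSmooth (reducedProj m hm J₀) := by
  intro n p hp x
  refine ⟨rescale m hm ∘ p, ?_, Filter.Eventually.of_forall fun _ => rfl⟩
  have hp' : ContDiff ℝ ∞ fun x => (p x : (Fin 3 → Vec) × Vec) := hp
  have h1 : ContDiff ℝ ∞ fun x => (p x).1.1 := hp'.fst
  have hI : ContDiff ℝ ∞ fun x => polarInertia m (p x).1.1 := by
    have h2 : ∀ a i, ContDiff ℝ ∞ fun x => (p x).1.1 a i := fun a i =>
      contDiff_pi.1 (contDiff_pi.1 h1 a) i
    unfold polarInertia dotProduct
    exact ContDiff.sum fun a _ => contDiff_const.mul (ContDiff.sum fun i _ => (h2 a i).mul (h2 a i))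
  have hpos : ∀ x, polarInertia m (p x).1.1 ≠ 0 := fun x => (polarInertia_pos hm (p x).2.2).ne'
  have hs : ContDiff ℝ ∞ fun x => (√(polarInertia m (p x).1.1))⁻¹ :=
    (hI.sqrt hpos).inv fun x => (Real.sqrt_pos.2 (polarInertia_pos hm (p x).2.2)).ne'
  exact (hs.smul h1).prodMk hp'.snd

/-! ## The one-form `α = 𝐉₀ ⬝ 𝐀` -/

/-- `α` is a smooth one-form on `Q̃*` that equals `𝐉₀ ⬝ 𝐀 = 𝐉₀ ⬝ 𝕀⁻¹ 𝐉` at all noncollinear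
triangles, where `𝕀` is invertible. -/
def IsConnectionComponent (m : Fin 3 → ℝ) (J₀ : Vec) (α : DForm (qStar m) 1) : Prop :=
  ∀ {n : ℕ} (p : EuclideanSpace ℝ (Fin n) → qStar m) (hp : IsPlot p)
    (x : EuclideanSpace ℝ (Fin n)), ¬ Collinear ℝ (Set.range (p x).1.1) →
    ∀ v : Fin 1 → EuclideanSpace ℝ (Fin n),
      α.toFun p hp x v =
        J₀ ⬝ᵥ mechanicalConnection m (p x).1.1 (fderiv ℝ (fun y => (p y).1.1) x (v 0))

/-! ## Coordinates from the inertia eigenframe -/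

/-- The Euclidean length of a vector. -/
def vecLength (u : Vec) : ℝ := √(u ⬝ᵥ u)

/-- The oriented area `Δ` of an oriented triangle. -/
def orientedArea (q : Fin 3 → Vec) (n : Vec) : ℝ :=
  1 / 2 * (n ⬝ᵥ ((q 1 - q 0) ⨯₃ (q 2 - q 0)))

/-- The normalized height `z₁` on the shape sphere. -/
def shapeHeight (m : Fin 3 → ℝ) (q : Fin 3 → Vec) (n : Vec) : ℝ :=
  4 * √(m 0 * m 1 * m 2 / (m 0 + m 1 + m 2)) * (orientedArea q n / polarInertia m q)

/-- The normalized height `z₂` on the angular momentum sphere. -/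
def momentumHeight (J₀ n : Vec) : ℝ := J₀ ⬝ᵥ n / vecLength J₀

/-- First normalized Jacobi vector. -/
def jacobi₁ (m : Fin 3 → ℝ) (q : Fin 3 → Vec) : Vec :=
  √(1 / (1 / m 0 + 1 / m 2)) • (q 0 - q 2)

/-- Second normalized Jacobi vector. -/
def jacobi₂ (m : Fin 3 → ℝ) (q : Fin 3 → Vec) : Vec :=
  √(1 / (1 / (m 0 + m 2) + 1 / m 1)) •
    (q 1 - (m 0 / (m 0 + m 2)) • q 0 - (m 2 / (m 0 + m 2)) • q 2)

/-- First horizontal coordinate on the shape sphere of radius `1/2`. -/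
def shapeW₁ (m : Fin 3 → ℝ) (q : Fin 3 → Vec) : ℝ :=
  1 / 2 * (jacobi₁ m q ⬝ᵥ jacobi₁ m q - jacobi₂ m q ⬝ᵥ jacobi₂ m q) / polarInertia m q

/-- Second horizontal coordinate on the shape sphere of radius `1/2`. -/
def shapeW₂ (m : Fin 3 → ℝ) (q : Fin 3 → Vec) : ℝ :=
  (jacobi₁ m q ⬝ᵥ jacobi₂ m q) / polarInertia m q

/-- `e₁, e₂, n` is a right-handed orthonormal frame of eigenvectors of the inertia tensor
(the normal `n` is always an eigenvector). -/
def IsInertiaEigenframe (m : Fin 3 → ℝ) (q : Fin 3 → Vec) (e₁ e₂ n : Vec) : Prop :=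
  e₁ ⬝ᵥ e₁ = 1 ∧ e₂ ⬝ᵥ e₂ = 1 ∧ e₁ ⬝ᵥ e₂ = 0 ∧ e₁ ⨯₃ e₂ = n ∧
  (∃ l : ℝ, inertiaTensor m q *ᵥ e₁ = l • e₁) ∧ (∃ l : ℝ, inertiaTensor m q *ᵥ e₂ = l • e₂)

/-- The point `s` of `S_{𝐉₀}`, off the poles of both spheres, has coordinates
`c = (z₁, θ₁, z₂, θ₂)`: here `θ₁` is the azimuth of the shape on the shape sphere with Cartesian
coordinates `(w₁, w₂, z₁ / 2)`, and `θ₂` is the azimuth of the vector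
`(𝐉₀ ⬝ e₁, 𝐉₀ ⬝ e₂, 𝐉₀ ⬝ n)` of body components of `𝐉₀` in an inertia eigenframe.
Azimuths are taken in the direction for which `dz ∧ dθ` is the outward oriented solid angle form,
i.e. the horizontal part of a unit vector is `√(1 - z²) (cos θ, - sin θ)`. -/
def HasEigenframeCoordinates (m : Fin 3 → ℝ) (J₀ : Vec) (s : ReducedSphereBundle m J₀)
    (c : EuclideanSpace ℝ (Fin 4)) : Prop :=
  ∃ x : sFive m, reducedClass m J₀ x = s ∧
    c 0 = shapeHeight m x.1.1 x.1.2 ∧ |c 0| < 1 ∧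
    shapeW₁ m x.1.1 = 1 / 2 * √(1 - c 0 ^ 2) * Real.cos (c 1) ∧
    shapeW₂ m x.1.1 = - (1 / 2 * √(1 - c 0 ^ 2) * Real.sin (c 1)) ∧
    c 2 = momentumHeight J₀ x.1.2 ∧ |c 2| < 1 ∧
    ∃ e₁ e₂ : Vec, IsInertiaEigenframe m x.1.1 e₁ e₂ x.1.2 ∧
      J₀ ⬝ᵥ e₁ = vecLength J₀ * √(1 - c 2 ^ 2) * Real.cos (c 3) ∧
      J₀ ⬝ᵥ e₂ = - (vecLength J₀ * √(1 - c 2 ^ 2) * Real.sin (c 3))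

/-- A system of local coordinates `(z₁, θ₁, z₂, θ₂)` on `S_{𝐉₀}` from the inertia eigenframe. -/
def IsEigenframeChart (m : Fin 3 → ℝ) (J₀ : Vec) (W : Set (ReducedSphereBundle m J₀))
    (c : ReducedSphereBundle m J₀ → EuclideanSpace ℝ (Fin 4)) : Prop :=
  IsLocalCoordinates W c ∧ ∀ s ∈ W, HasEigenframeCoordinates m J₀ s (c s)

end

/-!
Along a motion of oriented triangles, the constraints `n ⬝ qₐ = 0` show that the angular velocity
`ω = (n ⬝ 𝐉 / I) n + n × dn` solves `𝕀 ω = 𝐉`, collinear or not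
(`inertiaTensor_mulVec_eq_angularMomentum`).  Hence `𝐉₀ ⬝ ω` is a smooth one-form `α` on `Q̃*` that
equals `𝐉₀ ⬝ 𝐀` where `𝕀` is invertible.  It is the only one: a shear within the plane of the
triangle embeds every plot as the slice `t = 0` of a plot which is noncollinear at a collinear
triangle as soon as `t ≠ 0`, and forms are continuous along that plot
(`DForm.eq_of_noncollinear`).

The form `α` does not change under variable homotheties (`connectionForm_homothety`), and a rotation
about `𝐉₀` through a variable angle `φ` adds the closed form `|𝐉₀| dφ` to it
(`connectionForm_rotation`).  Two plots of `S̃⁵` with the same projection to `S_{𝐉₀}` differ by such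
a rotation, whose cosine and sine are smooth functions of the parameters because they can be
recovered from the action on the triangle and its normal (`exists_smooth_axialTurn`).  So `dα` takes
the same values on both, and it descends along local lifts (`exists_reducedForm`).  Uniqueness and
closedness of the reduced form can be checked on local lifts (`toFun_eq_of_lift`).

In the principal frame of a triangle with `I = 1`, let `φ` be the azimuth of the normal about `𝐉₀`.
Splitting the angular momentum about the normal into the turning of the frame, `dθ₂` plus a multiple
of `dφ`, and the motion of the Jacobi vectors relative to the frame, `½ z₁ dθ₁` (`shape_velocity`),
gives `α = |𝐉₀| (dφ + z₂ dθ₂ + ½ z₁ z₂ dθ₁)` (`connectionForm_eigenframe`).  The first term is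
closed, and the exterior derivative of the others is the asserted formula.

For the existence of charts, take for the first principal axis the longer one: the Jacobi vectors
then have the components `a (cos ½θ₁, -sin ½θ₁)` and `b (sin ½θ₁, cos ½θ₁)` along the two axes, where
`a² = ½ (1 + √(1 - z₁²))` and `2 a b = z₁`.  The angles are branches of arguments of complex-valued
smooth functions of the triangle: `2 θ₂` is the phase of a complex quadratic form in the Jacobi
vectors, `axisQuad`, which vanishes only at the poles of the two spheres, and `½ θ₁` is the phase of
the component along the first axis, `principalPhase`.  The inverse is the projection of the explicit
section `coordTriangle`.
-/

/-! ### Exterior derivatives of one-forms -/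

section Curl

variable {E : Type*} [NormedAddCommGroup E] [NormedSpace ℝ E]

/-- The exterior derivative of a one-form `F` on a normed space, for one-forms encoded as maps into
the dual space. -/
noncomputable def curl (F : E → E →L[ℝ] ℝ) (x : E) (v : Fin 2 → E) : ℝ :=
  fderiv ℝ F x (v 0) (v 1) - fderiv ℝ F x (v 1) (v 0)

lemma extDeriv_ofSubsingleton {F : E → E →L[ℝ] ℝ} {x : E} (hF : DifferentiableAt ℝ F x)
    (v : Fin 2 → E) :
    extDeriv (fun y => ContinuousAlternatingMap.ofSubsingleton ℝ E ℝ (0 : Fin 1) (F y)) x v =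
      curl F x v := by
  have h1 : HasFDerivAt
      (fun y => ContinuousAlternatingMap.ofSubsingletonLIE (𝕜 := ℝ) (E := E) (F := ℝ)
        (i := (0 : Fin 1)) (F y))
      (((ContinuousAlternatingMap.ofSubsingletonLIE (𝕜 := ℝ) (E := E) (F := ℝ)
        (i := (0 : Fin 1))).toContinuousLinearEquiv : (E →L[ℝ] ℝ) →L[ℝ] _) ∘L fderiv ℝ F x) x :=
    ((ContinuousAlternatingMap.ofSubsingletonLIE (𝕜 := ℝ) (E := E) (F := ℝ)
      (i := (0 : Fin 1))).toContinuousLinearEquiv.hasFDerivAt).comp x hF.hasFDerivAt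
  have h2 : fderiv ℝ
      (fun y => ContinuousAlternatingMap.ofSubsingleton ℝ E ℝ (0 : Fin 1) (F y)) x = _ := h1.fderiv
  rw [extDeriv, h2, ContinuousAlternatingMap.alternatizeUncurryFin_apply, Fin.sum_univ_two]
  simp only [curl, Fin.val_zero, pow_zero, Fin.val_one, pow_one, one_smul, neg_smul,
    ← sub_eq_add_neg]
  rfl

lemma Filter.EventuallyEq.curl_eq {F G : E → E →L[ℝ] ℝ} {x : E} (h : F =ᶠ[𝓝 x] G)
    (v : Fin 2 → E) : curl F x v = curl G x v := by
  simp only [curl, h.fderiv_eq]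

lemma curl_add {F G : E → E →L[ℝ] ℝ} {x : E} (hF : DifferentiableAt ℝ F x)
    (hG : DifferentiableAt ℝ G x) (v : Fin 2 → E) :
    curl (fun y => F y + G y) x v = curl F x v + curl G x v := by
  simp only [curl, fderiv_fun_add hF hG, _root_.add_apply]
  ring

lemma curl_const_smul (r : ℝ) {F : E → E →L[ℝ] ℝ} {x : E} (hF : DifferentiableAt ℝ F x)
    (v : Fin 2 → E) : curl (fun y => r • F y) x v = r * curl F x v := by
  simp only [curl, fderiv_fun_const_smul hF, _root_.smul_apply, smul_eq_mul]
  ring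

lemma ContDiffAt.differentiableAt_fderiv {h : E → ℝ} {x : E} (hh : ContDiffAt ℝ ∞ h x) :
    DifferentiableAt ℝ (fderiv ℝ h) x :=
  (hh.fderiv_right (m := 1) (WithTop.coe_le_coe.2 le_top)).differentiableAt one_ne_zero

/-- `d(f dh) = df ∧ dh`. -/
lemma curl_smul_fderiv {f h : E → ℝ} {x : E} (hf : DifferentiableAt ℝ f x)
    (hh : ContDiffAt ℝ ∞ h x) (v : Fin 2 → E) :
    curl (fun y => f y • fderiv ℝ h y) x v = wedge (fderiv ℝ f x) (fderiv ℝ h x) v := by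
  have hs := (hh.isSymmSndFDerivAt (by
    rw [minSmoothness_of_isRCLikeNormedField]; exact WithTop.coe_le_coe.2 le_top)).eq (v 0) (v 1)
  simp only [curl, wedge, fderiv_fun_smul hf hh.differentiableAt_fderiv]
  simp only [_root_.add_apply, _root_.smul_apply, smul_eq_mul,
    ContinuousLinearMap.smulRight_apply, hs]
  ring

/-- The angular form of the planar vector `(a, b)`, that is, the differential of its argument. -/
noncomputable def angleForm (a b : E → ℝ) (y : E) : E →L[ℝ] ℝ :=
  (a y / (a y ^ 2 + b y ^ 2)) • fderiv ℝ b y + (-b y / (a y ^ 2 + b y ^ 2)) • fderiv ℝ a y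

lemma angleForm_apply (a b : E → ℝ) (y v : E) :
    angleForm a b y v = (a y * fderiv ℝ b y v - b y * fderiv ℝ a y v) / (a y ^ 2 + b y ^ 2) := by
  simp only [angleForm, _root_.add_apply, _root_.smul_apply, smul_eq_mul]
  ring

lemma differentiableAt_angleForm {a b : E → ℝ} {x : E} (ha : ContDiffAt ℝ ∞ a x)
    (hb : ContDiffAt ℝ ∞ b x) (h0 : a x ^ 2 + b x ^ 2 ≠ 0) :
    DifferentiableAt ℝ (angleForm a b) x := by
  have h1 := ha.differentiableAt (by simp)
  have h2 := hb.differentiableAt (by simp)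
  have h3 := ha.differentiableAt_fderiv
  have h4 := hb.differentiableAt_fderiv
  unfold angleForm
  fun_prop (disch := assumption)

/-- The angular form is closed. -/
lemma curl_angleForm {a b : E → ℝ} {x : E} (ha : ContDiffAt ℝ ∞ a x)
    (hb : ContDiffAt ℝ ∞ b x) (h0 : a x ^ 2 + b x ^ 2 ≠ 0) (v : Fin 2 → E) :
    curl (angleForm a b) x v = 0 := by
  have h1 := ha.differentiableAt (by simp)
  have h2 := hb.differentiableAt (by simp)
  have h3 := ha.differentiableAt_fderiv
  have h4 := hb.differentiableAt_fderiv
  have hr : HasFDerivAt (fun y => a y ^ 2 + b y ^ 2)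
      ((2 * a x) • fderiv ℝ a x + (2 * b x) • fderiv ℝ b x) x := by
    refine ((h1.hasFDerivAt.pow 2).add (h2.hasFDerivAt.pow 2)).congr_fderiv ?_
    simp
  have hA : ∀ c : E → ℝ, DifferentiableAt ℝ c x → ∀ w,
      fderiv ℝ (fun y => c y / (a y ^ 2 + b y ^ 2)) x w =
      fderiv ℝ c x w / (a x ^ 2 + b x ^ 2) - c x * (2 * a x * fderiv ℝ a x w
        + 2 * b x * fderiv ℝ b x w) / (a x ^ 2 + b x ^ 2) ^ 2 := by
    intro c hc w
    have h5 := hc.hasFDerivAt.mul ((hasDerivAt_inv h0).comp_hasFDerivAt x hr)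
    have h6 : fderiv ℝ (fun y => c y / (a y ^ 2 + b y ^ 2)) x = _ := h5.fderiv
    rw [h6]
    simp
    field_simp
    ring
  have hnb : ∀ w, fderiv ℝ (fun y => - b y) x w = - fderiv ℝ b x w := by simp
  have e1 : curl (angleForm a b) x v =
      wedge (fderiv ℝ (fun y => a y / (a y ^ 2 + b y ^ 2)) x) (fderiv ℝ b x) v +
      wedge (fderiv ℝ (fun y => -b y / (a y ^ 2 + b y ^ 2)) x) (fderiv ℝ a x) v := by
    rw [← curl_smul_fderiv (by fun_prop (disch := assumption)) hb,
      ← curl_smul_fderiv (by fun_prop (disch := assumption)) ha, ← curl_add]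
    · rfl
    · fun_prop (disch := assumption)
    · fun_prop (disch := assumption)
  rw [e1]
  have hB := hA _ h2.fun_neg
  simp only [wedge, hA a h1, hB, hnb]
  field_simp
  ring

end Curl

/-! ### Forms on diffeological spaces: locality and descent -/

namespace DForm

variable {X Y : Type*} [DiffeologicalSpace X] [DiffeologicalSpace Y] {k : ℕ}

/-- The value of a form on a plot depends only on the germ of the plot. -/
lemma toFun_congr (η : DForm X k) {n : ℕ} {p p' : EuclideanSpace ℝ (Fin n) → X} (hp : IsPlot p)
    (hp' : IsPlot p') {x : EuclideanSpace ℝ (Fin n)} (h : p =ᶠ[𝓝 x] p') :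
    η.toFun p hp x = η.toFun p' hp' x := by
  obtain ⟨u, hu, huo, hxu⟩ := eventually_nhds_iff.1 h
  obtain ⟨f, hfu, hf, he⟩ := exists_smooth_localizer u huo x hxu
  have hfx : f x = x := he.self_of_nhds
  have hd : fderiv ℝ f x = ContinuousLinearMap.id ℝ _ := by
    have : f =ᶠ[𝓝 x] id := he
    rw [this.fderiv_eq, fderiv_id]
  have hc : p ∘ f = p' ∘ f := funext fun y => hu _ (hfu y)
  have h1 := η.compat p hp f hf x
  have h2 := η.compat p' hp' f hf x
  have h3 : η.toFun (p ∘ f) (isPlot_reparam hp hf) x =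
      η.toFun (p' ∘ f) (isPlot_reparam hp' hf) x := by
    simp only [hc]
  rw [h1, h2, hfx, hd] at h3
  ext v
  simpa using congrArg (fun φ => φ v) h3

/-- A form descends along a smooth map with local lifts of plots as soon as its values on two plots
with the same projection agree. -/
lemma exists_descent (η : DForm X k) (π : X → Y)
    (lift : ∀ {n : ℕ} (p : EuclideanSpace ℝ (Fin n) → Y), IsPlot p → ∀ x,
      ∃ P : EuclideanSpace ℝ (Fin n) → X, IsPlot P ∧ π ∘ P =ᶠ[𝓝 x] p)
    (basic : ∀ {n : ℕ} (P P' : EuclideanSpace ℝ (Fin n) → X) (hP : IsPlot P) (hP' : IsPlot P') (x),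
      π ∘ P =ᶠ[𝓝 x] π ∘ P' → η.toFun P hP x = η.toFun P' hP' x) :
    ∃ Ω : DForm Y k, ∀ {n : ℕ} (p : EuclideanSpace ℝ (Fin n) → Y) (hp : IsPlot p)
      (P : EuclideanSpace ℝ (Fin n) → X) (hP : IsPlot P) (x),
      π ∘ P =ᶠ[𝓝 x] p → Ω.toFun p hp x = η.toFun P hP x := by
  choose L hL he using @lift
  have key : ∀ {n : ℕ} (p : EuclideanSpace ℝ (Fin n) → Y) (hp : IsPlot p)
      (P : EuclideanSpace ℝ (Fin n) → X) (hP : IsPlot P) (x),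
      π ∘ P =ᶠ[𝓝 x] p → η.toFun (L p hp x) (hL p hp x) x = η.toFun P hP x :=
    fun p hp P hP x h => basic _ _ (hL p hp x) hP x ((he p hp x).trans h.symm)
  refine ⟨⟨fun p hp x => η.toFun (L p hp x) (hL p hp x) x, fun p hp => ?_,
    fun p hp f hf x => ?_⟩, key⟩
  · refine contDiff_iff_contDiffAt.2 fun x => ?_
    refine (η.smooth (L p hp x) (hL p hp x)).contDiffAt.congr_of_eventuallyEq ?_
    filter_upwards [(he p hp x).eventuallyEq_nhds] with y hy
    exact key p hp _ (hL p hp x) y hy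
  · rw [key (p ∘ f) (isPlot_reparam hp hf) (L p hp (f x) ∘ f) (isPlot_reparam (hL p hp _) hf) x
      ((he p hp (f x)).comp_tendsto hf.continuous.continuousAt)]
    exact η.compat _ _ f hf x

lemma closed_d (η : DForm X k) : η.d.Closed := fun p hp x => by
  change extDeriv (extDeriv (η.toFun p hp)) x = 0
  exact extDeriv_extDeriv_apply (η.smooth p hp).contDiffAt
    (by rw [minSmoothness_of_isRCLikeNormedField]; exact WithTop.coe_le_coe.2 le_top)

end DForm

/-! ### Vector algebra and orthonormal frames -/

/-- `e₁, e₂, n` is a right-handed orthonormal frame. -/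
structure IsRightFrame (e₁ e₂ n : Vec) : Prop where
  fst : e₁ ⬝ᵥ e₁ = 1
  snd : e₂ ⬝ᵥ e₂ = 1
  perp : e₁ ⬝ᵥ e₂ = 0
  cross : e₁ ⨯₃ e₂ = n

namespace IsRightFrame

variable {e₁ e₂ n : Vec}

lemma perp' (h : IsRightFrame e₁ e₂ n) : e₂ ⬝ᵥ e₁ = 0 := by rw [dotProduct_comm, h.perp]

lemma normal (h : IsRightFrame e₁ e₂ n) : n ⬝ᵥ n = 1 := by
  rw [← h.cross, cross_dot_cross, h.fst, h.snd, h.perp]; ring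

lemma fst_normal (h : IsRightFrame e₁ e₂ n) : e₁ ⬝ᵥ n = 0 := by rw [← h.cross]; simp

lemma snd_normal (h : IsRightFrame e₁ e₂ n) : e₂ ⬝ᵥ n = 0 := by rw [← h.cross]; simp

lemma normal_fst (h : IsRightFrame e₁ e₂ n) : n ⬝ᵥ e₁ = 0 := by
  rw [dotProduct_comm, h.fst_normal]

lemma normal_snd (h : IsRightFrame e₁ e₂ n) : n ⬝ᵥ e₂ = 0 := by
  rw [dotProduct_comm, h.snd_normal]

lemma normal_cross_fst (h : IsRightFrame e₁ e₂ n) : n ⨯₃ e₁ = e₂ := by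
  rw [← h.cross, cross_cross_eq_smul_sub_smul, h.fst, h.perp']; simp

lemma snd_cross_normal (h : IsRightFrame e₁ e₂ n) : e₂ ⨯₃ n = e₁ := by
  rw [← h.cross, cross_cross_eq_smul_sub_smul', h.snd, h.perp]; simp

lemma normal_cross_snd (h : IsRightFrame e₁ e₂ n) : n ⨯₃ e₂ = -e₁ := by
  rw [← cross_anticomm, h.snd_cross_normal]

lemma expand (h : IsRightFrame e₁ e₂ n) (u : Vec) :
    u = (u ⬝ᵥ e₁) • e₁ + (u ⬝ᵥ e₂) • e₂ + (u ⬝ᵥ n) • n := by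
  have h1 : n ⨯₃ (n ⨯₃ u) = -((u ⬝ᵥ e₁) • e₁) - (u ⬝ᵥ e₂) • e₂ := by
    have h2 : n ⨯₃ u = (u ⬝ᵥ e₁) • e₂ - (u ⬝ᵥ e₂) • e₁ := by
      conv_lhs => rw [← h.cross]
      rw [cross_cross_eq_smul_sub_smul, dotProduct_comm e₁, dotProduct_comm e₂]
    rw [h2, map_sub, map_smul, map_smul, h.normal_cross_fst, h.normal_cross_snd]
    simp
  rw [cross_cross_eq_smul_sub_smul', h.normal, one_smul, dotProduct_comm n u] at h1
  have h3 : u = (u ⬝ᵥ n) • n - ((u ⬝ᵥ n) • n - u) := by abel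
  rw [h1] at h3
  conv_lhs => rw [h3]
  abel

lemma dot_eq (h : IsRightFrame e₁ e₂ n) (u v : Vec) :
    u ⬝ᵥ v = (u ⬝ᵥ e₁) * (v ⬝ᵥ e₁) + (u ⬝ᵥ e₂) * (v ⬝ᵥ e₂) + (u ⬝ᵥ n) * (v ⬝ᵥ n) := by
  conv_lhs => rw [h.expand v]
  simp only [dotProduct_add, dotProduct_smul, smul_eq_mul]
  ring

lemma ext_dot (h : IsRightFrame e₁ e₂ n) {u v : Vec} (h₁ : u ⬝ᵥ e₁ = v ⬝ᵥ e₁)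
    (h₂ : u ⬝ᵥ e₂ = v ⬝ᵥ e₂) (h₃ : u ⬝ᵥ n = v ⬝ᵥ n) : u = v := by
  rw [h.expand u, h.expand v, h₁, h₂, h₃]

/-- The third component of a cross product in a right-handed orthonormal frame. -/
lemma cross_dot_normal (h : IsRightFrame e₁ e₂ n) (u v : Vec) :
    n ⬝ᵥ (u ⨯₃ v) = (u ⬝ᵥ e₁) * (v ⬝ᵥ e₂) - (u ⬝ᵥ e₂) * (v ⬝ᵥ e₁) := by
  conv_lhs => rw [← h.cross, cross_dot_cross]
  simp only [dotProduct_comm e₁, dotProduct_comm e₂]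
  ring

/-- Turning the first two vectors of a frame. -/
lemma rotate (h : IsRightFrame e₁ e₂ n) (t : ℝ) :
    IsRightFrame (Real.cos t • e₁ + Real.sin t • e₂) (Real.cos t • e₂ - Real.sin t • e₁) n where
  fst := by
    simp [h.fst, h.snd, h.perp, h.perp']
    nlinarith [Real.sin_sq_add_cos_sq t]
  snd := by
    simp [h.fst, h.snd, h.perp, h.perp']
    nlinarith [Real.sin_sq_add_cos_sq t]
  perp := by
    simp [h.fst, h.snd, h.perp, h.perp']
    ring
  cross := by
    have h2 : e₂ ⨯₃ e₁ = -n := by rw [← cross_anticomm, h.cross]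
    simp [h.cross, h2, smul_smul, ← add_smul]
    rw [show Real.cos t * Real.cos t + Real.sin t * Real.sin t = 1 by
      nlinarith [Real.sin_sq_add_cos_sq t], one_smul]

end IsRightFrame

lemma dotProduct_self_pos {u : Vec} (hu : u ≠ 0) : 0 < u ⬝ᵥ u := by
  obtain ⟨i, hi⟩ := Function.ne_iff.1 hu
  exact Finset.sum_pos' (fun j _ => mul_self_nonneg _) ⟨i, Finset.mem_univ _, mul_self_pos.2 hi⟩

lemma vec_dot_self_nonneg (u : Vec) : 0 ≤ u ⬝ᵥ u :=
  Finset.sum_nonneg fun _ _ => mul_self_nonneg _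

lemma vecLength_pos {u : Vec} (hu : u ≠ 0) : 0 < vecLength u :=
  Real.sqrt_pos.2 (dotProduct_self_pos hu)

lemma vecLength_sq (u : Vec) : vecLength u ^ 2 = u ⬝ᵥ u := Real.sq_sqrt (vec_dot_self_nonneg u)

/-- A unit vector and an orthogonal unit vector complete to a right-handed frame. -/
lemma isRightFrame_of_perp {n e : Vec} (hn : n ⬝ᵥ n = 1) (he : e ⬝ᵥ e = 1) (hp : n ⬝ᵥ e = 0) :
    IsRightFrame e (n ⨯₃ e) n where
  fst := he
  snd := by rw [cross_dot_cross, hn, he, hp, dotProduct_comm e, hp]; ring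
  perp := by simp
  cross := by
    rw [cross_cross_eq_smul_sub_smul', he, hp]; simp

lemma isRightFrame_normalize {n u : Vec} (hn : n ⬝ᵥ n = 1) (hu : u ≠ 0) (hp : n ⬝ᵥ u = 0) :
    IsRightFrame ((vecLength u)⁻¹ • u) (n ⨯₃ ((vecLength u)⁻¹ • u)) n := by
  refine isRightFrame_of_perp hn ?_ (by simp [hp])
  have := vecLength_pos hu
  simp [← vecLength_sq]
  field_simp

/-- Every unit vector is the third vector of a right-handed orthonormal frame. -/
lemma exists_isRightFrame {k : Vec} (hk : k ⬝ᵥ k = 1) : ∃ e₁ e₂ : Vec, IsRightFrame e₁ e₂ k := by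
  have : ∃ u : Vec, u ≠ 0 ∧ k ⬝ᵥ u = 0 := by
    by_cases h : k 0 = 0
    · exact ⟨![1, 0, 0], fun h0 => by simpa using congrFun h0 0,
        by simp [dotProduct, Fin.sum_univ_three, h]⟩
    · refine ⟨![-k 1, k 0, 0], fun h0 => h (by simpa using congrFun h0 1), ?_⟩
      simp [dotProduct, Fin.sum_univ_three]; ring
  obtain ⟨u, hu, hku⟩ := this
  exact ⟨_, _, isRightFrame_normalize hk hu hku⟩

/-! ### Differentiation of dot and cross products -/

section Calculus

variable {E : Type*} [NormedAddCommGroup E] [NormedSpace ℝ E]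

lemma ContDiffAt.dotProduct {f g : E → Vec} {x : E} (hf : ContDiffAt ℝ ∞ f x)
    (hg : ContDiffAt ℝ ∞ g x) : ContDiffAt ℝ ∞ (fun y => f y ⬝ᵥ g y) x := by
  unfold _root_.dotProduct
  exact ContDiffAt.sum fun i _ => (contDiffAt_pi.1 hf i).mul (contDiffAt_pi.1 hg i)

lemma ContDiffAt.crossProduct {f g : E → Vec} {x : E} (hf : ContDiffAt ℝ ∞ f x)
    (hg : ContDiffAt ℝ ∞ g x) : ContDiffAt ℝ ∞ (fun y => f y ⨯₃ g y) x := by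
  have hf' := contDiffAt_pi.1 hf
  have hg' := contDiffAt_pi.1 hg
  refine contDiffAt_pi.2 fun i => ?_
  fin_cases i <;> simp only [cross_apply] <;>
    exact ((hf' _).mul (hg' _)).sub ((hf' _).mul (hg' _))

lemma fderiv_vec_apply {f : E → Vec} {x : E} (hf : DifferentiableAt ℝ f x) (v : E) (i : Fin 3) :
    fderiv ℝ f x v i = fderiv ℝ (fun y => f y i) x v := by
  rw [fderiv_pi (fun i => differentiableAt_pi.1 hf i)]; rfl

lemma fderiv_dotProduct {f g : E → Vec} {x : E} (hf : DifferentiableAt ℝ f x)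
    (hg : DifferentiableAt ℝ g x) (v : E) :
    fderiv ℝ (fun y => f y ⬝ᵥ g y) x v = fderiv ℝ f x v ⬝ᵥ g x + f x ⬝ᵥ fderiv ℝ g x v := by
  have hf' := differentiableAt_pi.1 hf
  have hg' := differentiableAt_pi.1 hg
  unfold _root_.dotProduct
  rw [fderiv_fun_sum fun i _ => (hf' i).fun_mul (hg' i), _root_.sum_apply,
    ← Finset.sum_add_distrib]
  refine Finset.sum_congr rfl fun i _ => ?_
  rw [fderiv_fun_mul (hf' i) (hg' i), fderiv_vec_apply hf, fderiv_vec_apply hg]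
  simp only [_root_.add_apply, _root_.smul_apply, smul_eq_mul]
  ring

lemma DifferentiableAt.dotProduct {f g : E → Vec} {x : E} (hf : DifferentiableAt ℝ f x)
    (hg : DifferentiableAt ℝ g x) : DifferentiableAt ℝ (fun y => f y ⬝ᵥ g y) x := by
  have hf' := differentiableAt_pi.1 hf
  have hg' := differentiableAt_pi.1 hg
  unfold _root_.dotProduct
  fun_prop

lemma DifferentiableAt.crossProduct {f g : E → Vec} {x : E} (hf : DifferentiableAt ℝ f x)
    (hg : DifferentiableAt ℝ g x) : DifferentiableAt ℝ (fun y => f y ⨯₃ g y) x := by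
  have hf' := differentiableAt_pi.1 hf
  have hg' := differentiableAt_pi.1 hg
  refine differentiableAt_pi.2 fun i => ?_
  fin_cases i <;> simp only [cross_apply] <;>
    exact ((hf' _).mul (hg' _)).sub ((hf' _).mul (hg' _))

lemma fderiv_crossProduct {f g : E → Vec} {x : E} (hf : DifferentiableAt ℝ f x)
    (hg : DifferentiableAt ℝ g x) (v : E) :
    fderiv ℝ (fun y => f y ⨯₃ g y) x v = fderiv ℝ f x v ⨯₃ g x + f x ⨯₃ fderiv ℝ g x v := by
  have hf' := differentiableAt_pi.1 hf
  have hg' := differentiableAt_pi.1 hg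
  have hfg := hf.crossProduct hg
  ext i
  rw [fderiv_vec_apply hfg]
  have key : ∀ j l, fderiv ℝ (fun y => f y j * g y l - f y l * g y j) x v =
      fderiv ℝ f x v j * g x l - fderiv ℝ f x v l * g x j +
        (f x j * fderiv ℝ g x v l - f x l * fderiv ℝ g x v j) := by
    intro j l
    rw [fderiv_fun_sub ((hf' _).fun_mul (hg' _)) ((hf' _).fun_mul (hg' _)),
      fderiv_fun_mul (hf' _) (hg' _), fderiv_fun_mul (hf' _) (hg' _)]
    simp only [fderiv_vec_apply hf, fderiv_vec_apply hg, _root_.add_apply, _root_.smul_apply,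
      smul_eq_mul, _root_.sub_apply]
    ring
  fin_cases i
  · exact key 1 2
  · exact key 2 0
  · exact key 0 1

end Calculus

/-! ### The mechanical connection -/

lemma inertiaTensor_mulVec (m : Fin 3 → ℝ) (q : Fin 3 → Vec) (u : Vec) :
    inertiaTensor m q *ᵥ u = ∑ a, m a • (q a ⨯₃ (u ⨯₃ q a)) := by
  simp only [inertiaTensor, Matrix.sum_mulVec, Matrix.smul_mulVec, Matrix.sub_mulVec,
    Matrix.one_mulVec, cross_cross_eq_smul_sub_smul', vecMulVec_mulVec]
  simp [dotProduct_comm u]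

/-- The inertia tensor of a noncollinear triangle is invertible. -/
lemma isUnit_det_inertiaTensor {m : Fin 3 → ℝ} (hm : ∀ a, 0 < m a) {q : Fin 3 → Vec}
    (hq : ¬ Collinear ℝ (Set.range q)) : IsUnit (inertiaTensor m q).det := by
  rw [isUnit_iff_ne_zero]
  intro h0
  obtain ⟨u, hu, h⟩ := Matrix.exists_mulVec_eq_zero_iff.2 h0
  have h1 := dot_inertiaTensor m q u
  rw [h, dotProduct_zero] at h1
  have h2 : ∀ a, u ⨯₃ q a = 0 := by
    by_contra hne
    have : (fun a => u ⨯₃ q a) ≠ 0 := fun h' => hne fun a => congrFun h' a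
    exact (polarInertia_pos hm this).ne h1
  refine hq ((collinear_iff_of_mem (Set.mem_range_self 0)).2 ⟨u, ?_⟩)
  have h3 : ∀ a, q a = ((u ⬝ᵥ q a) / (u ⬝ᵥ u)) • u := by
    intro a
    have h4 := cross_cross_eq_smul_sub_smul' u u (q a)
    rw [h2 a, map_zero] at h4
    rw [div_eq_inv_mul, mul_smul, sub_eq_zero.1 h4.symm, smul_smul,
      inv_mul_cancel₀ (dotProduct_self_pos hu).ne', one_smul]
  rintro _ ⟨a, rfl⟩
  refine ⟨(u ⬝ᵥ q a) / (u ⬝ᵥ u) - (u ⬝ᵥ q 0) / (u ⬝ᵥ u), ?_⟩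
  rw [sub_smul, ← h3, ← h3]
  simp

lemma cross_eq_of_normal {n q w : Vec} (hn : n ⬝ᵥ n = 1) (hq : n ⬝ᵥ q = 0) :
    q ⨯₃ w = (n ⬝ᵥ (q ⨯₃ w)) • n - (n ⬝ᵥ w) • (n ⨯₃ q) := by
  have h1 := cross_cross_eq_smul_sub_smul' n n (q ⨯₃ w)
  have h2 := cross_cross_eq_smul_sub_smul' n q w
  rw [h2, hn, one_smul, dotProduct_comm q n, hq, zero_smul, sub_zero, map_smul] at h1
  rw [h1]; abel

lemma dot_angularMomentum (m : Fin 3 → ℝ) (n : Vec) (q v : Fin 3 → Vec) :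
    n ⬝ᵥ angularMomentum m q v = ∑ a, m a * (n ⬝ᵥ (q a ⨯₃ v a)) := by
  simp [angularMomentum, dotProduct_sum]

/-- The angular velocity solving `𝕀 ω = 𝐉` along a motion of an oriented triangle.  Unlike
`𝕀⁻¹ 𝐉`, it makes sense at collinear triangles. -/
lemma inertiaTensor_mulVec_eq_angularMomentum {m : Fin 3 → ℝ} {q q' : Fin 3 → Vec} {n n' : Vec}
    (hI : polarInertia m q ≠ 0) (hn : n ⬝ᵥ n = 1) (hq : ∀ a, n ⬝ᵥ q a = 0)
    (hq' : ∀ a, n' ⬝ᵥ q a + n ⬝ᵥ q' a = 0) :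
    inertiaTensor m q *ᵥ
        ((n ⬝ᵥ angularMomentum m q q' / polarInertia m q) • n + n ⨯₃ n') =
      angularMomentum m q q' := by
  have h1 : inertiaTensor m q *ᵥ n = polarInertia m q • n := by
    rw [inertiaTensor_mulVec, polarInertia, Finset.sum_smul]
    refine Finset.sum_congr rfl fun a _ => ?_
    rw [cross_cross_eq_smul_sub_smul', hq, zero_smul, sub_zero, smul_smul]
  have h2 : ∀ a, q a ⨯₃ ((n ⨯₃ n') ⨯₃ q a) = -((n ⬝ᵥ q' a) • (n ⨯₃ q a)) := by
    intro a
    rw [cross_cross_eq_smul_sub_smul, hq, zero_smul, zero_sub, map_neg, map_smul,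
      ← cross_anticomm n, eq_neg_of_add_eq_zero_left (hq' a), smul_neg, neg_neg, neg_smul]
  rw [Matrix.mulVec_add, Matrix.mulVec_smul, h1, smul_smul, div_mul_cancel₀ _ hI,
    inertiaTensor_mulVec, dot_angularMomentum, angularMomentum, Finset.sum_smul,
    ← Finset.sum_add_distrib]
  refine Finset.sum_congr rfl fun a _ => ?_
  rw [h2]
  conv_rhs => rw [cross_eq_of_normal hn (hq a)]
  rw [smul_sub, smul_neg, smul_smul, smul_smul, sub_eq_add_neg]

lemma angularMomentum_add (m : Fin 3 → ℝ) (q v w : Fin 3 → Vec) :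
    angularMomentum m q (v + w) = angularMomentum m q v + angularMomentum m q w := by
  simp [angularMomentum, Finset.sum_add_distrib]

lemma angularMomentum_smul (m : Fin 3 → ℝ) (q v : Fin 3 → Vec) (r : ℝ) :
    angularMomentum m q (r • v) = r • angularMomentum m q v := by
  simp only [angularMomentum, Pi.smul_apply, map_smul, Finset.smul_sum, smul_comm r]

/-- The one-form `𝐉₀ ⬝ ((n ⬝ 𝐉 / I) n + n × dn)` on the ambient space of pairs `(q, n)`, at the
point `z`.  Its restriction to oriented triangles is the smooth extension of `𝐉₀ ⬝ 𝐀`. -/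
noncomputable def connectionForm (m : Fin 3 → ℝ) (J₀ : Vec) (z : (Fin 3 → Vec) × Vec) :
    ((Fin 3 → Vec) × Vec) →L[ℝ] ℝ :=
  LinearMap.toContinuousLinearMap
    { toFun w := J₀ ⬝ᵥ
        ((z.2 ⬝ᵥ angularMomentum m z.1 w.1 / polarInertia m z.1) • z.2 + z.2 ⨯₃ w.2)
      map_add' v w := by
        simp only [Prod.fst_add, Prod.snd_add, angularMomentum_add, dotProduct_add, map_add,
          dotProduct_smul, smul_eq_mul]
        ring
      map_smul' r w := by
        simp only [Prod.smul_fst, Prod.smul_snd, angularMomentum_smul, dotProduct_smul, map_smul,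
          dotProduct_add, smul_eq_mul, RingHom.id_apply]
        ring }

lemma connectionForm_apply (m : Fin 3 → ℝ) (J₀ : Vec) (z w : (Fin 3 → Vec) × Vec) :
    connectionForm m J₀ z w = J₀ ⬝ᵥ
      ((z.2 ⬝ᵥ angularMomentum m z.1 w.1 / polarInertia m z.1) • z.2 + z.2 ⨯₃ w.2) := rfl

section

variable {E : Type*} [NormedAddCommGroup E] [NormedSpace ℝ E]

lemma ContDiffAt.polarInertia (m : Fin 3 → ℝ) {q : E → Fin 3 → Vec} {x : E}
    (hq : ContDiffAt ℝ ∞ q x) : ContDiffAt ℝ ∞ (fun y => polarInertia m (q y)) x := by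
  have := contDiffAt_pi.1 hq
  unfold _root_.polarInertia
  exact ContDiffAt.sum fun a _ => contDiffAt_const.mul ((this a).dotProduct (this a))

lemma ContDiffAt.angularMomentum (m : Fin 3 → ℝ) {q v : E → Fin 3 → Vec} {x : E}
    (hq : ContDiffAt ℝ ∞ q x) (hv : ContDiffAt ℝ ∞ v x) :
    ContDiffAt ℝ ∞ (fun y => angularMomentum m (q y) (v y)) x := by
  have h1 := contDiffAt_pi.1 hq
  have h2 := contDiffAt_pi.1 hv
  unfold _root_.angularMomentum
  exact ContDiffAt.sum fun a _ => ((h1 a).crossProduct (h2 a)).const_smul (m a)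

lemma ContDiff.connectionForm (m : Fin 3 → ℝ) (J₀ : Vec) {z : E → (Fin 3 → Vec) × Vec}
    (hz : ContDiff ℝ ∞ z) (hI : ∀ y, polarInertia m (z y).1 ≠ 0) :
    ContDiff ℝ ∞ fun y => connectionForm m J₀ (z y) := by
  refine contDiff_clm_apply_iff.2 fun w => contDiff_iff_contDiffAt.2 fun x => ?_
  have h1 := (hz.contDiffAt (x := x)).fst
  have h2 := (hz.contDiffAt (x := x)).snd
  simp only [connectionForm_apply]
  exact contDiffAt_const.dotProduct ((((h2.dotProduct
    (ContDiffAt.angularMomentum m h1 contDiffAt_const)).div (h1.polarInertia m) (hI x)).smul h2).add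
    (h2.crossProduct contDiffAt_const))

end

section Plots

variable {m : Fin 3 → ℝ} {n : ℕ}

lemma polarInertia_qStar_ne_zero (hm : ∀ a, 0 < m a) (x : qStar m) : polarInertia m x.1.1 ≠ 0 :=
  (polarInertia_pos hm x.2.2).ne'

lemma contDiff_connectionForm_comp_fderiv (hm : ∀ a, 0 < m a) (J₀ : Vec)
    {p : EuclideanSpace ℝ (Fin n) → qStar m} (hp : IsPlot p) :
    ContDiff ℝ ∞ fun x => connectionForm m J₀ (p x) ∘L
      fderiv ℝ (fun y => (p y : (Fin 3 → Vec) × Vec)) x := by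
  have hp' : ContDiff ℝ ∞ fun y => (p y : (Fin 3 → Vec) × Vec) := hp
  exact (hp'.connectionForm m J₀ fun y => polarInertia_qStar_ne_zero hm (p y)).clm_comp
    (hp'.fderiv_right (by simp))

/-- The smooth one-form on `Q̃*` that extends `𝐉₀ ⬝ 𝐀`. -/
noncomputable def extendedConnection (m : Fin 3 → ℝ) (hm : ∀ a, 0 < m a) (J₀ : Vec) :
    DForm (qStar m) 1 where
  toFun p _ x := ContinuousAlternatingMap.ofSubsingleton ℝ _ ℝ (0 : Fin 1)
    (connectionForm m J₀ (p x) ∘L fderiv ℝ (fun y => (p y : (Fin 3 → Vec) × Vec)) x)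
  smooth {n} p hp := by
    have h1 := contDiff_connectionForm_comp_fderiv hm J₀ hp
    exact ((ContinuousAlternatingMap.ofSubsingletonLIE (𝕜 := ℝ) (E := EuclideanSpace ℝ (Fin n))
      (F := ℝ) (i := (0 : Fin 1))).toContinuousLinearEquiv.contDiff).comp h1
  compat p hp f hf x := by
    have hp' : ContDiff ℝ ∞ fun y => (p y : (Fin 3 → Vec) × Vec) := hp
    have h1 : fderiv ℝ (fun y => ((p ∘ f) y : (Fin 3 → Vec) × Vec)) x =
        fderiv ℝ (fun y => (p y : (Fin 3 → Vec) × Vec)) (f x) ∘L fderiv ℝ f x :=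
      fderiv_comp x (hp'.contDiffAt.differentiableAt (by simp))
        (hf.contDiffAt.differentiableAt (by simp))
    rw [h1]
    rfl

lemma extendedConnection_apply (hm : ∀ a, 0 < m a) (J₀ : Vec)
    (p : EuclideanSpace ℝ (Fin n) → qStar m) (hp : IsPlot p) (x : EuclideanSpace ℝ (Fin n)) :
    (extendedConnection m hm J₀).toFun p hp x =
      ContinuousAlternatingMap.ofSubsingleton ℝ _ ℝ (0 : Fin 1)
        (connectionForm m J₀ (p x) ∘L fderiv ℝ (fun y => (p y : (Fin 3 → Vec) × Vec)) x) := rfl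

lemma fderiv_position_apply {E : Type*} [NormedAddCommGroup E] [NormedSpace ℝ E]
    {z : E → (Fin 3 → Vec) × Vec} {x : E} (hz : DifferentiableAt ℝ z x) (v : E) (a : Fin 3) :
    (fderiv ℝ z x v).1 a = fderiv ℝ (fun y => (z y).1 a) x v := by
  have : fderiv ℝ (fun y => (z y).1) x v = (fderiv ℝ z x v).1 := by
    rw [hz.hasFDerivAt.fst.fderiv]; rfl
  rw [← this, fderiv_pi fun a => differentiableAt_pi.1 hz.fst a]; rfl

lemma fderiv_normal_apply {E : Type*} [NormedAddCommGroup E] [NormedSpace ℝ E]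
    {z : E → (Fin 3 → Vec) × Vec} {x : E} (hz : DifferentiableAt ℝ z x) (v : E) :
    (fderiv ℝ z x v).2 = fderiv ℝ (fun y => (z y).2) x v := by
  rw [hz.hasFDerivAt.snd.fderiv]; rfl

/-- The velocity of a motion of oriented triangles satisfies the linearized constraints. -/
lemma velocity_constraints {E : Type*} [NormedAddCommGroup E] [NormedSpace ℝ E]
    {z : E → (Fin 3 → Vec) × Vec} {x : E} (hz : DifferentiableAt ℝ z x)
    (hp : ∀ y, z y ∈ orientedTriangles m) (v : E) :
    ∑ a, m a • (fderiv ℝ z x v).1 a = 0 ∧ (z x).2 ⬝ᵥ (fderiv ℝ z x v).2 = 0 ∧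
      ∀ a, (fderiv ℝ z x v).2 ⬝ᵥ (z x).1 a + (z x).2 ⬝ᵥ (fderiv ℝ z x v).1 a = 0 := by
  have h1 : DifferentiableAt ℝ (fun y => (z y).1) x := hz.fst
  have h2 : DifferentiableAt ℝ (fun y => (z y).2) x := hz.snd
  have h1a := differentiableAt_pi.1 h1
  have e1 := fderiv_position_apply hz v
  have e2 := fderiv_normal_apply hz v
  refine ⟨?_, ?_, fun a => ?_⟩
  · have h3 : (fun y => ∑ a, m a • (z y).1 a) = fun _ => 0 := funext fun y => (hp y).1
    have h4 : fderiv ℝ (fun y => ∑ a, m a • (z y).1 a) x v = 0 := by rw [h3]; simp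
    rw [fderiv_fun_sum fun a _ => (h1a a).fun_const_smul (m a)] at h4
    simp only [_root_.sum_apply, fderiv_fun_const_smul (h1a _), _root_.smul_apply] at h4
    simp only [e1, h4]
  · have h3 : (fun y => (z y).2 ⬝ᵥ (z y).2) = fun _ => 1 := funext fun y => (hp y).2.1
    have h4 := fderiv_dotProduct h2 h2 v
    rw [h3, dotProduct_comm (fderiv ℝ _ x v)] at h4
    rw [e2]
    simp at h4
    linarith
  · have h3 : (fun y => (z y).2 ⬝ᵥ (z y).1 a) = fun _ => 0 := funext fun y => (hp y).2.2 a
    have h4 := fderiv_dotProduct h2 (h1a a) v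
    rw [h3] at h4
    rw [e1, e2, ← h4]
    simp

lemma isConnectionComponent_extendedConnection (hm : ∀ a, 0 < m a) (J₀ : Vec) :
    IsConnectionComponent m J₀ (extendedConnection m hm J₀) := by
  intro n p hp x hx v
  have hp' : DifferentiableAt ℝ (fun y => (p y : (Fin 3 → Vec) × Vec)) x :=
    (show ContDiff ℝ ∞ _ from hp).contDiffAt.differentiableAt (by simp)
  obtain ⟨-, -, h3⟩ := velocity_constraints hp' (fun y => (p y).2.1) (v 0)
  rw [extendedConnection_apply, ContinuousAlternatingMap.ofSubsingleton_apply_apply,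
    ContinuousLinearMap.comp_apply, connectionForm_apply, mechanicalConnection]
  have e1 : fderiv ℝ (fun y => (p y).1.1) x (v 0) =
      (fderiv ℝ (fun y => (p y : (Fin 3 → Vec) × Vec)) x (v 0)).1 := by
    rw [hp'.hasFDerivAt.fst.fderiv]; rfl
  rw [e1]
  have h4 := inertiaTensor_mulVec_eq_angularMomentum (polarInertia_qStar_ne_zero hm (p x))
    (p x).2.1.2.1 (p x).2.1.2.2 h3
  conv_rhs => rw [← h4]
  rw [Matrix.mulVec_mulVec, Matrix.nonsing_inv_mul _ (isUnit_det_inertiaTensor hm hx),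
    Matrix.one_mulVec]

end Plots

/-! ### Uniqueness of the extension -/

/-- Twice the oriented area, as a triple product. -/
noncomputable def tripleArea (z : (Fin 3 → Vec) × Vec) : ℝ :=
  z.2 ⬝ᵥ ((z.1 1 - z.1 0) ⨯₃ (z.1 2 - z.1 0))

lemma tripleArea_eq_zero_of_collinear {z : (Fin 3 → Vec) × Vec}
    (h : Collinear ℝ (Set.range z.1)) : tripleArea z = 0 := by
  obtain ⟨v, hv⟩ := (collinear_iff_of_mem (Set.mem_range_self (f := z.1) 0)).1 h
  obtain ⟨r, hr⟩ := hv _ (Set.mem_range_self 1)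
  obtain ⟨s, hs⟩ := hv _ (Set.mem_range_self 2)
  simp [tripleArea, hr, hs]

/-- A deformation of an oriented triangle within its plane that makes collinear triangles
noncollinear. -/
noncomputable def planarShear (m : Fin 3 → ℝ) (z : (Fin 3 → Vec) × Vec) (s : ℝ) :
    (Fin 3 → Vec) × Vec :=
  (fun a => z.1 a + (s / m a) • (z.2 ⨯₃ (z.1 (a + 1) - z.1 (a + 2))), z.2)

lemma planarShear_zero (m : Fin 3 → ℝ) (z : (Fin 3 → Vec) × Vec) : planarShear m z 0 = z := by
  simp [planarShear]

lemma planarShear_mem {m : Fin 3 → ℝ} (hm : ∀ a, 0 < m a) {z : (Fin 3 → Vec) × Vec}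
    (hz : z ∈ orientedTriangles m) (s : ℝ) : planarShear m z s ∈ orientedTriangles m := by
  obtain ⟨h1, h2, h3⟩ := hz
  refine ⟨?_, h2, fun a => ?_⟩
  · have : ∀ a, m a • (planarShear m z s).1 a =
        m a • z.1 a + s • (z.2 ⨯₃ (z.1 (a + 1) - z.1 (a + 2))) := by
      intro a
      simp only [planarShear, smul_add, smul_smul]
      rw [mul_div_cancel₀ _ (hm a).ne']
    simp only [this, Finset.sum_add_distrib, h1, ← Finset.smul_sum, ← map_sum]
    simp [Fin.sum_univ_three]
    right; abel
  · simp [planarShear, h3]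

/-- The mass-weighted pairing of a triangle with its shear, which detects that the shear does not
vanish. -/
lemma sum_dot_planarShear {m : Fin 3 → ℝ} (hm : ∀ a, 0 < m a) (z : (Fin 3 → Vec) × Vec) (s : ℝ) :
    ∑ a, m a * (z.1 a ⬝ᵥ (planarShear m z s).1 a) =
      polarInertia m z.1 - 2 * s * tripleArea z := by
  have : ∀ a, m a * (z.1 a ⬝ᵥ (planarShear m z s).1 a) =
      m a * (z.1 a ⬝ᵥ z.1 a) + s * (z.1 a ⬝ᵥ (z.2 ⨯₃ (z.1 (a + 1) - z.1 (a + 2)))) := by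
    intro a
    have := (hm a).ne'
    simp only [planarShear, dotProduct_add, dotProduct_smul, smul_eq_mul]
    field_simp
  simp only [this, Finset.sum_add_distrib, ← Finset.mul_sum, polarInertia]
  simp [tripleArea, Fin.sum_univ_three, cross_apply, dotProduct]
  ring

lemma dot_cross_add_normal_cross {n u v : Vec} (hn : n ⬝ᵥ n = 1) (hu : n ⬝ᵥ u = 0)
    (hv : n ⬝ᵥ v = 0) (U V : Vec) :
    n ⬝ᵥ ((u + n ⨯₃ U) ⨯₃ (v + n ⨯₃ V)) =
      n ⬝ᵥ (u ⨯₃ v) + u ⬝ᵥ V - v ⬝ᵥ U + n ⬝ᵥ (U ⨯₃ V) := by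
  have h1 : ∀ x W : Vec, n ⬝ᵥ x = 0 → n ⬝ᵥ (x ⨯₃ (n ⨯₃ W)) = x ⬝ᵥ W := by
    intro x W hx
    rw [cross_cross_eq_smul_sub_smul', hx, zero_smul, sub_zero, dotProduct_smul, hn]
    simp
  have h2 : n ⬝ᵥ ((n ⨯₃ U) ⨯₃ (n ⨯₃ V)) = n ⬝ᵥ (U ⨯₃ V) := by
    rw [cross_cross_eq_smul_sub_smul, dotProduct_sub, dotProduct_smul, dotProduct_smul,
      dot_self_cross, hn, zero_smul, zero_sub, smul_eq_mul, mul_one, ← triple_product_permutation V,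
      ← triple_product_permutation n, ← cross_anticomm V, dotProduct_neg]
  rw [map_add, map_add, LinearMap.add_apply, LinearMap.add_apply]
  simp only [dotProduct_add]
  rw [h1 u V hu, h2, ← cross_anticomm v (n ⨯₃ U), dotProduct_neg, h1 v U hv]
  ring

/-- The area of the shear of a collinear triangle is proportional to the parameter, with a nonzero
coefficient. -/
lemma tripleArea_planarShear {m : Fin 3 → ℝ} {z : (Fin 3 → Vec) × Vec}
    (hz : z ∈ orientedTriangles m) (hA : tripleArea z = 0) (s : ℝ) :
    tripleArea (planarShear m z s) = -(s * ∑ a,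
      (m a)⁻¹ * ((z.1 (a + 1) - z.1 (a + 2)) ⬝ᵥ (z.1 (a + 1) - z.1 (a + 2)))) := by
  obtain ⟨-, h2, h3⟩ := hz
  obtain ⟨q, n⟩ := z
  simp only at h2 h3
  set x := q 2 - q 0 with hx
  set y := q 0 - q 1 with hy
  have e0 : q 1 - q 2 = -x - y := by rw [hx, hy]; abel
  have hA' : n ⬝ᵥ (x ⨯₃ y) = 0 := by
    rw [← hA, tripleArea, ← hx, show q 1 - q 0 = -y by rw [hy]; abel]
    simp
  have hA'' : n ⬝ᵥ (y ⨯₃ x) = 0 := by rw [← cross_anticomm, dotProduct_neg, hA', neg_zero]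
  have e1 : (planarShear m (q, n) s).1 1 - (planarShear m (q, n) s).1 0 =
      -y + n ⨯₃ ((s / m 1) • x - (s / m 0) • (-x - y)) := by
    rw [← e0, hx, hy]
    simp only [planarShear, map_sub, map_smul, Fin.isValue, zero_add, smul_sub,
      show (1 : Fin 3) + 1 = 2 from rfl, show (1 : Fin 3) + 2 = 0 from rfl]
    abel
  have e2 : (planarShear m (q, n) s).1 2 - (planarShear m (q, n) s).1 0 =
      x + n ⨯₃ ((s / m 2) • y - (s / m 0) • (-x - y)) := by
    rw [← e0, hx, hy]
    simp only [planarShear, map_sub, map_smul, Fin.isValue, zero_add, smul_sub,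
      show (2 : Fin 3) + 1 = 0 from rfl, show (2 : Fin 3) + 2 = 1 from rfl]
    abel
  rw [tripleArea, e1, e2, show (planarShear m (q, n) s).2 = n from rfl,
    dot_cross_add_normal_cross h2 (by rw [hy]; simp [h3]) (by rw [hx]; simp [h3])]
  simp only [Fin.sum_univ_three, Fin.isValue, zero_add, show (1 : Fin 3) + 1 = 2 from rfl,
    show (1 : Fin 3) + 2 = 0 from rfl, show (2 : Fin 3) + 1 = 0 from rfl,
    show (2 : Fin 3) + 2 = 1 from rfl, e0, ← hx, ← hy]
  have hxy := dotProduct_comm x y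
  simp only [map_sub, map_smul, map_neg, LinearMap.sub_apply, LinearMap.smul_apply,
    LinearMap.neg_apply, dotProduct_sub, dotProduct_smul, dotProduct_neg, sub_dotProduct,
    neg_dotProduct, cross_self, hA', hA'', hxy, dotProduct_zero, smul_eq_mul]
  ring

section

variable {m : Fin 3 → ℝ} {n : ℕ}

/-- With a parameter that is bounded in terms of the area and equivalent to `t I` for small `t`, the
shear is never a triple collision. -/
lemma planarShear_mem_qStar (hm : ∀ a, 0 < m a) {z : (Fin 3 → Vec) × Vec} (hz : z ∈ qStar m)
    (t : ℝ) : planarShear m z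
      (t * polarInertia m z.1 / (1 + (2 * t * tripleArea z) ^ 2)) ∈ qStar m := by
  refine ⟨planarShear_mem hm hz.1 _, fun h0 => ?_⟩
  have h1 := sum_dot_planarShear hm z (t * polarInertia m z.1 / (1 + (2 * t * tripleArea z) ^ 2))
  have hI := polarInertia_pos hm hz.2
  rw [h0] at h1
  simp only [Pi.zero_apply, dotProduct_zero, mul_zero, Finset.sum_const_zero] at h1
  have h2 : polarInertia m z.1 * (1 + (2 * t * tripleArea z) ^ 2 - 2 * t * tripleArea z) = 0 := by
    field_simp at h1
    linarith
  rcases mul_eq_zero.1 h2 with h | h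
  · exact hI.ne' h
  · nlinarith [sq_nonneg (2 * t * tripleArea z - 1 / 2)]

/-- A smooth one-form on `Q̃*` is determined by its values at noncollinear triangles: every plot is
the restriction to `t = 0` of a plot that is noncollinear for small `t ≠ 0`. -/
lemma DForm.eq_of_noncollinear (hm : ∀ a, 0 < m a) {α β : DForm (qStar m) 1}
    (h : ∀ {n : ℕ} (p : EuclideanSpace ℝ (Fin n) → qStar m) (hp : IsPlot p) (x),
      ¬ Collinear ℝ (Set.range (p x).1.1) → α.toFun p hp x = β.toFun p hp x) : α = β := by
  have key : ∀ {n : ℕ} (p : EuclideanSpace ℝ (Fin n) → qStar m) (hp : IsPlot p) (x),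
      α.toFun p hp x = β.toFun p hp x := by
    intro n p hp x
    by_cases hx : Collinear ℝ (Set.range (p x).1.1)
    swap
    · exact h p hp x hx
    have hp' : ContDiff ℝ ∞ fun y => (p y : (Fin 3 → Vec) × Vec) := hp
    let pr : EuclideanSpace ℝ (Fin (n + 1)) → EuclideanSpace ℝ (Fin n) :=
      fun y => WithLp.toLp 2 fun i => y i.castSucc
    let emb : ℝ → EuclideanSpace ℝ (Fin n) → EuclideanSpace ℝ (Fin (n + 1)) :=
      fun t y => WithLp.toLp 2 (Fin.snoc (fun i => y i) t : Fin (n + 1) → ℝ)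
    have hpr : ContDiff ℝ ∞ pr := by
      refine contDiff_euclidean.2 fun i => ?_
      fun_prop
    have hemb : ∀ t, ContDiff ℝ ∞ (emb t) := by
      intro t
      refine contDiff_euclidean.2 fun i => ?_
      refine Fin.lastCases ?_ (fun j => ?_) i
      · simp only [emb, Fin.snoc_last]; exact contDiff_const
      · simp only [emb, Fin.snoc_castSucc]; fun_prop
    have hembt : Continuous fun t => emb t x := by
      refine (PiLp.continuous_toLp 2 _).comp (continuous_pi fun i => ?_)
      refine Fin.lastCases ?_ (fun j => ?_) i
      · simp only [Fin.snoc_last]; exact continuous_id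
      · simp only [Fin.snoc_castSucc]; exact continuous_const
    have hpe : ∀ t y, pr (emb t y) = y := by
      intro t y; ext i; simp [pr, emb]
    have hel : ∀ t y, (emb t y) (Fin.last n) = t := by
      intro t y; simp [emb]
    let P : EuclideanSpace ℝ (Fin (n + 1)) → qStar m := fun y =>
      ⟨_, planarShear_mem_qStar hm (p (pr y)).2 (y (Fin.last n))⟩
    have hP : IsPlot P := by
      change ContDiff ℝ ∞ fun y => planarShear m (p (pr y)) _
      refine contDiff_iff_contDiffAt.2 fun y => ?_
      have hz : ContDiffAt ℝ ∞ (fun y => (p (pr y) : (Fin 3 → Vec) × Vec)) y :=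
        (hp'.comp hpr).contDiffAt
      have hq : ∀ a, ContDiffAt ℝ ∞ (fun y => (p (pr y) : (Fin 3 → Vec) × Vec).1 a) y :=
        fun a => contDiffAt_pi.1 hz.fst a
      have ht : ContDiffAt ℝ ∞ (fun y : EuclideanSpace ℝ (Fin (n + 1)) => y (Fin.last n)) y := by
        fun_prop
      have hA : ContDiffAt ℝ ∞ (fun y => tripleArea (p (pr y))) y :=
        hz.snd.dotProduct (((hq 1).sub (hq 0)).crossProduct ((hq 2).sub (hq 0)))
      refine ContDiffAt.prodMk (contDiffAt_pi.2 fun a => ?_) hz.snd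
      refine (hq a).add (ContDiffAt.fun_smul ?_ (hz.snd.crossProduct ((hq _).sub (hq _))))
      refine ContDiffAt.div_const ?_ _
      exact (ht.mul (hz.fst.polarInertia m)).div
        (contDiffAt_const.add (((contDiffAt_const.mul ht).mul hA).pow 2)) (by positivity)
    have hPe : P ∘ emb 0 = p := by
      funext y
      apply Subtype.ext
      simp only [P, Function.comp_apply, hpe, hel, zero_mul, zero_div, planarShear_zero]
    have hA0 := tripleArea_eq_zero_of_collinear hx
    have hd : 0 < ∑ a, (m a)⁻¹ * (((p x).1.1 (a + 1) - (p x).1.1 (a + 2)) ⬝ᵥ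
        ((p x).1.1 (a + 1) - (p x).1.1 (a + 2))) := by
      have hnn : ∀ a ∈ Finset.univ, 0 ≤ (m a)⁻¹ * (((p x).1.1 (a + 1) - (p x).1.1 (a + 2)) ⬝ᵥ
        ((p x).1.1 (a + 1) - (p x).1.1 (a + 2))) := fun a _ =>
          mul_nonneg (inv_pos.2 (hm a)).le (vec_dot_self_nonneg _)
      refine (Finset.sum_nonneg hnn).lt_of_ne fun h0 => ?_
      have h1 := (Finset.sum_eq_zero_iff_of_nonneg hnn).1 h0.symm
      have h2 : ∀ a, (p x).1.1 (a + 1) = (p x).1.1 (a + 2) := by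
        intro a
        by_contra hne
        exact (mul_pos (inv_pos.2 (hm a)) (dotProduct_self_pos (sub_ne_zero.2 hne))).ne'
          (h1 a (Finset.mem_univ _))
      have e1 : (p x).1.1 1 = (p x).1.1 0 := (h2 2).symm
      have e2 : (p x).1.1 2 = (p x).1.1 0 := h2 1
      have h3 := (p x).2.1.1
      rw [Fin.sum_univ_three, e1, e2, ← add_smul, ← add_smul] at h3
      have h4 : (p x).1.1 0 = 0 := (smul_eq_zero.1 h3).resolve_left
        (add_pos (add_pos (hm 0) (hm 1)) (hm 2)).ne'
      refine (p x).2.2 (funext fun a => ?_)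
      fin_cases a
      · exact h4
      · exact e1.trans h4
      · exact e2.trans h4
    have hnc : ∀ t, t ≠ 0 → α.toFun P hP (emb t x) = β.toFun P hP (emb t x) := by
      intro t ht
      refine h P hP _ fun hc => ?_
      have h1 := tripleArea_eq_zero_of_collinear hc
      have h2 := tripleArea_planarShear (p x).2.1 hA0
        (t * polarInertia m (p x).1.1 / (1 + (2 * t * tripleArea (p x).1) ^ 2))
      simp only [P, hpe, hel] at h1
      rw [h1, hA0] at h2
      have := mul_ne_zero ht (polarInertia_qStar_ne_zero hm (p x))
      rcases mul_eq_zero.1 (neg_eq_zero.1 h2.symm) with h3 | h3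
      · exact (div_ne_zero this (by positivity)) h3
      · exact hd.ne' h3
    have hlim : α.toFun P hP (emb 0 x) = β.toFun P hP (emb 0 x) := by
      have c1 : Continuous fun t => α.toFun P hP (emb t x) := (α.smooth P hP).continuous.comp hembt
      have c2 : Continuous fun t => β.toFun P hP (emb t x) := (β.smooth P hP).continuous.comp hembt
      exact congrFun (c1.ext_on (dense_compl_singleton (0 : ℝ)) c2 hnc) 0
    have hα := α.compat P hP (emb 0) (hemb 0) x
    have hβ := β.compat P hP (emb 0) (hemb 0) x
    rw [hlim, ← hβ] at hα
    simpa only [hPe] using hα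
  ext n p hp x : 5
  exact key p hp x

lemma IsConnectionComponent.eq (hm : ∀ a, 0 < m a) {J₀ : Vec} {α β : DForm (qStar m) 1}
    (hα : IsConnectionComponent m J₀ α) (hβ : IsConnectionComponent m J₀ β) : α = β :=
  DForm.eq_of_noncollinear hm fun p hp x hx => by
    ext v
    rw [hα p hp x hx v, hβ p hp x hx v]

end

/-! ### Rotations -/

section Rotation

variable {R : Matrix (Fin 3) (Fin 3) ℝ}

lemma transpose_mul_self_of_mem (hR : R ∈ Matrix.specialOrthogonalGroup (Fin 3) ℝ) :
    Rᵀ * R = 1 :=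
  (Matrix.mem_orthogonalGroup_iff' (Fin 3) ℝ).1 (Matrix.mem_specialOrthogonalGroup_iff.1 hR).1

lemma rotation_dot (hR : R ∈ Matrix.specialOrthogonalGroup (Fin 3) ℝ) (u v : Vec) :
    (R *ᵥ u) ⬝ᵥ (R *ᵥ v) = u ⬝ᵥ v := by
  rw [Matrix.dotProduct_mulVec, Matrix.vecMul_mulVec, transpose_mul_self_of_mem hR,
    Matrix.vecMul_one]

lemma rotation_cross (hR : R ∈ Matrix.specialOrthogonalGroup (Fin 3) ℝ) (u v : Vec) :
    (R *ᵥ u) ⨯₃ (R *ᵥ v) = R *ᵥ (u ⨯₃ v) := by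
  have hR' := transpose_mul_self_of_mem hR
  have hR'' : R * Rᵀ = 1 := mul_eq_one_comm.1 hR'
  have hdet : R.det = 1 := (Matrix.mem_specialOrthogonalGroup_iff.1 hR).2
  have key : ∀ w : Vec, (R *ᵥ w) ⬝ᵥ ((R *ᵥ u) ⨯₃ (R *ᵥ v)) = (R *ᵥ w) ⬝ᵥ (R *ᵥ (u ⨯₃ v)) := by
    intro w
    rw [rotation_dot hR, triple_product_eq_det, triple_product_eq_det]
    have : Matrix.of ![R *ᵥ w, R *ᵥ u, R *ᵥ v] = Matrix.of ![w, u, v] * Rᵀ := by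
      ext i j
      fin_cases i <;> simp [Matrix.mul_apply, Matrix.mulVec, dotProduct, mul_comm]
    have h := congrArg Matrix.det this
    rwa [Matrix.det_mul, Matrix.det_transpose, hdet, mul_one] at h
  refine dotProduct_eq _ _ fun w => ?_
  have := key (Rᵀ *ᵥ w)
  rw [Matrix.mulVec_mulVec, hR'', Matrix.one_mulVec] at this
  rw [dotProduct_comm, this, dotProduct_comm]

/-- The rotation about the unit vector `k` through the angle with cosine `c` and sine `s`. -/
noncomputable def axialTurn (k : Vec) (c s : ℝ) (u : Vec) : Vec :=
  c • u + ((1 - c) * (k ⬝ᵥ u)) • k + s • (k ⨯₃ u)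

/-- Rotations that fix `k` are turns about `k`. -/
lemma exists_axialTurn (hR : R ∈ Matrix.specialOrthogonalGroup (Fin 3) ℝ) {k : Vec}
    (hk : k ⬝ᵥ k = 1) (hRk : R *ᵥ k = k) :
    ∃ c s : ℝ, c ^ 2 + s ^ 2 = 1 ∧ ∀ u, R *ᵥ u = axialTurn k c s u := by
  obtain ⟨e₁, e₂, h⟩ := exists_isRightFrame hk
  have h0 : (R *ᵥ e₁) ⬝ᵥ k = 0 := by
    conv_lhs => rw [← hRk]
    rw [rotation_dot hR, h.fst_normal]
  have h1 : R *ᵥ e₁ = ((R *ᵥ e₁) ⬝ᵥ e₁) • e₁ + ((R *ᵥ e₁) ⬝ᵥ e₂) • e₂ := by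
    conv_lhs => rw [h.expand (R *ᵥ e₁), h0]
    simp
  set c := (R *ᵥ e₁) ⬝ᵥ e₁
  set s := (R *ᵥ e₁) ⬝ᵥ e₂
  have h2 : R *ᵥ e₂ = c • e₂ - s • e₁ := by
    rw [← h.normal_cross_fst, ← rotation_cross hR, hRk, h1, map_add, map_smul, map_smul,
      h.normal_cross_fst, h.normal_cross_snd, smul_neg, sub_eq_add_neg]
  refine ⟨c, s, ?_, fun u => ?_⟩
  · have h3 := rotation_dot hR e₁ e₁
    rw [h1, h.fst] at h3
    simp [h.fst, h.snd, h.perp, h.perp'] at h3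
    linarith
  · rw [axialTurn]
    conv_lhs => rw [h.expand u]
    conv_rhs => rw [h.expand u]
    simp only [Matrix.mulVec_add, Matrix.mulVec_smul, h1, h2, hRk, map_add, map_smul,
      h.normal_cross_fst, h.normal_cross_snd, cross_self, dotProduct_add, dotProduct_smul,
      h.normal_fst, h.normal_snd, hk]
    module

lemma dot_axialTurn {k : Vec} (c s : ℝ) (u : Vec) :
    u ⬝ᵥ axialTurn k c s u = c * (u ⬝ᵥ u - (k ⬝ᵥ u) ^ 2) + (k ⬝ᵥ u) ^ 2 := by
  simp only [axialTurn, dotProduct_add, dotProduct_smul, dot_cross_self, smul_eq_mul,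
    dotProduct_comm u k]
  ring

lemma cross_dot_axialTurn {k : Vec} (hk : k ⬝ᵥ k = 1) (c s : ℝ) (u : Vec) :
    (k ⨯₃ u) ⬝ᵥ axialTurn k c s u = s * (u ⬝ᵥ u - (k ⬝ᵥ u) ^ 2) := by
  have h1 : (k ⨯₃ u) ⬝ᵥ u = 0 := by rw [dotProduct_comm, dot_cross_self]
  have h2 : (k ⨯₃ u) ⬝ᵥ k = 0 := by rw [dotProduct_comm, dot_self_cross]
  simp only [axialTurn, dotProduct_add, dotProduct_smul, h1, h2, cross_dot_cross, hk, smul_eq_mul,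
    dotProduct_comm u k]
  ring

section

variable {E : Type*} [NormedAddCommGroup E] [NormedSpace ℝ E]

/-- The derivative of a turned vector: the turned derivative plus the rotation at the angular
speed `c ds - s dc`. -/
lemma fderiv_axialTurn {k : Vec} (hk : k ⬝ᵥ k = 1) {c s : E → ℝ} {u : E → Vec} {x : E}
    (hc : DifferentiableAt ℝ c x) (hs : DifferentiableAt ℝ s x) (hu : DifferentiableAt ℝ u x)
    (hcs : ∀ᶠ y in 𝓝 x, c y ^ 2 + s y ^ 2 = 1) (v : E) :
    fderiv ℝ (fun y => axialTurn k (c y) (s y) (u y)) x v =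
      axialTurn k (c x) (s x) (fderiv ℝ u x v) +
        angleForm c s x v • (k ⨯₃ axialTurn k (c x) (s x) (u x)) := by
  have h0 := hcs.self_of_nhds
  have h1 : c x * fderiv ℝ c x v + s x * fderiv ℝ s x v = 0 := by
    have h2 : (fun y => c y ^ 2 + s y ^ 2) =ᶠ[𝓝 x] fun _ => 1 := hcs
    have h3 : fderiv ℝ (fun y => c y ^ 2 + s y ^ 2) x v = 0 := by rw [h2.fderiv_eq]; simp
    rw [fderiv_fun_add (hc.fun_pow 2) (hs.fun_pow 2), fderiv_fun_pow 2 hc,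
      fderiv_fun_pow 2 hs] at h3
    simp at h3
    linarith
  have e1 : angleForm c s x v * c x = fderiv ℝ s x v := by
    rw [angleForm_apply, h0]
    linear_combination (-s x) * h1 + fderiv ℝ s x v * h0
  have e2 : angleForm c s x v * s x = -fderiv ℝ c x v := by
    rw [angleForm_apply, h0]
    linear_combination (c x) * h1 - fderiv ℝ c x v * h0
  have hk' : DifferentiableAt ℝ (fun _ : E => k) x := differentiableAt_const _
  have hku := hk'.dotProduct hu
  have hkc := hk'.crossProduct hu
  have hmul : DifferentiableAt ℝ (fun y => (1 - c y) * (k ⬝ᵥ u y)) x := by fun_prop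
  have e3 : fderiv ℝ (fun y => axialTurn k (c y) (s y) (u y)) x v =
      (c x • fderiv ℝ u x v + fderiv ℝ c x v • u x) +
      ((1 - c x) * (k ⬝ᵥ fderiv ℝ u x v) - fderiv ℝ c x v * (k ⬝ᵥ u x)) • k +
      (s x • (k ⨯₃ fderiv ℝ u x v) + fderiv ℝ s x v • (k ⨯₃ u x)) := by
    unfold axialTurn
    rw [fderiv_fun_add ((hc.fun_smul hu).fun_add (hmul.fun_smul hk')) (hs.fun_smul hkc),
      fderiv_fun_add (hc.fun_smul hu) (hmul.fun_smul hk'), fderiv_fun_smul hc hu,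
      fderiv_fun_smul hmul hk', fderiv_fun_smul hs hkc]
    simp only [_root_.add_apply, _root_.smul_apply, ContinuousLinearMap.smulRight_apply,
      fderiv_crossProduct hk' hu, fderiv_fun_const, Pi.zero_apply, _root_.zero_apply, map_zero,
      LinearMap.zero_apply, zero_add, smul_zero]
    rw [fderiv_fun_mul (by fun_prop) hku]
    simp only [_root_.add_apply, _root_.smul_apply, fderiv_dotProduct hk' hu, fderiv_fun_const,
      fderiv_const_sub, _root_.neg_apply,
      Pi.zero_apply, _root_.zero_apply, zero_dotProduct, zero_add, smul_eq_mul]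
    module
  rw [e3]
  have e4 : k ⨯₃ axialTurn k (c x) (s x) (u x) =
      c x • (k ⨯₃ u x) + s x • ((k ⬝ᵥ u x) • k - u x) := by
    simp only [axialTurn, map_add, map_smul, cross_self, smul_zero, add_zero,
      cross_cross_eq_smul_sub_smul', hk, one_smul]
  rw [e4, smul_add, smul_smul, smul_smul, e1, e2]
  unfold axialTurn
  module

end

end Rotation

/-! ### The exterior derivative of the connection form is basic -/

lemma polarInertia_rotation (m : Fin 3 → ℝ) {R : Matrix (Fin 3) (Fin 3) ℝ}
    (hR : R ∈ Matrix.specialOrthogonalGroup (Fin 3) ℝ) (q : Fin 3 → Vec) :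
    polarInertia m (fun a => R *ᵥ q a) = polarInertia m q := by
  simp only [polarInertia, rotation_dot hR]

/-- If a motion is composed with a rotation about the axis `k` of `𝐉₀ = l k` that turns at the
angular speed `κ`, the value of the form on the velocity changes by `l κ`. -/
lemma connectionForm_rotation {m : Fin 3 → ℝ} {J₀ : Vec} {R : Matrix (Fin 3) (Fin 3) ℝ}
    (hR : R ∈ Matrix.specialOrthogonalGroup (Fin 3) ℝ) {k : Vec} (hk : k ⬝ᵥ k = 1) {l : ℝ}
    (hJ : J₀ = l • k) (hRk : R *ᵥ k = k) {q q' : Fin 3 → Vec} {n n' : Vec}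
    (hI : polarInertia m q ≠ 0) (hn : n ⬝ᵥ n = 1) (hq : ∀ a, n ⬝ᵥ q a = 0) (κ : ℝ) :
    connectionForm m J₀ (fun a => R *ᵥ q a, R *ᵥ n)
        (fun a => R *ᵥ q' a + κ • (k ⨯₃ (R *ᵥ q a)), R *ᵥ n' + κ • (k ⨯₃ (R *ᵥ n))) =
      connectionForm m J₀ (q, n) (q', n') + l * κ := by
  have hkR : ∀ u, k ⬝ᵥ (R *ᵥ u) = k ⬝ᵥ u := fun u => by
    conv_lhs => rw [← hRk]
    rw [rotation_dot hR]
  have h1 : ∀ a, (R *ᵥ n) ⬝ᵥ ((R *ᵥ q a) ⨯₃ (R *ᵥ q' a + κ • (k ⨯₃ (R *ᵥ q a)))) =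
      n ⬝ᵥ (q a ⨯₃ q' a) + κ * (q a ⬝ᵥ q a * (k ⬝ᵥ n)) := by
    intro a
    rw [map_add, map_smul, dotProduct_add, dotProduct_smul, rotation_cross hR, rotation_dot hR,
      cross_cross_eq_smul_sub_smul', dotProduct_sub, dotProduct_smul, dotProduct_smul,
      rotation_dot hR, rotation_dot hR, hq, dotProduct_comm (R *ᵥ n), hkR]
    simp
  have h2 : (R *ᵥ n) ⬝ᵥ angularMomentum m (fun a => R *ᵥ q a)
      (fun a => R *ᵥ q' a + κ • (k ⨯₃ (R *ᵥ q a))) =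
      n ⬝ᵥ angularMomentum m q q' + κ * (polarInertia m q * (k ⬝ᵥ n)) := by
    simp only [dot_angularMomentum, h1, polarInertia, mul_add, Finset.sum_add_distrib,
      Finset.mul_sum, Finset.sum_mul]
    congr 1
    exact Finset.sum_congr rfl fun _ _ => by ring
  have h3 : k ⬝ᵥ ((R *ᵥ n) ⨯₃ (R *ᵥ n' + κ • (k ⨯₃ (R *ᵥ n)))) =
      k ⬝ᵥ (n ⨯₃ n') + κ * (1 - (k ⬝ᵥ n) ^ 2) := by
    rw [map_add, map_smul, dotProduct_add, dotProduct_smul, rotation_cross hR, hkR,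
      cross_cross_eq_smul_sub_smul', dotProduct_sub, dotProduct_smul, dotProduct_smul,
      rotation_dot hR, hkR, hk, hn]
    simp only [smul_eq_mul]
    ring
  simp only [connectionForm_apply, hJ, smul_dotProduct, dotProduct_add, dotProduct_smul, h2, h3,
    polarInertia_rotation m hR, hkR, smul_eq_mul]
  field_simp
  ring

/-- The form is invariant under variable homotheties. -/
lemma connectionForm_homothety {m : Fin 3 → ℝ} {J₀ : Vec} {q q' : Fin 3 → Vec} {n n' : Vec}
    {r : ℝ} (hr : r ≠ 0) (r' : ℝ) :
    connectionForm m J₀ (r • q, n) (r • q' + r' • q, n') = connectionForm m J₀ (q, n) (q', n') := by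
  have h1 : angularMomentum m (r • q) (r • q' + r' • q) = (r * r) • angularMomentum m q q' := by
    simp only [angularMomentum, Pi.add_apply, Pi.smul_apply, map_add, map_smul,
      LinearMap.smul_apply, cross_self, smul_zero, add_zero, Finset.smul_sum, smul_smul]
    exact Finset.sum_congr rfl fun _ _ => by congr 1; ring
  have h2 : polarInertia m (r • q) = (r * r) * polarInertia m q := by
    simp only [polarInertia, Pi.smul_apply, dotProduct_smul, smul_dotProduct, smul_eq_mul,
      Finset.mul_sum]
    exact Finset.sum_congr rfl fun _ _ => by ring
  simp only [connectionForm_apply, h1, h2, dotProduct_smul, smul_eq_mul]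
  rw [mul_div_mul_left _ _ (mul_ne_zero hr hr)]

/-! ### Lifts to normalized triangles and the reduced form -/

section Basic

variable {m : Fin 3 → ℝ} {n : ℕ}

lemma extendedConnection_d_apply (hm : ∀ a, 0 < m a) (J₀ : Vec)
    (p : EuclideanSpace ℝ (Fin n) → qStar m) (hp : IsPlot p) (x : EuclideanSpace ℝ (Fin n))
    (v : Fin 2 → EuclideanSpace ℝ (Fin n)) :
    (extendedConnection m hm J₀).d.toFun p hp x v =
      curl (fun x => connectionForm m J₀ (p x) ∘L
        fderiv ℝ (fun y => (p y : (Fin 3 → Vec) × Vec)) x) x v :=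
  extDeriv_ofSubsingleton ((contDiff_connectionForm_comp_fderiv hm J₀ hp).differentiable
    (by simp) x) v

/-- Normalized oriented triangles as oriented triangles. -/
def sFiveInclusion (m : Fin 3 → ℝ) (x : sFive m) : qStar m :=
  ⟨x.1, x.2.1, fun h => by simpa [polarInertia, h] using x.2.2⟩

lemma isPlot_sFiveInclusion {p : EuclideanSpace ℝ (Fin n) → sFive m} (hp : IsPlot p) :
    IsPlot (sFiveInclusion m ∘ p) := hp

lemma rescale_sFiveInclusion (hm : ∀ a, 0 < m a) (x : sFive m) :
    rescale m hm (sFiveInclusion m x) = x := by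
  apply Subtype.ext
  simp [rescale, sFiveInclusion, x.2.2]

lemma reducedProj_sFiveInclusion (hm : ∀ a, 0 < m a) (J₀ : Vec) (x : sFive m) :
    reducedProj m hm J₀ (sFiveInclusion m x) = reducedClass m J₀ x := by
  rw [reducedProj, rescale_sFiveInclusion]

lemma isPlot_rescale (hm : ∀ a, 0 < m a) {p : EuclideanSpace ℝ (Fin n) → qStar m}
    (hp : IsPlot p) : IsPlot (rescale m hm ∘ p) := by
  have hp' : ContDiff ℝ ∞ fun x => (p x : (Fin 3 → Vec) × Vec) := hp
  change ContDiff ℝ ∞ fun x => (rescale m hm (p x) : (Fin 3 → Vec) × Vec)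
  refine contDiff_iff_contDiffAt.2 fun x => ?_
  have h1 := (hp'.contDiffAt (x := x)).fst
  have hI := (hp'.contDiffAt (x := x)).fst.polarInertia m
  have h0 := polarInertia_pos hm (p x).2.2
  exact (((hI.sqrt h0.ne').inv (Real.sqrt_pos.2 h0).ne').smul h1).prodMk
    (hp'.contDiffAt (x := x)).snd

lemma extendedConnection_rescale (hm : ∀ a, 0 < m a) (J₀ : Vec)
    (p : EuclideanSpace ℝ (Fin n) → qStar m) (hp : IsPlot p) :
    (extendedConnection m hm J₀).toFun (sFiveInclusion m ∘ rescale m hm ∘ p)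
      (isPlot_sFiveInclusion (isPlot_rescale hm hp)) = (extendedConnection m hm J₀).toFun p hp := by
  funext x
  rw [extendedConnection_apply, extendedConnection_apply]
  congr 1
  ext v
  have hp' : ContDiffAt ℝ ∞ (fun x => (p x : (Fin 3 → Vec) × Vec)) x :=
    (show ContDiff ℝ ∞ _ from hp).contDiffAt
  have h0 := polarInertia_pos hm (p x).2.2
  have hr : ContDiffAt ℝ ∞ (fun y => (√(polarInertia m (p y).1.1))⁻¹) x :=
    ((hp'.fst.polarInertia m).sqrt h0.ne').inv (Real.sqrt_pos.2 h0).ne'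
  have hr' := hr.differentiableAt (by simp)
  have hd := hp'.differentiableAt (by simp)
  have e : fderiv ℝ (fun y => ((sFiveInclusion m ∘ rescale m hm ∘ p) y : (Fin 3 → Vec) × Vec)) x =
      _ := ((hr'.hasFDerivAt.smul hd.hasFDerivAt.fst).prodMk hd.hasFDerivAt.snd).fderiv
  rw [e, ContinuousLinearMap.comp_apply, ContinuousLinearMap.comp_apply]
  exact connectionForm_homothety (inv_ne_zero (Real.sqrt_pos.2 h0).ne') _

/-- Two motions with the same projection differ by a turn about `𝐉₀` whose cosine and sine depend
smoothly on the parameters. -/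
lemma exists_smooth_axialTurn {J₀ : Vec} {k : Vec} (hk : k ⬝ᵥ k = 1)
    {l : ℝ} (hl : l ≠ 0) (hJ : J₀ = l • k)
    {p p' : EuclideanSpace ℝ (Fin n) → sFive m} (hp : IsPlot p) (hp' : IsPlot p')
    {x : EuclideanSpace ℝ (Fin n)}
    (h : reducedClass m J₀ ∘ p =ᶠ[𝓝 x] reducedClass m J₀ ∘ p') :
    ∃ c s : EuclideanSpace ℝ (Fin n) → ℝ, ContDiff ℝ ∞ c ∧ ContDiff ℝ ∞ s ∧
      ∀ᶠ y in 𝓝 x, c y ^ 2 + s y ^ 2 = 1 ∧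
        ∃ R ∈ Matrix.specialOrthogonalGroup (Fin 3) ℝ, R *ᵥ k = k ∧
          (∀ u, R *ᵥ u = axialTurn k (c y) (s y) u) ∧
          (∀ a, (p' y).1.1 a = R *ᵥ (p y).1.1 a) ∧ (p' y).1.2 = R *ᵥ (p y).1.2 := by
  have hz : ContDiff ℝ ∞ fun y => (p y : (Fin 3 → Vec) × Vec) := hp
  have hz' : ContDiff ℝ ∞ fun y => (p' y : (Fin 3 → Vec) × Vec) := hp'
  -- the cosine and the sine are recovered from the action on the four vectors `q₀, q₁, q₂, n`
  let u : Option (Fin 3) → EuclideanSpace ℝ (Fin n) → Vec := fun i y =>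
    i.elim (p y).1.2 (p y).1.1
  let u' : Option (Fin 3) → EuclideanSpace ℝ (Fin n) → Vec := fun i y =>
    i.elim (p' y).1.2 (p' y).1.1
  have hu : ∀ i y, ContDiffAt ℝ ∞ (u i) y := by
    rintro (_ | a) y
    · exact hz.contDiffAt.snd
    · exact contDiffAt_pi.1 hz.contDiffAt.fst a
  have hu' : ∀ i y, ContDiffAt ℝ ∞ (u' i) y := by
    rintro (_ | a) y
    · exact hz'.contDiffAt.snd
    · exact contDiffAt_pi.1 hz'.contDiffAt.fst a
  let D : EuclideanSpace ℝ (Fin n) → ℝ := fun y => ∑ i, (u i y ⬝ᵥ u i y - (k ⬝ᵥ u i y) ^ 2)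
  have hperp : ∀ w : Vec, w ⬝ᵥ w - (k ⬝ᵥ w) ^ 2 = (k ⨯₃ w) ⬝ᵥ (k ⨯₃ w) := by
    intro w
    rw [cross_dot_cross, hk, dotProduct_comm w k]; ring
  have hD : ∀ y, D y ≠ 0 := by
    intro y h0
    have h1 : ∀ i, k ⨯₃ u i y = 0 := by
      intro i
      by_contra hne
      refine (Finset.sum_pos' (fun j _ => ?_) ⟨i, Finset.mem_univ i, ?_⟩).ne' h0
      · rw [hperp]; exact vec_dot_self_nonneg _
      · rw [hperp]; exact dotProduct_self_pos hne
    have h2 : ∀ i, u i y = (k ⬝ᵥ u i y) • k := by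
      intro i
      have := cross_cross_eq_smul_sub_smul' k k (u i y)
      rw [h1 i, map_zero, hk, one_smul] at this
      exact (sub_eq_zero.1 this.symm).symm
    have hn : (k ⬝ᵥ (p y).1.2) ≠ 0 := by
      intro h3
      have h4 := h2 none
      have h5 : (p y).1.2 = (k ⬝ᵥ (p y).1.2) • k := h4
      have h6 := (p y).2.1.2.1
      rw [h5, h3] at h6
      simp at h6
    refine (sFiveInclusion m (p y)).2.2 (funext fun a => ?_)
    have h5 : (p y).1.2 = (k ⬝ᵥ (p y).1.2) • k := h2 none
    have h6 : (p y).1.1 a = (k ⬝ᵥ (p y).1.1 a) • k := h2 (some a)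
    have h7 := (p y).2.1.2.2 a
    rw [h5, h6] at h7
    simp only [dotProduct_smul, smul_dotProduct, hk, smul_eq_mul, mul_one] at h7
    have h8 : k ⬝ᵥ (p y).1.1 a = 0 := by
      rcases mul_eq_zero.1 h7 with h | h
      · exact h
      · exact absurd h hn
    change (p y).1.1 a = 0
    rw [h6, h8, zero_smul]
  have hDs : ContDiff ℝ ∞ D := contDiff_iff_contDiffAt.2 fun y =>
    ContDiffAt.sum fun i _ => ((hu i y).dotProduct (hu i y)).sub
      ((contDiffAt_const.dotProduct (hu i y)).pow 2)
  refine ⟨fun y => (∑ i, (u i y ⬝ᵥ u' i y - (k ⬝ᵥ u i y) ^ 2)) / D y,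
    fun y => (∑ i, (k ⨯₃ u i y) ⬝ᵥ u' i y) / D y, ?_, ?_, ?_⟩
  · refine ContDiff.div (contDiff_iff_contDiffAt.2 fun y => ?_) hDs hD
    exact ContDiffAt.sum fun i _ => ((hu i y).dotProduct (hu' i y)).sub
      ((contDiffAt_const.dotProduct (hu i y)).pow 2)
  · refine ContDiff.div (contDiff_iff_contDiffAt.2 fun y => ?_) hDs hD
    exact ContDiffAt.sum fun i _ => (contDiffAt_const.crossProduct (hu i y)).dotProduct (hu' i y)
  · filter_upwards [h] with y hy
    obtain ⟨R, hR, hRJ, h1, h2⟩ := Quotient.exact hy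
    have hRk : R *ᵥ k = k := by
      rw [hJ, Matrix.mulVec_smul] at hRJ
      exact smul_right_injective _ hl hRJ
    obtain ⟨c, s, hcs, hT⟩ := exists_axialTurn hR hk hRk
    have hui : ∀ i, u' i y = axialTurn k c s (u i y) := by
      rintro (_ | a)
      · exact h2.symm.trans (hT _)
      · exact (h1 a).symm.trans (hT _)
    have ec : (∑ i, (u i y ⬝ᵥ u' i y - (k ⬝ᵥ u i y) ^ 2)) / D y = c := by
      rw [div_eq_iff (hD y), Finset.mul_sum]
      refine Finset.sum_congr rfl fun i _ => ?_
      rw [hui, dot_axialTurn]; ring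
    have es : (∑ i, (k ⨯₃ u i y) ⬝ᵥ u' i y) / D y = s := by
      rw [div_eq_iff (hD y), Finset.mul_sum]
      refine Finset.sum_congr rfl fun i _ => ?_
      rw [hui, cross_dot_axialTurn hk]
    simp only [ec, es]
    exact ⟨hcs, R, hR, hRk, hT, fun a => (h1 a).symm, h2.symm⟩

lemma exists_unit_axis {J₀ : Vec} (hJ₀ : J₀ ≠ 0) :
    ∃ k : Vec, k ⬝ᵥ k = 1 ∧ J₀ = vecLength J₀ • k := by
  have h := vecLength_pos hJ₀
  refine ⟨(vecLength J₀)⁻¹ • J₀, ?_, by rw [smul_smul, mul_inv_cancel₀ h.ne', one_smul]⟩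
  simp only [dotProduct_smul, smul_dotProduct, ← vecLength_sq, smul_eq_mul]
  field_simp

/-- Two motions that differ by rotations about `𝐉₀` have connection forms that differ by a multiple
of the closed form of the angle of rotation. -/
lemma extendedConnection_d_congr_sFive (hm : ∀ a, 0 < m a) {J₀ : Vec} (hJ₀ : J₀ ≠ 0)
    {p p' : EuclideanSpace ℝ (Fin n) → sFive m} (hp : IsPlot p) (hp' : IsPlot p')
    {x : EuclideanSpace ℝ (Fin n)}
    (h : reducedClass m J₀ ∘ p =ᶠ[𝓝 x] reducedClass m J₀ ∘ p') :
    (extendedConnection m hm J₀).d.toFun (sFiveInclusion m ∘ p) (isPlot_sFiveInclusion hp) x =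
      (extendedConnection m hm J₀).d.toFun (sFiveInclusion m ∘ p')
        (isPlot_sFiveInclusion hp') x := by
  obtain ⟨k, hk, hJ⟩ := exists_unit_axis hJ₀
  obtain ⟨c, s, hc, hs, hR⟩ := exists_smooth_axialTurn hk (vecLength_pos hJ₀).ne' hJ hp hp' h
  have hz : ContDiff ℝ ∞ fun y => (p y : (Fin 3 → Vec) × Vec) := hp
  have hz' : ContDiff ℝ ∞ fun y => (p' y : (Fin 3 → Vec) × Vec) := hp'
  have hne : c x ^ 2 + s x ^ 2 ≠ 0 := by rw [hR.self_of_nhds.1]; exact one_ne_zero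
  ext v
  rw [extendedConnection_d_apply, extendedConnection_d_apply]
  have key : (fun x => connectionForm m J₀ ((sFiveInclusion m ∘ p') x) ∘L
        fderiv ℝ (fun y => ((sFiveInclusion m ∘ p') y : (Fin 3 → Vec) × Vec)) x) =ᶠ[𝓝 x]
      fun x => connectionForm m J₀ ((sFiveInclusion m ∘ p) x) ∘L
        fderiv ℝ (fun y => ((sFiveInclusion m ∘ p) y : (Fin 3 → Vec) × Vec)) x +
        vecLength J₀ • angleForm c s x := by
    filter_upwards [hR.eventually_nhds] with y hy
    ext w
    obtain ⟨hcs, R, hRm, hRk, hT, h1, h2⟩ := hy.self_of_nhds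
    have hd := hz.contDiffAt.differentiableAt (x := y) (by simp)
    have hd' := hz'.contDiffAt.differentiableAt (x := y) (by simp)
    have hcs' : ∀ᶠ y' in 𝓝 y, c y' ^ 2 + s y' ^ 2 = 1 := hy.mono fun _ h => h.1
    have hcd := hc.contDiffAt.differentiableAt (x := y) (by simp)
    have hsd := hs.contDiffAt.differentiableAt (x := y) (by simp)
    have hqd := differentiableAt_pi.1 hd.fst
    have hqd' := differentiableAt_pi.1 hd'.fst
    have e1 := fderiv_position_apply hd w
    have e1' := fderiv_position_apply hd' w
    have e2 := fderiv_normal_apply hd w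
    have e2' := fderiv_normal_apply hd' w
    have g1 : ∀ a, (fun y => (p' y).1.1 a) =ᶠ[𝓝 y]
        fun y => axialTurn k (c y) (s y) ((p y).1.1 a) := fun a => hy.mono fun y' h => by
      obtain ⟨-, R, -, -, hT, h1, -⟩ := h
      exact (h1 a).trans (hT _)
    have g2 : (fun y => (p' y).1.2) =ᶠ[𝓝 y]
        fun y => axialTurn k (c y) (s y) (p y).1.2 := hy.mono fun y' h => by
      obtain ⟨-, R, -, -, hT, -, h2⟩ := h
      exact h2.trans (hT _)
    have f1 : ∀ a, (fderiv ℝ (fun y => (p' y : (Fin 3 → Vec) × Vec)) y w).1 a =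
        R *ᵥ (fderiv ℝ (fun y => (p y : (Fin 3 → Vec) × Vec)) y w).1 a +
          angleForm c s y w • (k ⨯₃ (R *ᵥ (p y).1.1 a)) := by
      intro a
      rw [e1', (g1 a).fderiv_eq, fderiv_axialTurn hk hcd hsd (hqd a) hcs', hT, hT, e1]
    have f2 : (fderiv ℝ (fun y => (p' y : (Fin 3 → Vec) × Vec)) y w).2 =
        R *ᵥ (fderiv ℝ (fun y => (p y : (Fin 3 → Vec) × Vec)) y w).2 +
          angleForm c s y w • (k ⨯₃ (R *ᵥ (p y).1.2)) := by
      rw [e2', g2.fderiv_eq, fderiv_axialTurn hk hcd hsd hd.snd hcs', hT, hT, e2]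
    have hpt : ((p' y).1 : (Fin 3 → Vec) × Vec) =
        (fun a => R *ᵥ (p y).1.1 a, R *ᵥ (p y).1.2) := Prod.ext (funext h1) h2
    have := connectionForm_rotation (J₀ := J₀) hRm hk hJ hRk
      (polarInertia_qStar_ne_zero hm (sFiveInclusion m (p y))) (p y).2.1.2.1 (p y).2.1.2.2
      (angleForm c s y w) (q' := (fderiv ℝ (fun y => (p y : (Fin 3 → Vec) × Vec)) y w).1)
      (n' := (fderiv ℝ (fun y => (p y : (Fin 3 → Vec) × Vec)) y w).2)
    rw [_root_.add_apply, _root_.smul_apply, ContinuousLinearMap.comp_apply,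
      ContinuousLinearMap.comp_apply, smul_eq_mul]
    refine Eq.trans ?_ this
    change connectionForm m J₀ (p' y).1 (fderiv ℝ (fun y => (p' y : (Fin 3 → Vec) × Vec)) y w) = _
    rw [hpt]
    congr 1
    exact Prod.ext (funext f1) f2
  rw [key.curl_eq, curl_add, curl_const_smul, curl_angleForm hc.contDiffAt hs.contDiffAt hne]
  · ring
  · exact differentiableAt_angleForm hc.contDiffAt hs.contDiffAt hne
  · exact (contDiff_connectionForm_comp_fderiv hm J₀ (isPlot_sFiveInclusion hp)).differentiable
      (by simp) x
  · exact (differentiableAt_angleForm hc.contDiffAt hs.contDiffAt hne).fun_const_smul _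

lemma extendedConnection_d_rescale (hm : ∀ a, 0 < m a) (J₀ : Vec)
    (p : EuclideanSpace ℝ (Fin n) → qStar m) (hp : IsPlot p) (x : EuclideanSpace ℝ (Fin n)) :
    (extendedConnection m hm J₀).d.toFun (sFiveInclusion m ∘ rescale m hm ∘ p)
      (isPlot_sFiveInclusion (isPlot_rescale hm hp)) x =
      (extendedConnection m hm J₀).d.toFun p hp x := by
  change extDeriv _ x = extDeriv _ x
  rw [extendedConnection_rescale]

/-- Plots of `S_{𝐉₀}` lift locally to `S̃⁵`. -/
lemma exists_lift_sFive {J₀ : Vec} {p : EuclideanSpace ℝ (Fin n) → ReducedSphereBundle m J₀}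
    (hp : IsPlot p) (x : EuclideanSpace ℝ (Fin n)) :
    ∃ P : EuclideanSpace ℝ (Fin n) → sFive m, IsPlot P ∧
      reducedClass m J₀ ∘ P =ᶠ[𝓝 x] p := hp x

/-- The reduced two-form, characterized by its values on the plots that come from `Q̃*`. -/
lemma exists_reducedForm (hm : ∀ a, 0 < m a) {J₀ : Vec} (hJ₀ : J₀ ≠ 0) :
    ∃ Ω : DForm (ReducedSphereBundle m J₀) 2, ∀ {n : ℕ}
      (p : EuclideanSpace ℝ (Fin n) → ReducedSphereBundle m J₀) (hp : IsPlot p)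
      (P : EuclideanSpace ℝ (Fin n) → qStar m) (hP : IsPlot P) (x),
      reducedProj m hm J₀ ∘ P =ᶠ[𝓝 x] p →
        Ω.toFun p hp x = (extendedConnection m hm J₀).d.toFun P hP x := by
  refine DForm.exists_descent _ _ (fun p hp x => ?_) fun P P' hP hP' x h => ?_
  · obtain ⟨P, hP, he⟩ := exists_lift_sFive hp x
    refine ⟨sFiveInclusion m ∘ P, isPlot_sFiveInclusion hP, ?_⟩
    filter_upwards [he] with y hy
    rw [← hy]
    exact reducedProj_sFiveInclusion hm J₀ (P y)
  · rw [← extendedConnection_d_rescale, ← extendedConnection_d_rescale hm J₀ P']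
    exact extendedConnection_d_congr_sFive hm hJ₀ (isPlot_rescale hm hP) (isPlot_rescale hm hP') h

/-- A two-form on `S_{𝐉₀}` that pulls back to `dα` is determined near each point by a local lift. -/
lemma toFun_eq_of_lift {hm : ∀ a, 0 < m a} {J₀ : Vec} {Ω : DForm (ReducedSphereBundle m J₀) 2}
    (hΩ : Ω.pullback (reducedProj m hm J₀) (dSmooth_reducedProj m hm J₀) =
      (extendedConnection m hm J₀).d)
    {p : EuclideanSpace ℝ (Fin n) → ReducedSphereBundle m J₀} (hp : IsPlot p)
    {P : EuclideanSpace ℝ (Fin n) → sFive m} (hP : IsPlot P) {x : EuclideanSpace ℝ (Fin n)}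
    (he : reducedClass m J₀ ∘ P =ᶠ[𝓝 x] p) :
    Ω.toFun p hp x = (extendedConnection m hm J₀).d.toFun (sFiveInclusion m ∘ P)
      (isPlot_sFiveInclusion hP) x := by
  rw [← hΩ]
  refine Ω.toFun_congr _ _ ?_
  filter_upwards [he] with y hy
  rw [← hy]
  exact (reducedProj_sFiveInclusion hm J₀ (P y)).symm

end Basic

/-! ### Jacobi vectors -/

section Jacobi

variable {m : Fin 3 → ℝ}

lemma jacobi₁_scale_pos (hm : ∀ a, 0 < m a) : 0 < √(1 / (1 / m 0 + 1 / m 2)) := by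
  have := hm 0; have := hm 2
  positivity

lemma jacobi₂_scale_pos (hm : ∀ a, 0 < m a) : 0 < √(1 / (1 / (m 0 + m 2) + 1 / m 1)) := by
  have := hm 0; have := hm 1; have := hm 2
  positivity

lemma jacobi₁_scale_sq (hm : ∀ a, 0 < m a) :
    √(1 / (1 / m 0 + 1 / m 2)) ^ 2 = m 0 * m 2 / (m 0 + m 2) := by
  have := hm 0; have := hm 2
  rw [Real.sq_sqrt (by positivity)]
  field_simp
  ring

lemma jacobi₂_scale_sq (hm : ∀ a, 0 < m a) :
    √(1 / (1 / (m 0 + m 2) + 1 / m 1)) ^ 2 = (m 0 + m 2) * m 1 / (m 0 + m 1 + m 2) := by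
  have := hm 0; have := hm 1; have := hm 2
  rw [Real.sq_sqrt (by positivity)]
  field_simp
  ring

/-- The triangle with centre of mass at the origin and given normalized Jacobi vectors. -/
noncomputable def triangleOfJacobi (m : Fin 3 → ℝ) (u v : Vec) : Fin 3 → Vec :=
  let r := (√(1 / (1 / m 0 + 1 / m 2)))⁻¹ • u
  let s := (√(1 / (1 / (m 0 + m 2) + 1 / m 1)))⁻¹ • v
  ![-(m 1 / (m 0 + m 1 + m 2)) • s + (m 2 / (m 0 + m 2)) • r,
    ((m 0 + m 2) / (m 0 + m 1 + m 2)) • s,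
    -(m 1 / (m 0 + m 1 + m 2)) • s - (m 0 / (m 0 + m 2)) • r]

lemma sum_smul_triangleOfJacobi (hm : ∀ a, 0 < m a) (u v : Vec) :
    ∑ a, m a • triangleOfJacobi m u v a = 0 := by
  have := hm 0; have := hm 1; have := hm 2
  simp only [triangleOfJacobi, Fin.sum_univ_three, Matrix.cons_val]
  match_scalars <;> field_simp <;> ring

lemma jacobi₁_triangleOfJacobi (hm : ∀ a, 0 < m a) (u v : Vec) :
    jacobi₁ m (triangleOfJacobi m u v) = u := by
  have := hm 0; have := hm 1; have := hm 2
  have := jacobi₁_scale_pos hm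
  simp only [triangleOfJacobi, jacobi₁, Matrix.cons_val]
  match_scalars <;> field_simp <;> ring

lemma jacobi₂_triangleOfJacobi (hm : ∀ a, 0 < m a) (u v : Vec) :
    jacobi₂ m (triangleOfJacobi m u v) = v := by
  have := hm 0; have := hm 1; have := hm 2
  have := jacobi₂_scale_pos hm
  simp only [triangleOfJacobi, jacobi₂, Matrix.cons_val]
  match_scalars <;> field_simp <;> ring

lemma triangleOfJacobi_jacobi (hm : ∀ a, 0 < m a) {q : Fin 3 → Vec}
    (hq : ∑ a, m a • q a = 0) : triangleOfJacobi m (jacobi₁ m q) (jacobi₂ m q) = q := by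
  have := hm 0; have := hm 1; have := hm 2
  have h1 := jacobi₁_scale_pos hm
  have h2 := jacobi₂_scale_pos hm
  have e2 : q 2 = -((m 0 / m 2) • q 0) - (m 1 / m 2) • q 1 := by
    rw [Fin.sum_univ_three] at hq
    have h3 : m 2 • q 2 = -(m 0 • q 0) - m 1 • q 1 := by
      rw [eq_sub_iff_add_eq, eq_neg_iff_add_eq_zero, ← hq]; abel
    have h4 : q 2 = (m 2)⁻¹ • (m 2 • q 2) := by
      rw [smul_smul, inv_mul_cancel₀ (hm 2).ne', one_smul]
    rw [h4, h3]
    match_scalars <;> field_simp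
  funext a
  fin_cases a <;> simp only [triangleOfJacobi, jacobi₁, jacobi₂, Matrix.cons_val, Fin.zero_eta,
    Fin.mk_one, Fin.reduceFinMk, smul_smul, inv_mul_cancel₀ h1.ne', inv_mul_cancel₀ h2.ne',
    one_smul]
  all_goals rw [e2]; match_scalars <;> field_simp <;> ring

/-- Jacobi vectors diagonalize the kinetic metric: a mass-weighted sum of values of a bilinear map
is the sum of the values on the normalized Jacobi vectors. -/
lemma sum_bilinear_eq_jacobi (hm : ∀ a, 0 < m a) {W : Type*} [AddCommGroup W] [Module ℝ W]
    (B : Vec →ₗ[ℝ] Vec →ₗ[ℝ] W) {q v : Fin 3 → Vec}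
    (hq : ∑ a, m a • q a = 0) (hv : ∑ a, m a • v a = 0) :
    ∑ a, m a • B (q a) (v a) =
      B (jacobi₁ m q) (jacobi₁ m v) + B (jacobi₂ m q) (jacobi₂ m v) := by
  have := hm 0; have := hm 1; have := hm 2
  have h1 := jacobi₁_scale_pos hm
  have h2 := jacobi₂_scale_pos hm
  have s1 := jacobi₁_scale_sq hm
  have s2 := jacobi₂_scale_sq hm
  conv_lhs => rw [← triangleOfJacobi_jacobi hm hq, ← triangleOfJacobi_jacobi hm hv]
  simp only [triangleOfJacobi, Fin.sum_univ_three, Matrix.cons_val]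
  set a := √(1 / (1 / m 0 + 1 / m 2))
  set b := √(1 / (1 / (m 0 + m 2) + 1 / m 1))
  have ha : a⁻¹ * a⁻¹ = (m 0 + m 2) / (m 0 * m 2) := by
    rw [← mul_inv, ← pow_two, s1, inv_div]
  have hb : b⁻¹ * b⁻¹ = (m 0 + m 1 + m 2) / ((m 0 + m 2) * m 1) := by
    rw [← mul_inv, ← pow_two, s2, inv_div]
  generalize jacobi₁ m q = u
  generalize jacobi₂ m q = w
  generalize jacobi₁ m v = u'
  generalize jacobi₂ m v = w'
  have key : ∀ r s r' s' : Vec, m 0 • B (-(m 1 / (m 0 + m 1 + m 2)) • s + (m 2 / (m 0 + m 2)) • r)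
        (-(m 1 / (m 0 + m 1 + m 2)) • s' + (m 2 / (m 0 + m 2)) • r') +
      m 1 • B (((m 0 + m 2) / (m 0 + m 1 + m 2)) • s) (((m 0 + m 2) / (m 0 + m 1 + m 2)) • s') +
      m 2 • B (-(m 1 / (m 0 + m 1 + m 2)) • s - (m 0 / (m 0 + m 2)) • r)
        (-(m 1 / (m 0 + m 1 + m 2)) • s' - (m 0 / (m 0 + m 2)) • r') =
      (m 0 * m 2 / (m 0 + m 2)) • B r r' + ((m 0 + m 2) * m 1 / (m 0 + m 1 + m 2)) • B s s' := by
    intro r s r' s'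
    simp only [map_add, map_sub, map_smul, LinearMap.add_apply, LinearMap.sub_apply,
      LinearMap.smul_apply]
    match_scalars <;> field_simp <;> ring
  rw [key]
  simp only [map_smul, LinearMap.smul_apply, smul_smul]
  rw [ha, hb]
  congr 1
  · rw [div_mul_div_cancel₀ (by positivity), div_self (by positivity), one_smul]
  · rw [div_mul_div_cancel₀ (by positivity), div_self (by positivity), one_smul]

lemma polarInertia_eq_jacobi (hm : ∀ a, 0 < m a) {q : Fin 3 → Vec} (hq : ∑ a, m a • q a = 0) :
    polarInertia m q = jacobi₁ m q ⬝ᵥ jacobi₁ m q + jacobi₂ m q ⬝ᵥ jacobi₂ m q :=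
  sum_bilinear_eq_jacobi hm (LinearMap.mk₂ ℝ (fun u v : Vec => u ⬝ᵥ v) add_dotProduct
    smul_dotProduct dotProduct_add (fun c u v => dotProduct_smul c u v)) hq hq

lemma angularMomentum_eq_jacobi (hm : ∀ a, 0 < m a) {q v : Fin 3 → Vec}
    (hq : ∑ a, m a • q a = 0) (hv : ∑ a, m a • v a = 0) :
    angularMomentum m q v = jacobi₁ m q ⨯₃ jacobi₁ m v + jacobi₂ m q ⨯₃ jacobi₂ m v :=
  sum_bilinear_eq_jacobi hm crossProduct hq hv

lemma inertiaTensor_mulVec_eq_jacobi (hm : ∀ a, 0 < m a) {q : Fin 3 → Vec}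
    (hq : ∑ a, m a • q a = 0) (u : Vec) :
    inertiaTensor m q *ᵥ u =
      jacobi₁ m q ⨯₃ (u ⨯₃ jacobi₁ m q) + jacobi₂ m q ⨯₃ (u ⨯₃ jacobi₂ m q) := by
  rw [inertiaTensor_mulVec]
  exact sum_bilinear_eq_jacobi hm ((crossProduct (R := ℝ)).compl₂ (crossProduct u)) hq hq

lemma shapeHeight_eq_jacobi (hm : ∀ a, 0 < m a) (q : Fin 3 → Vec) (n : Vec) :
    shapeHeight m q n = 2 * (n ⬝ᵥ (jacobi₁ m q ⨯₃ jacobi₂ m q)) / polarInertia m q := by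
  have := hm 0; have := hm 1; have := hm 2
  have h1 : √(m 0 * m 1 * m 2 / (m 0 + m 1 + m 2)) =
      √(1 / (1 / m 0 + 1 / m 2)) * √(1 / (1 / (m 0 + m 2) + 1 / m 1)) := by
    rw [← Real.sqrt_mul (by positivity)]
    congr 1
    field_simp
    ring
  have h2 : q 1 - (m 0 / (m 0 + m 2)) • q 0 - (m 2 / (m 0 + m 2)) • q 2 =
      (q 1 - q 0) + (m 2 / (m 0 + m 2)) • (q 0 - q 2) := by
    match_scalars <;> field_simp
    ring
  have h3 : (q 0 - q 2) ⨯₃ (q 1 - q 0) = (q 1 - q 0) ⨯₃ (q 2 - q 0) := by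
    rw [← cross_anticomm (q 1 - q 0) (q 0 - q 2), ← map_neg, neg_sub]
  have h4 : jacobi₁ m q ⨯₃ jacobi₂ m q =
      (√(1 / (1 / m 0 + 1 / m 2)) * √(1 / (1 / (m 0 + m 2) + 1 / m 1))) •
        ((q 1 - q 0) ⨯₃ (q 2 - q 0)) := by
    rw [jacobi₁, jacobi₂, h2]
    simp only [map_smul, LinearMap.smul_apply, map_add, cross_self, smul_zero, add_zero, h3,
      smul_smul]
    congr 1
    ring
  rw [h4, shapeHeight, orientedArea, h1, dotProduct_smul, smul_eq_mul]
  ring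

lemma dot_jacobi {q : Fin 3 → Vec} {n : Vec} (h : ∀ a, n ⬝ᵥ q a = 0) :
    n ⬝ᵥ jacobi₁ m q = 0 ∧ n ⬝ᵥ jacobi₂ m q = 0 := by
  simp [jacobi₁, jacobi₂, h]

lemma jacobi₁_mulVec (R : Matrix (Fin 3) (Fin 3) ℝ) (q : Fin 3 → Vec) :
    jacobi₁ m (fun a => R *ᵥ q a) = R *ᵥ jacobi₁ m q := by
  simp only [jacobi₁, Matrix.mulVec_smul, Matrix.mulVec_sub]

lemma jacobi₂_mulVec (R : Matrix (Fin 3) (Fin 3) ℝ) (q : Fin 3 → Vec) :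
    jacobi₂ m (fun a => R *ᵥ q a) = R *ᵥ jacobi₂ m q := by
  simp only [jacobi₂, Matrix.mulVec_smul, Matrix.mulVec_sub]

end Jacobi

/-! ### Rotation invariance of the coordinates -/

section Invariance

variable {m : Fin 3 → ℝ} {R : Matrix (Fin 3) (Fin 3) ℝ}

lemma shapeHeight_rotation (hm : ∀ a, 0 < m a)
    (hR : R ∈ Matrix.specialOrthogonalGroup (Fin 3) ℝ) (q : Fin 3 → Vec) (n : Vec) :
    shapeHeight m (fun a => R *ᵥ q a) (R *ᵥ n) = shapeHeight m q n := by
  simp only [shapeHeight_eq_jacobi hm, jacobi₁_mulVec, jacobi₂_mulVec, rotation_cross hR,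
    rotation_dot hR, polarInertia_rotation m hR]

lemma shapeW₁_rotation (hR : R ∈ Matrix.specialOrthogonalGroup (Fin 3) ℝ) (q : Fin 3 → Vec) :
    shapeW₁ m (fun a => R *ᵥ q a) = shapeW₁ m q := by
  simp only [shapeW₁, jacobi₁_mulVec, jacobi₂_mulVec, rotation_dot hR, polarInertia_rotation m hR]

lemma shapeW₂_rotation (hR : R ∈ Matrix.specialOrthogonalGroup (Fin 3) ℝ) (q : Fin 3 → Vec) :
    shapeW₂ m (fun a => R *ᵥ q a) = shapeW₂ m q := by
  simp only [shapeW₂, jacobi₁_mulVec, jacobi₂_mulVec, rotation_dot hR, polarInertia_rotation m hR]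

lemma rotation_dot_axis {J₀ : Vec} (hR : R ∈ Matrix.specialOrthogonalGroup (Fin 3) ℝ)
    (hJ : R *ᵥ J₀ = J₀) (u : Vec) : J₀ ⬝ᵥ (R *ᵥ u) = J₀ ⬝ᵥ u := by
  conv_lhs => rw [← hJ]
  exact rotation_dot hR _ _

lemma IsInertiaEigenframe.rotation (hR : R ∈ Matrix.specialOrthogonalGroup (Fin 3) ℝ)
    {q : Fin 3 → Vec} {e₁ e₂ n : Vec} (h : IsInertiaEigenframe m q e₁ e₂ n) :
    IsInertiaEigenframe m (fun a => R *ᵥ q a) (R *ᵥ e₁) (R *ᵥ e₂) (R *ᵥ n) := by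
  obtain ⟨h1, h2, h3, h4, ⟨l₁, h5⟩, ⟨l₂, h6⟩⟩ := h
  have key : ∀ u, inertiaTensor m (fun a => R *ᵥ q a) *ᵥ (R *ᵥ u) =
      R *ᵥ (inertiaTensor m q *ᵥ u) := by
    intro u
    simp only [inertiaTensor_mulVec, rotation_cross hR, Matrix.mulVec_sum, Matrix.mulVec_smul]
  refine ⟨?_, ?_, ?_, ?_, ⟨l₁, ?_⟩, ⟨l₂, ?_⟩⟩
  · rw [rotation_dot hR, h1]
  · rw [rotation_dot hR, h2]
  · rw [rotation_dot hR, h3]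
  · rw [rotation_cross hR, h4]
  · rw [key, h5, Matrix.mulVec_smul]
  · rw [key, h6, Matrix.mulVec_smul]

/-- The oriented triangle `z`, with `I = 1`, has eigenframe coordinates `c`: the condition of
`HasEigenframeCoordinates` at a representative. -/
def HasEigenframeCoordinatesAt (m : Fin 3 → ℝ) (J₀ : Vec) (z : (Fin 3 → Vec) × Vec)
    (c : EuclideanSpace ℝ (Fin 4)) : Prop :=
  c 0 = shapeHeight m z.1 z.2 ∧ |c 0| < 1 ∧
    shapeW₁ m z.1 = 1 / 2 * √(1 - c 0 ^ 2) * Real.cos (c 1) ∧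
    shapeW₂ m z.1 = - (1 / 2 * √(1 - c 0 ^ 2) * Real.sin (c 1)) ∧
    c 2 = momentumHeight J₀ z.2 ∧ |c 2| < 1 ∧
    ∃ e₁ e₂ : Vec, IsInertiaEigenframe m z.1 e₁ e₂ z.2 ∧
      J₀ ⬝ᵥ e₁ = vecLength J₀ * √(1 - c 2 ^ 2) * Real.cos (c 3) ∧
      J₀ ⬝ᵥ e₂ = - (vecLength J₀ * √(1 - c 2 ^ 2) * Real.sin (c 3))

/-- Eigenframe coordinates of a class can be read off at every representative. -/
lemma HasEigenframeCoordinates.at_representative (hm : ∀ a, 0 < m a) {J₀ : Vec} {x : sFive m}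
    {c : EuclideanSpace ℝ (Fin 4)} (h : HasEigenframeCoordinates m J₀ (reducedClass m J₀ x) c) :
    HasEigenframeCoordinatesAt m J₀ x.1 c := by
  obtain ⟨x', hx', h1, h2, h3, h4, h5, h6, e₁, e₂, h7, h8, h9⟩ := h
  obtain ⟨R, hR, hRJ, hq, hn⟩ := Quotient.exact hx'
  have hq' : x.1.1 = fun a => R *ᵥ x'.1.1 a := funext fun a => (hq a).symm
  rw [HasEigenframeCoordinatesAt, hq', ← hn]
  refine ⟨?_, h2, ?_, ?_, ?_, h6, R *ᵥ e₁, R *ᵥ e₂, h7.rotation hR, ?_, ?_⟩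
  · rw [shapeHeight_rotation hm hR, h1]
  · rw [shapeW₁_rotation hR, h3]
  · rw [shapeW₂_rotation hR, h4]
  · rw [momentumHeight, rotation_dot_axis hR hRJ, h5, momentumHeight]
  · rw [rotation_dot_axis hR hRJ, h8]
  · rw [rotation_dot_axis hR hRJ, h9]

end Invariance

/-! ### The connection form in eigenframe coordinates -/

section Velocity

/-- Angular momentum about the normal, in a moving frame with angular speed `e₁' ⬝ e₂` about the
normal. -/
lemma normal_dot_cross_velocity {e₁ e₂ n : Vec} (h : IsRightFrame e₁ e₂ n) {e₁' e₂' : Vec}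
    (h₁ : e₁ ⬝ᵥ e₁' = 0) (h₂ : e₂ ⬝ᵥ e₂' = 0) (h₁₂ : e₁' ⬝ᵥ e₂ + e₁ ⬝ᵥ e₂' = 0)
    {u : Vec} (hu : n ⬝ᵥ u = 0) (u' : Vec) :
    n ⬝ᵥ (u ⨯₃ u') =
      (u ⬝ᵥ e₁) * (u' ⬝ᵥ e₂ + u ⬝ᵥ e₂') - (u ⬝ᵥ e₂) * (u' ⬝ᵥ e₁ + u ⬝ᵥ e₁') +
        (u ⬝ᵥ u) * (e₁' ⬝ᵥ e₂) := by
  have hu' : u ⬝ᵥ n = 0 := by rw [dotProduct_comm, hu]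
  have a1 : u ⬝ᵥ e₁' = (u ⬝ᵥ e₂) * (e₁' ⬝ᵥ e₂) := by
    rw [h.dot_eq u e₁', hu', dotProduct_comm e₁' e₁, h₁]; ring
  have a2 : u ⬝ᵥ e₂' = -((u ⬝ᵥ e₁) * (e₁' ⬝ᵥ e₂)) := by
    rw [h.dot_eq u e₂', hu', dotProduct_comm e₂' e₂, h₂, dotProduct_comm e₂' e₁,
      eq_neg_of_add_eq_zero_right h₁₂]; ring
  rw [h.cross_dot_normal, a1, a2, h.dot_eq u u, hu']
  ring

/-- The angular speed of the frame about its third vector, from the components of a fixed vector. -/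
lemma frame_angular_speed {e₁ e₂ n : Vec} (h : IsRightFrame e₁ e₂ n) {e₁' e₂' n' : Vec}
    (h₁ : e₁ ⬝ᵥ e₁' = 0) (h₂ : e₂ ⬝ᵥ e₂' = 0) (h₁₂ : e₁' ⬝ᵥ e₂ + e₁ ⬝ᵥ e₂' = 0)
    (h₁n : e₁' ⬝ᵥ n + e₁ ⬝ᵥ n' = 0) (h₂n : e₂' ⬝ᵥ n + e₂ ⬝ᵥ n' = 0) (hn : n ⬝ᵥ n' = 0) (J : Vec) :
    (e₁' ⬝ᵥ e₂) * ((J ⬝ᵥ e₁) ^ 2 + (J ⬝ᵥ e₂) ^ 2) =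
      -((J ⬝ᵥ e₁) * (J ⬝ᵥ e₂') - (J ⬝ᵥ e₂) * (J ⬝ᵥ e₁')) + (J ⬝ᵥ n) * (J ⬝ᵥ (n ⨯₃ n')) := by
  have a1 : J ⬝ᵥ e₁' = (J ⬝ᵥ e₂) * (e₁' ⬝ᵥ e₂) + (J ⬝ᵥ n) * (e₁' ⬝ᵥ n) := by
    rw [h.dot_eq J e₁', dotProduct_comm e₁' e₁, h₁]; ring
  have a2 : J ⬝ᵥ e₂' = -((J ⬝ᵥ e₁) * (e₁' ⬝ᵥ e₂)) + (J ⬝ᵥ n) * (e₂' ⬝ᵥ n) := by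
    rw [h.dot_eq J e₂', dotProduct_comm e₂' e₂, h₂, dotProduct_comm e₂' e₁,
      eq_neg_of_add_eq_zero_right h₁₂]; ring
  have a3 : n ⨯₃ n' = (n' ⬝ᵥ e₁) • e₂ - (n' ⬝ᵥ e₂) • e₁ := by
    conv_lhs => rw [h.expand n', dotProduct_comm n' n, hn]
    simp [h.normal_cross_fst, h.normal_cross_snd, sub_eq_add_neg]
  rw [a3, dotProduct_sub, dotProduct_smul, dotProduct_smul, a1, a2,
    eq_neg_of_add_eq_zero_left h₁n, eq_neg_of_add_eq_zero_left h₂n, dotProduct_comm n' e₁,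
    dotProduct_comm n' e₂]
  simp only [smul_eq_mul]
  ring

/-- The rate `T = ∑ (x dy - y dx)` of a planar pair in its principal frame (`∑ x y = 0`) in terms
of the rate of its point `(w₁, w₂)` on the shape sphere. -/
lemma shape_velocity (x₁ x₂ y₁ y₂ a₁ a₂ b₁ b₂ : ℝ) (hC : x₁ * y₁ + x₂ * y₂ = 0)
    (hC' : a₁ * y₁ + x₁ * b₁ + (a₂ * y₂ + x₂ * b₂) = 0)
    (hI : x₁ ^ 2 + x₂ ^ 2 + y₁ ^ 2 + y₂ ^ 2 = 1) :
    (1 - (2 * (x₁ * y₂ - x₂ * y₁)) ^ 2) * (x₁ * b₁ - y₁ * a₁ + (x₂ * b₂ - y₂ * a₂)) =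
      -(2 * (2 * (x₁ * y₂ - x₂ * y₁))) *
        (1 / 2 * (x₁ ^ 2 + y₁ ^ 2 - (x₂ ^ 2 + y₂ ^ 2)) *
            (a₁ * x₂ + x₁ * a₂ + (b₁ * y₂ + y₁ * b₂)) -
          (x₁ * x₂ + y₁ * y₂) * (x₁ * a₁ + y₁ * b₁ - (x₂ * a₂ + y₂ * b₂))) := by
  linear_combination
    (2 * (x₁ ^ 2 + x₂ ^ 2 + y₁ ^ 2 + y₂ ^ 2) * (y₁ * b₁ + y₂ * b₂ - x₁ * a₁ - x₂ * a₂)) * hC +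
    ((x₁ ^ 2 + x₂ ^ 2) ^ 2 - (y₁ ^ 2 + y₂ ^ 2) ^ 2) * hC' -
    (x₁ * b₁ - y₁ * a₁ + (x₂ * b₂ - y₂ * a₂)) * (x₁ ^ 2 + x₂ ^ 2 + y₁ ^ 2 + y₂ ^ 2 + 1) * hI

variable {E : Type*} [NormedAddCommGroup E] [NormedSpace ℝ E]

/-- In polar coordinates `g = r (cos θ, - sin θ)`, one has `g₁ dg₂ - g₂ dg₁ = - r² dθ`. -/
lemma polar_velocity {r θ g₁ g₂ : E → ℝ} {x : E} (hr : DifferentiableAt ℝ r x)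
    (hθ : DifferentiableAt ℝ θ x) (h₁ : g₁ =ᶠ[𝓝 x] fun y => r y * Real.cos (θ y))
    (h₂ : g₂ =ᶠ[𝓝 x] fun y => -(r y * Real.sin (θ y))) (v : E) :
    g₁ x * fderiv ℝ g₂ x v - g₂ x * fderiv ℝ g₁ x v = -(r x) ^ 2 * fderiv ℝ θ x v := by
  have hc : DifferentiableAt ℝ (fun y => Real.cos (θ y)) x := hθ.cos
  have hs : DifferentiableAt ℝ (fun y => Real.sin (θ y)) x := hθ.sin
  rw [h₁.fderiv_eq, h₂.fderiv_eq, h₁.self_of_nhds, h₂.self_of_nhds, fderiv_fun_neg,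
    fderiv_fun_mul hr hc, fderiv_fun_mul hr hs, fderiv_cos hθ, fderiv_sin hθ]
  simp only [_root_.add_apply, _root_.smul_apply, _root_.neg_apply, smul_eq_mul]
  linear_combination (-(r x) ^ 2 * fderiv ℝ θ x v) * Real.sin_sq_add_cos_sq (θ x)

lemma dotProduct_velocity_of_const {f g : E → Vec} {x : E} (hf : DifferentiableAt ℝ f x)
    (hg : DifferentiableAt ℝ g x) {r : ℝ} (h : ∀ᶠ y in 𝓝 x, f y ⬝ᵥ g y = r) (v : E) :
    fderiv ℝ f x v ⬝ᵥ g x + f x ⬝ᵥ fderiv ℝ g x v = 0 := by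
  have h' : (fun y => f y ⬝ᵥ g y) =ᶠ[𝓝 x] fun _ => r := h
  rw [← fderiv_dotProduct hf hg, h'.fderiv_eq]
  simp

lemma fderiv_jacobi₁ {m : Fin 3 → ℝ} {z : E → (Fin 3 → Vec) × Vec} {x : E}
    (hz : DifferentiableAt ℝ z x) (v : E) :
    fderiv ℝ (fun y => jacobi₁ m (z y).1) x v = jacobi₁ m (fderiv ℝ z x v).1 := by
  have h := differentiableAt_pi.1 hz.fst
  unfold jacobi₁
  rw [fderiv_fun_const_smul ((h 0).fun_sub (h 2)), fderiv_fun_sub (h 0) (h 2)]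
  simp only [_root_.smul_apply, _root_.sub_apply, fderiv_position_apply hz]

lemma fderiv_jacobi₂ {m : Fin 3 → ℝ} {z : E → (Fin 3 → Vec) × Vec} {x : E}
    (hz : DifferentiableAt ℝ z x) (v : E) :
    fderiv ℝ (fun y => jacobi₂ m (z y).1) x v = jacobi₂ m (fderiv ℝ z x v).1 := by
  have h := differentiableAt_pi.1 hz.fst
  unfold jacobi₂
  rw [fderiv_fun_const_smul (((h 1).fun_sub ((h 0).fun_const_smul _)).fun_sub
    ((h 2).fun_const_smul _)), fderiv_fun_sub ((h 1).fun_sub ((h 0).fun_const_smul _))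
    ((h 2).fun_const_smul _), fderiv_fun_sub (h 1) ((h 0).fun_const_smul _),
    fderiv_fun_const_smul (h 0), fderiv_fun_const_smul (h 2)]
  simp only [_root_.smul_apply, _root_.sub_apply, fderiv_position_apply hz]

lemma ContDiffAt.jacobi₁ {m : Fin 3 → ℝ} {q : E → Fin 3 → Vec} {x : E}
    (hq : ContDiffAt ℝ ∞ q x) : ContDiffAt ℝ ∞ (fun y => jacobi₁ m (q y)) x := by
  have h := contDiffAt_pi.1 hq
  unfold _root_.jacobi₁
  exact ((h 0).sub (h 2)).const_smul _

lemma ContDiffAt.jacobi₂ {m : Fin 3 → ℝ} {q : E → Fin 3 → Vec} {x : E}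
    (hq : ContDiffAt ℝ ∞ q x) : ContDiffAt ℝ ∞ (fun y => jacobi₂ m (q y)) x := by
  have h := contDiffAt_pi.1 hq
  unfold _root_.jacobi₂
  exact (((h 1).sub ((h 0).const_smul _)).sub ((h 2).const_smul _)).const_smul _

/-- A frame is determined by its third vector and the components of a vector not parallel to it. -/
lemma IsRightFrame.fst_eq {e₁ e₂ n : Vec} (h : IsRightFrame e₁ e₂ n) {J : Vec} {r θ : ℝ}
    (hr : r ≠ 0) (h₁ : J ⬝ᵥ e₁ = r * Real.cos θ) (h₂ : J ⬝ᵥ e₂ = -(r * Real.sin θ)) :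
    e₁ = r⁻¹ • (Real.cos θ • (J - (J ⬝ᵥ n) • n) + Real.sin θ • (n ⨯₃ J)) := by
  have e1 : J - (J ⬝ᵥ n) • n = (r * Real.cos θ) • e₁ - (r * Real.sin θ) • e₂ := by
    conv_lhs => rw [h.expand J]
    simp only [add_dotProduct, smul_dotProduct, h.fst_normal, h.snd_normal, h.normal, h₁, h₂,
      smul_eq_mul]
    module
  have e2 : n ⨯₃ J = (r * Real.cos θ) • e₂ + (r * Real.sin θ) • e₁ := by
    conv_lhs => rw [h.expand J]
    simp only [map_add, map_smul, cross_self, h.normal_cross_fst, h.normal_cross_snd, h₁, h₂]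
    module
  rw [e1, e2]
  have e3 : Real.cos θ • ((r * Real.cos θ) • e₁ - (r * Real.sin θ) • e₂) +
      Real.sin θ • ((r * Real.cos θ) • e₂ + (r * Real.sin θ) • e₁) =
      (r * (Real.sin θ ^ 2 + Real.cos θ ^ 2)) • e₁ := by module
  rw [e3, Real.sin_sq_add_cos_sq, mul_one, smul_smul, inv_mul_cancel₀ hr, one_smul]

lemma IsInertiaEigenframe.isRightFrame {m : Fin 3 → ℝ} {q : Fin 3 → Vec} {e₁ e₂ n : Vec}
    (h : IsInertiaEigenframe m q e₁ e₂ n) : IsRightFrame e₁ e₂ n :=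
  ⟨h.1, h.2.1, h.2.2.1, h.2.2.2.1⟩

/-- In an inertia eigenframe, the Jacobi vectors have vanishing product of inertia. -/
lemma IsInertiaEigenframe.product_eq_zero {m : Fin 3 → ℝ} (hm : ∀ a, 0 < m a) {q : Fin 3 → Vec}
    (hq : ∑ a, m a • q a = 0) {e₁ e₂ n : Vec} (h : IsInertiaEigenframe m q e₁ e₂ n) :
    (jacobi₁ m q ⬝ᵥ e₁) * (jacobi₁ m q ⬝ᵥ e₂) + (jacobi₂ m q ⬝ᵥ e₁) * (jacobi₂ m q ⬝ᵥ e₂) = 0 := by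
  have hf := h.isRightFrame
  obtain ⟨l, hl⟩ := h.2.2.2.2.1
  have h1 := congrArg (fun u => e₂ ⬝ᵥ u) hl
  simp only [inertiaTensor_mulVec_eq_jacobi hm hq, cross_cross_eq_smul_sub_smul', dotProduct_add,
    dotProduct_sub, dotProduct_smul, hf.perp', smul_eq_mul, mul_zero] at h1
  rw [dotProduct_comm e₁, dotProduct_comm e₁, dotProduct_comm e₂, dotProduct_comm e₂] at h1
  linarith

end Velocity

section Formula

variable {E : Type*} [NormedAddCommGroup E] [NormedSpace ℝ E] {m : Fin 3 → ℝ}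

lemma one_sub_sq_pos {t : ℝ} (ht : |t| < 1) : 0 < 1 - t ^ 2 := by
  have := (sq_lt_one_iff_abs_lt_one t).2 ht
  linarith

lemma momentum_frame_sq {J₀ k n e₁ e₂ : Vec} (hf : IsRightFrame e₁ e₂ n) {l : ℝ}
    (hk : k ⬝ᵥ k = 1) (hJ : J₀ = l • k) :
    (J₀ ⬝ᵥ e₁) ^ 2 + (J₀ ⬝ᵥ e₂) ^ 2 = l ^ 2 * (1 - (k ⬝ᵥ n) ^ 2) := by
  have h := hf.dot_eq J₀ J₀
  have h1 : J₀ ⬝ᵥ J₀ = l ^ 2 := by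
    rw [hJ]; simp only [dotProduct_smul, smul_dotProduct, hk, smul_eq_mul]; ring
  have h2 : J₀ ⬝ᵥ n = l * (k ⬝ᵥ n) := by rw [hJ, smul_dotProduct, smul_eq_mul]
  rw [h1, h2] at h
  linarith

lemma momentumHeight_eq {J₀ k : Vec} (hJ₀ : J₀ ≠ 0) (hJ : J₀ = vecLength J₀ • k) (n : Vec) :
    momentumHeight J₀ n = k ⬝ᵥ n := by
  rw [momentumHeight]
  conv_lhs => enter [1]; rw [hJ]
  rw [smul_dotProduct, smul_eq_mul, mul_div_cancel_left₀ _ (vecLength_pos hJ₀).ne']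

/-- Along a motion with `I = 1` with eigenframe coordinates `(z₁, θ₁, z₂, θ₂)`, the connection form
is `J₀ (dφ + z₂ dθ₂ + ½ z₁ z₂ dθ₁)`, where `φ` is the azimuth of the normal about `𝐉₀`. -/
lemma connectionForm_eigenframe (hm : ∀ a, 0 < m a) {J₀ k : Vec} (hJ₀ : J₀ ≠ 0)
    (hk : k ⬝ᵥ k = 1) (hJ : J₀ = vecLength J₀ • k) {E₁ E₂ : Vec} (hE : IsRightFrame E₁ E₂ k)
    {z : E → (Fin 3 → Vec) × Vec} {x : E} (hz : ContDiffAt ℝ ∞ z x) (hmem : ∀ y, z y ∈ sFive m)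
    {c : E → EuclideanSpace ℝ (Fin 4)} (hc : ContDiffAt ℝ ∞ c x)
    (hco : ∀ᶠ y in 𝓝 x, HasEigenframeCoordinatesAt m J₀ (z y) (c y)) (v : E) :
    connectionForm m J₀ (z x) (fderiv ℝ z x v) =
      vecLength J₀ * (angleForm (fun y => (z y).2 ⬝ᵥ E₁) (fun y => (z y).2 ⬝ᵥ E₂) x v +
        c x 2 * fderiv ℝ (fun y => c y 3) x v +
        1 / 2 * (c x 0 * c x 2) * fderiv ℝ (fun y => c y 1) x v) := by
  set l := vecLength J₀ with hl
  have hlpos : 0 < l := vecLength_pos hJ₀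
  have hco0 := hco.self_of_nhds
  have hci : ∀ i, ContDiffAt ℝ ∞ (fun y => c y i) x := fun i => contDiffAt_euclidean.1 hc i
  have hcd : ∀ i, DifferentiableAt ℝ (fun y => c y i) x := fun i =>
    (hci i).differentiableAt (by simp)
  have hzd : DifferentiableAt ℝ z x := hz.differentiableAt (by simp)
  obtain ⟨hv1, hv2, hv3⟩ := velocity_constraints hzd (fun y => (hmem y).1) v
  have hs2 : 0 < 1 - c x 2 ^ 2 := one_sub_sq_pos hco0.2.2.2.2.2.1
  have hs1 : 0 < 1 - c x 0 ^ 2 := one_sub_sq_pos hco0.2.1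
  -- the eigenframe is a smooth function of the coordinates
  let r : E → ℝ := fun y => l * √(1 - c y 2 ^ 2)
  have hr : ContDiffAt ℝ ∞ r x :=
    contDiffAt_const.mul ((contDiffAt_const.sub ((hci 2).pow 2)).sqrt hs2.ne')
  have hr0 : r x ≠ 0 := (mul_pos hlpos (Real.sqrt_pos.2 hs2)).ne'
  let N : E → Vec := fun y => (z y).2
  have hN : ContDiffAt ℝ ∞ N x := hz.snd
  let e₁ : E → Vec := fun y => (r y)⁻¹ • (Real.cos (c y 3) • (J₀ - (J₀ ⬝ᵥ N y) • N y) +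
    Real.sin (c y 3) • (N y ⨯₃ J₀))
  let e₂ : E → Vec := fun y => N y ⨯₃ e₁ y
  have he₁ : ContDiffAt ℝ ∞ e₁ x :=
    (hr.inv hr0).smul (((hci 3).cos.smul (contDiffAt_const.sub
      ((contDiffAt_const.dotProduct hN).smul hN))).add
        ((hci 3).sin.smul (hN.crossProduct contDiffAt_const)))
  have he₂ : ContDiffAt ℝ ∞ e₂ x := hN.crossProduct he₁
  have hfr : ∀ᶠ y in 𝓝 x, IsInertiaEigenframe m (z y).1 (e₁ y) (e₂ y) (N y) ∧
      J₀ ⬝ᵥ e₁ y = r y * Real.cos (c y 3) ∧ J₀ ⬝ᵥ e₂ y = -(r y * Real.sin (c y 3)) := by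
    filter_upwards [hco] with y hy
    obtain ⟨-, -, -, -, -, hc2, f₁, f₂, hf, h1, h2⟩ := hy
    have hry : r y ≠ 0 := (mul_pos hlpos (Real.sqrt_pos.2 (one_sub_sq_pos hc2))).ne'
    have e1 : e₁ y = f₁ := (hf.isRightFrame.fst_eq hry h1 h2).symm
    have e2 : e₂ y = f₂ := by
      simp only [e₂, e1]
      exact hf.isRightFrame.normal_cross_fst
    rw [e1, e2]
    exact ⟨hf, h1, h2⟩
  have hfrx := hfr.self_of_nhds.1
  have hF := hfrx.isRightFrame
  -- derivatives
  have hNd : DifferentiableAt ℝ N x := hN.differentiableAt (by simp)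
  have he₁d : DifferentiableAt ℝ e₁ x := he₁.differentiableAt (by simp)
  have he₂d : DifferentiableAt ℝ e₂ x := he₂.differentiableAt (by simp)
  set e₁' := fderiv ℝ e₁ x v with he₁'
  set e₂' := fderiv ℝ e₂ x v with he₂'
  have hN' : fderiv ℝ N x v = (fderiv ℝ z x v).2 := (fderiv_normal_apply hzd v).symm
  set n' := (fderiv ℝ z x v).2 with hn'
  have d11 : e₁ x ⬝ᵥ e₁' = 0 := by
    have := dotProduct_velocity_of_const he₁d he₁d (hfr.mono fun y hy => hy.1.isRightFrame.fst) v
    rw [dotProduct_comm (fderiv ℝ e₁ x v)] at this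
    linarith
  have d22 : e₂ x ⬝ᵥ e₂' = 0 := by
    have := dotProduct_velocity_of_const he₂d he₂d (hfr.mono fun y hy => hy.1.isRightFrame.snd) v
    rw [dotProduct_comm (fderiv ℝ e₂ x v)] at this
    linarith
  have d12 : e₁' ⬝ᵥ e₂ x + e₁ x ⬝ᵥ e₂' = 0 :=
    dotProduct_velocity_of_const he₁d he₂d (hfr.mono fun y hy => hy.1.isRightFrame.perp) v
  have d1n : e₁' ⬝ᵥ N x + e₁ x ⬝ᵥ n' = 0 := by
    rw [← hN']
    exact dotProduct_velocity_of_const he₁d hNd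
      (hfr.mono fun y hy => hy.1.isRightFrame.fst_normal) v
  have d2n : e₂' ⬝ᵥ N x + e₂ x ⬝ᵥ n' = 0 := by
    rw [← hN']
    exact dotProduct_velocity_of_const he₂d hNd
      (hfr.mono fun y hy => hy.1.isRightFrame.snd_normal) v
  -- Jacobi vectors
  let ζ₁ : E → Vec := fun y => jacobi₁ m (z y).1
  let ζ₂ : E → Vec := fun y => jacobi₂ m (z y).1
  have hζ₁ : DifferentiableAt ℝ ζ₁ x := hz.fst.jacobi₁.differentiableAt (by simp)
  have hζ₂ : DifferentiableAt ℝ ζ₂ x := hz.fst.jacobi₂.differentiableAt (by simp)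
  have hζ₁' : fderiv ℝ ζ₁ x v = jacobi₁ m (fderiv ℝ z x v).1 := fderiv_jacobi₁ hzd v
  have hζ₂' : fderiv ℝ ζ₂ x v = jacobi₂ m (fderiv ℝ z x v).1 := fderiv_jacobi₂ hzd v
  have hζn : ∀ y, N y ⬝ᵥ ζ₁ y = 0 ∧ N y ⬝ᵥ ζ₂ y = 0 := fun y => dot_jacobi (hmem y).1.2.2
  have hI : ∀ y, ζ₁ y ⬝ᵥ ζ₁ y + ζ₂ y ⬝ᵥ ζ₂ y = 1 := fun y => by
    rw [← polarInertia_eq_jacobi hm (hmem y).1.1, (hmem y).2]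
  -- components in the eigenframe
  let x₁ : E → ℝ := fun y => ζ₁ y ⬝ᵥ e₁ y
  let x₂ : E → ℝ := fun y => ζ₂ y ⬝ᵥ e₁ y
  let y₁ : E → ℝ := fun y => ζ₁ y ⬝ᵥ e₂ y
  let y₂ : E → ℝ := fun y => ζ₂ y ⬝ᵥ e₂ y
  have hx₁ : HasFDerivAt x₁ (fderiv ℝ x₁ x) x := (hζ₁.dotProduct he₁d).hasFDerivAt
  have hx₂ : HasFDerivAt x₂ (fderiv ℝ x₂ x) x := (hζ₂.dotProduct he₁d).hasFDerivAt
  have hy₁ : HasFDerivAt y₁ (fderiv ℝ y₁ x) x := (hζ₁.dotProduct he₂d).hasFDerivAt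
  have hy₂ : HasFDerivAt y₂ (fderiv ℝ y₂ x) x := (hζ₂.dotProduct he₂d).hasFDerivAt
  have f1 : fderiv ℝ x₁ x v = fderiv ℝ ζ₁ x v ⬝ᵥ e₁ x + ζ₁ x ⬝ᵥ e₁' :=
    fderiv_dotProduct hζ₁ he₁d v
  have f2 : fderiv ℝ x₂ x v = fderiv ℝ ζ₂ x v ⬝ᵥ e₁ x + ζ₂ x ⬝ᵥ e₁' :=
    fderiv_dotProduct hζ₂ he₁d v
  have f3 : fderiv ℝ y₁ x v = fderiv ℝ ζ₁ x v ⬝ᵥ e₂ x + ζ₁ x ⬝ᵥ e₂' :=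
    fderiv_dotProduct hζ₁ he₂d v
  have f4 : fderiv ℝ y₂ x v = fderiv ℝ ζ₂ x v ⬝ᵥ e₂ x + ζ₂ x ⬝ᵥ e₂' :=
    fderiv_dotProduct hζ₂ he₂d v
  have hsq : ∀ᶠ y in 𝓝 x, ζ₁ y ⬝ᵥ ζ₁ y = x₁ y ^ 2 + y₁ y ^ 2 ∧
      ζ₂ y ⬝ᵥ ζ₂ y = x₂ y ^ 2 + y₂ y ^ 2 ∧ ζ₁ y ⬝ᵥ ζ₂ y = x₁ y * x₂ y + y₁ y * y₂ y := by
    filter_upwards [hfr] with y hy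
    have hf := hy.1.isRightFrame
    have a1 : ζ₁ y ⬝ᵥ N y = 0 := by rw [dotProduct_comm, (hζn y).1]
    have a2 : ζ₂ y ⬝ᵥ N y = 0 := by rw [dotProduct_comm, (hζn y).2]
    refine ⟨?_, ?_, ?_⟩
    · rw [hf.dot_eq, a1]; ring
    · rw [hf.dot_eq, a2]; ring
    · rw [hf.dot_eq, a1, a2]; ring
  have hC : ∀ᶠ y in 𝓝 x, x₁ y * y₁ y + x₂ y * y₂ y = 0 :=
    hfr.mono fun y hy => hy.1.product_eq_zero hm (hmem y).1.1
  have hC' : fderiv ℝ x₁ x v * y₁ x + x₁ x * fderiv ℝ y₁ x v +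
      (fderiv ℝ x₂ x v * y₂ x + x₂ x * fderiv ℝ y₂ x v) = 0 := by
    have h1 := ((hx₁.mul hy₁).add (hx₂.mul hy₂)).fderiv
    have h2 : (x₁ * y₁ + x₂ * y₂) =ᶠ[𝓝 x] fun _ => 0 := hC
    rw [h2.fderiv_eq] at h1
    have h3 := congrArg (fun φ => φ v) h1
    simp only [_root_.add_apply, _root_.smul_apply, smul_eq_mul, fderiv_fun_const,
      Pi.zero_apply, _root_.zero_apply] at h3
    linarith
  have hIx : x₁ x ^ 2 + x₂ x ^ 2 + y₁ x ^ 2 + y₂ x ^ 2 = 1 := by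
    have h1 := hI x
    rw [hsq.self_of_nhds.1, hsq.self_of_nhds.2.1] at h1
    linarith
  -- the shape sphere
  let w₁ : E → ℝ := fun y => 1 / 2 * (x₁ y ^ 2 + y₁ y ^ 2 - (x₂ y ^ 2 + y₂ y ^ 2))
  let w₂ : E → ℝ := fun y => x₁ y * x₂ y + y₁ y * y₂ y
  have hw₁ : fderiv ℝ w₁ x v = x₁ x * fderiv ℝ x₁ x v + y₁ x * fderiv ℝ y₁ x v -
      (x₂ x * fderiv ℝ x₂ x v + y₂ x * fderiv ℝ y₂ x v) := by
    have h1 := ((((hx₁.pow 2).add (hy₁.pow 2)).sub ((hx₂.pow 2).add (hy₂.pow 2))).const_mul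
      (1 / 2)).fderiv
    have h2 : fderiv ℝ w₁ x = _ := h1
    rw [h2]
    simp
    ring
  have hw₂ : fderiv ℝ w₂ x v = fderiv ℝ x₁ x v * x₂ x + x₁ x * fderiv ℝ x₂ x v +
      (fderiv ℝ y₁ x v * y₂ x + y₁ x * fderiv ℝ y₂ x v) := by
    have h1 := ((hx₁.mul hx₂).add (hy₁.mul hy₂)).fderiv
    have h2 : fderiv ℝ w₂ x = _ := h1
    rw [h2]
    simp
    ring
  have hρ : DifferentiableAt ℝ (fun y => 1 / 2 * √(1 - c y 0 ^ 2)) x :=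
    (contDiffAt_const.mul ((contDiffAt_const.sub ((hci 0).pow 2)).sqrt
      hs1.ne')).differentiableAt (n := ∞) (by simp)
  have p1 := polar_velocity (g₁ := w₁) (g₂ := w₂) hρ (hcd 1)
    (by
      filter_upwards [hco, hsq] with y hy hs
      rw [← hy.2.2.1, shapeW₁, (hmem y).2, div_one]
      simp only [w₁, ← hs.1, ← hs.2.1, ζ₁, ζ₂])
    (by
      filter_upwards [hco, hsq] with y hy hs
      rw [← hy.2.2.2.1, shapeW₂, (hmem y).2, div_one]
      simp only [w₂, ← hs.2.2, ζ₁, ζ₂]) v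
  have hc0 : c x 0 = 2 * (x₁ x * y₂ x - x₂ x * y₁ x) := by
    rw [hco0.1, shapeHeight_eq_jacobi hm, (hmem x).2, div_one, hF.cross_dot_normal]
    simp only [x₁, x₂, y₁, y₂, ζ₁, ζ₂]
    ring
  have hT := shape_velocity _ _ _ _ _ _ _ _ hC.self_of_nhds hC' hIx
  have hT' : x₁ x * fderiv ℝ y₁ x v - y₁ x * fderiv ℝ x₁ x v +
      (x₂ x * fderiv ℝ y₂ x v - y₂ x * fderiv ℝ x₂ x v) =
      1 / 2 * c x 0 * fderiv ℝ (fun y => c y 1) x v := by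
    rw [← hw₁, ← hw₂, ← hc0] at hT
    have h1 : (1 / 2 * √(1 - c x 0 ^ 2)) ^ 2 = 1 / 4 * (1 - c x 0 ^ 2) := by
      rw [mul_pow, Real.sq_sqrt hs1.le]; norm_num
    rw [h1] at p1
    have h2 : 1 / 2 * (x₁ x ^ 2 + y₁ x ^ 2 - (x₂ x ^ 2 + y₂ x ^ 2)) * fderiv ℝ w₂ x v -
        (x₁ x * x₂ x + y₁ x * y₂ x) * fderiv ℝ w₁ x v =
        -(1 / 4 * (1 - c x 0 ^ 2)) * fderiv ℝ (fun y => c y 1) x v := p1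
    rw [h2] at hT
    refine mul_left_cancel₀ hs1.ne' ?_
    linear_combination hT
  -- the momentum sphere
  have p2 := polar_velocity (g₁ := fun y => J₀ ⬝ᵥ e₁ y) (g₂ := fun y => J₀ ⬝ᵥ e₂ y)
    (hr.differentiableAt (by simp)) (hcd 3) (hfr.mono fun y hy => hy.2.1)
    (hfr.mono fun y hy => hy.2.2) v
  have hJd : DifferentiableAt ℝ (fun _ : E => J₀) x := differentiableAt_const _
  rw [fderiv_dotProduct hJd he₁d, fderiv_dotProduct hJd he₂d] at p2
  simp only [fderiv_fun_const, Pi.zero_apply, _root_.zero_apply, zero_dotProduct, zero_add] at p2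
  have hω := frame_angular_speed hF d11 d22 d12 d1n d2n hv2 J₀
  have hkn : k ⬝ᵥ N x = c x 2 := by rw [hco0.2.2.2.2.1, momentumHeight_eq hJ₀ hJ]
  have hJn : J₀ ⬝ᵥ N x = l * c x 2 := by rw [← hkn, hJ, smul_dotProduct, smul_eq_mul]
  have hJc : J₀ ⬝ᵥ (N x ⨯₃ n') = l * (k ⬝ᵥ (N x ⨯₃ n')) := by
    rw [hJ, smul_dotProduct, smul_eq_mul]
  have hrx : r x ^ 2 = l ^ 2 * (1 - c x 2 ^ 2) := by
    simp only [r]; rw [mul_pow, Real.sq_sqrt hs2.le]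
  rw [momentum_frame_sq hF hk hJ, p2, hrx, hJn, hJc, hkn] at hω
  have hτ : angleForm (fun y => (z y).2 ⬝ᵥ E₁) (fun y => (z y).2 ⬝ᵥ E₂) x v =
      (k ⬝ᵥ (N x ⨯₃ n')) / (1 - c x 2 ^ 2) := by
    have hE₁d : DifferentiableAt ℝ (fun _ : E => E₁) x := differentiableAt_const _
    have hE₂d : DifferentiableAt ℝ (fun _ : E => E₂) x := differentiableAt_const _
    have a1 : fderiv ℝ (fun y => (z y).2 ⬝ᵥ E₁) x v = n' ⬝ᵥ E₁ := by
      have := fderiv_dotProduct hNd hE₁d v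
      rw [hN'] at this
      simpa using this
    have a2 : fderiv ℝ (fun y => (z y).2 ⬝ᵥ E₂) x v = n' ⬝ᵥ E₂ := by
      have := fderiv_dotProduct hNd hE₂d v
      rw [hN'] at this
      simpa using this
    have a3 := hE.dot_eq (N x) (N x)
    rw [hF.normal, dotProduct_comm (N x) k, hkn] at a3
    rw [angleForm_apply, a1, a2, hE.cross_dot_normal]
    congr 1
    linarith
  have b1 := normal_dot_cross_velocity hF d11 d22 d12 (hζn x).1 (fderiv ℝ ζ₁ x v)
  have b2 := normal_dot_cross_velocity hF d11 d22 d12 (hζn x).2 (fderiv ℝ ζ₂ x v)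
  rw [← f1, ← f3] at b1
  rw [← f2, ← f4] at b2
  have hL : N x ⬝ᵥ angularMomentum m (z x).1 (fderiv ℝ z x v).1 =
      1 / 2 * c x 0 * fderiv ℝ (fun y => c y 1) x v + e₁' ⬝ᵥ e₂ x := by
    rw [angularMomentum_eq_jacobi hm (hmem x).1.1 hv1, ← hζ₁', ← hζ₂', dotProduct_add]
    have h1 := hI x
    change N x ⬝ᵥ (ζ₁ x ⨯₃ fderiv ℝ ζ₁ x v) + N x ⬝ᵥ (ζ₂ x ⨯₃ fderiv ℝ ζ₂ x v) = _
    rw [b1, b2, ← hT']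
    linear_combination (e₁' ⬝ᵥ e₂ x) * h1
  rw [connectionForm_apply, (hmem x).2, div_one, dotProduct_add, dotProduct_smul]
  change (N x ⬝ᵥ angularMomentum m (z x).1 (fderiv ℝ z x v).1) • (J₀ ⬝ᵥ N x) +
    J₀ ⬝ᵥ (N x ⨯₃ n') = _
  rw [hL, hJn, hJc, hτ, smul_eq_mul]
  have hω' : e₁' ⬝ᵥ e₂ x = fderiv ℝ (fun y => c y 3) x v +
      c x 2 * (k ⬝ᵥ (N x ⨯₃ n')) / (1 - c x 2 ^ 2) := by
    rw [eq_comm, ← sub_eq_zero]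
    have hl0 := hlpos.ne'
    have hs0 := hs2.ne'
    have h3 : l ^ 2 * (1 - c x 2 ^ 2) ≠ 0 := by positivity
    refine (mul_eq_zero.1 (?_ : l ^ 2 * (1 - c x 2 ^ 2) * _ = 0)).resolve_left h3
    field_simp
    linear_combination (-1) * hω
  rw [hω']
  have hs0 := hs2.ne'
  field_simp
  ring

end Formula

section ChartFormula

variable {m : Fin 3 → ℝ}

/-- The exterior derivative of the connection form along a motion, in eigenframe coordinates. -/
lemma extendedConnection_d_eigenframe (hm : ∀ a, 0 < m a) {J₀ : Vec} (hJ₀ : J₀ ≠ 0) {n : ℕ}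
    {P : EuclideanSpace ℝ (Fin n) → sFive m} (hP : IsPlot P)
    {c : EuclideanSpace ℝ (Fin n) → EuclideanSpace ℝ (Fin 4)} {x : EuclideanSpace ℝ (Fin n)}
    (hc : ∀ᶠ y in 𝓝 x, ContDiffAt ℝ ∞ c y)
    (hco : ∀ᶠ y in 𝓝 x, HasEigenframeCoordinatesAt m J₀ (P y).1 (c y))
    (v : Fin 2 → EuclideanSpace ℝ (Fin n)) :
    (extendedConnection m hm J₀).d.toFun (sFiveInclusion m ∘ P) (isPlot_sFiveInclusion hP) x v =
      vecLength J₀ * (1 / 2 * wedge (fderiv ℝ (fun y => c y 0 * c y 2) x)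
          (fderiv ℝ (fun y => c y 1) x) v +
        wedge (fderiv ℝ (fun y => c y 2) x) (fderiv ℝ (fun y => c y 3) x) v) := by
  obtain ⟨k, hk, hJ⟩ := exists_unit_axis hJ₀
  obtain ⟨E₁, E₂, hE⟩ := exists_isRightFrame hk
  have hz : ContDiff ℝ ∞ fun y => (P y : (Fin 3 → Vec) × Vec) := hP
  have hci : ∀ i, ContDiffAt ℝ ∞ (fun y => c y i) x := contDiffAt_euclidean.1 hc.self_of_nhds
  have hcd : ∀ i, DifferentiableAt ℝ (fun y => c y i) x := fun i =>
    (hci i).differentiableAt (by simp)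
  have hcf : ∀ i, DifferentiableAt ℝ (fderiv ℝ fun y => c y i) x := fun i =>
    (hci i).differentiableAt_fderiv
  have ha : ContDiffAt ℝ ∞ (fun y => (P y).1.2 ⬝ᵥ E₁) x :=
    hz.contDiffAt.snd.dotProduct contDiffAt_const
  have hb : ContDiffAt ℝ ∞ (fun y => (P y).1.2 ⬝ᵥ E₂) x :=
    hz.contDiffAt.snd.dotProduct contDiffAt_const
  have hab : ((P x).1.2 ⬝ᵥ E₁) ^ 2 + ((P x).1.2 ⬝ᵥ E₂) ^ 2 ≠ 0 := by
    have h1 := hco.self_of_nhds.2.2.2.2.1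
    have h2 := (sq_lt_one_iff_abs_lt_one _).2 hco.self_of_nhds.2.2.2.2.2.1
    rw [momentumHeight_eq hJ₀ hJ] at h1
    have h3 := hE.dot_eq (P x).1.2 (P x).1.2
    rw [(P x).2.1.2.1, dotProduct_comm _ k, ← h1] at h3
    intro h0
    nlinarith
  have hang := differentiableAt_angleForm ha hb hab
  have key : (fun x => connectionForm m J₀ ((sFiveInclusion m ∘ P) x) ∘L
        fderiv ℝ (fun y => ((sFiveInclusion m ∘ P) y : (Fin 3 → Vec) × Vec)) x) =ᶠ[𝓝 x]
      fun x => vecLength J₀ • (angleForm (fun y => (P y).1.2 ⬝ᵥ E₁) (fun y => (P y).1.2 ⬝ᵥ E₂) x +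
        (c x 2 • fderiv ℝ (fun y => c y 3) x +
          (1 / 2 : ℝ) • ((c x 0 * c x 2) • fderiv ℝ (fun y => c y 1) x))) := by
    filter_upwards [hc, hco.eventually_nhds] with y hy1 hy2
    ext w
    simp only [_root_.add_apply, _root_.smul_apply, smul_eq_mul]
    refine (connectionForm_eigenframe hm hJ₀ hk hJ hE hz.contDiffAt (fun y => (P y).2) hy1
      hy2 w).trans ?_
    ring
  have h23 : DifferentiableAt ℝ (fun x => c x 2 • fderiv ℝ (fun y => c y 3) x) x :=
    (hcd 2).fun_smul (hcf 3)
  have h021 : DifferentiableAt ℝ (fun x => (c x 0 * c x 2) • fderiv ℝ (fun y => c y 1) x) x :=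
    ((hcd 0).fun_mul (hcd 2)).fun_smul (hcf 1)
  rw [extendedConnection_d_apply, key.curl_eq,
    curl_const_smul _ (hang.fun_add (h23.fun_add (h021.fun_const_smul _))),
    curl_add hang (h23.fun_add (h021.fun_const_smul _)), curl_add h23 (h021.fun_const_smul _),
    curl_const_smul _ h021, curl_angleForm ha hb hab, curl_smul_fderiv (hcd 2) (hci 3),
    curl_smul_fderiv ((hcd 0).fun_mul (hcd 2)) (hci 1)]
  ring

/-- The reduced form in any chart of eigenframe coordinates. -/
lemma reducedForm_eigenframeChart (hm : ∀ a, 0 < m a) {J₀ : Vec} (hJ₀ : J₀ ≠ 0)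
    {Ω : DForm (ReducedSphereBundle m J₀) 2}
    (hΩ : Ω.pullback (reducedProj m hm J₀) (dSmooth_reducedProj m hm J₀) =
      (extendedConnection m hm J₀).d)
    {W : Set (ReducedSphereBundle m J₀)} {c : ReducedSphereBundle m J₀ → EuclideanSpace ℝ (Fin 4)}
    (hWc : IsEigenframeChart m J₀ W c) {n : ℕ}
    (p : EuclideanSpace ℝ (Fin n) → ReducedSphereBundle m J₀) (hp : IsPlot p)
    (x : EuclideanSpace ℝ (Fin n)) (hx : p x ∈ W) (v : Fin 2 → EuclideanSpace ℝ (Fin n)) :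
    Ω.toFun p hp x v = vecLength J₀ *
      (1 / 2 * wedge (fderiv ℝ (fun y => c (p y) 0 * c (p y) 2) x)
          (fderiv ℝ (fun y => c (p y) 1) x) v +
        wedge (fderiv ℝ (fun y => c (p y) 2) x) (fderiv ℝ (fun y => c (p y) 3) x) v) := by
  obtain ⟨⟨hWo, -, -, hs, -⟩, hcW⟩ := hWc
  obtain ⟨P, hP, he⟩ := exists_lift_sFive hp x
  have hW : ∀ᶠ y in 𝓝 x, p y ∈ W :=
    (isOpen_iff_preimages_plots.1 hWo n p hp).mem_nhds hx
  rw [toFun_eq_of_lift hΩ hp hP he, extendedConnection_d_eigenframe hm hJ₀ hP (c := c ∘ p)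
    (hW.mono fun y hy => hs p hp y hy) ?_ v]
  · rfl
  · filter_upwards [hW, he] with y hy hey
    refine HasEigenframeCoordinates.at_representative hm (x := P y) ?_
    have : reducedClass m J₀ (P y) = p y := hey
    rw [this]
    exact hcW _ hy

end ChartFormula

/-! ### Principal form of a normalized oriented triangle -/

/-- Two right-handed orthonormal frames differ by a rotation. -/
lemma IsRightFrame.exists_rotation {e₁ e₂ n e₁' e₂' n' : Vec} (h : IsRightFrame e₁ e₂ n)
    (h' : IsRightFrame e₁' e₂' n') :
    ∃ R ∈ Matrix.specialOrthogonalGroup (Fin 3) ℝ, ∀ u u' : Vec, u ⬝ᵥ e₁ = u' ⬝ᵥ e₁' →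
      u ⬝ᵥ e₂ = u' ⬝ᵥ e₂' → u ⬝ᵥ n = u' ⬝ᵥ n' → R *ᵥ u = u' := by
  have key : ∀ {f₁ f₂ f₃ : Vec}, IsRightFrame f₁ f₂ f₃ →
      Matrix.of ![f₁, f₂, f₃] ∈ Matrix.specialOrthogonalGroup (Fin 3) ℝ := by
    intro f₁ f₂ f₃ hf
    refine Matrix.mem_specialOrthogonalGroup_iff.2
      ⟨(Matrix.mem_orthogonalGroup_iff (Fin 3) ℝ).2 ?_, ?_⟩
    · have hmul : ∀ i j, (Matrix.of ![f₁, f₂, f₃] * (Matrix.of ![f₁, f₂, f₃])ᵀ) i j =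
          (![f₁, f₂, f₃] i) ⬝ᵥ (![f₁, f₂, f₃] j) := fun i j => rfl
      ext i j
      change (Matrix.of ![f₁, f₂, f₃] * (Matrix.of ![f₁, f₂, f₃])ᵀ) i j = _
      rw [hmul]
      fin_cases i <;> fin_cases j <;>
        simp [hf.fst, hf.snd, hf.normal, hf.perp, hf.perp', hf.fst_normal, hf.snd_normal,
          hf.normal_fst, hf.normal_snd]
    · have := triple_product_eq_det f₁ f₂ f₃
      rw [hf.snd_cross_normal, hf.fst] at this
      exact this.symm
  have hF := key h
  have hF' := key h'
  refine ⟨star (Matrix.of ![e₁', e₂', n']) * Matrix.of ![e₁, e₂, n],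
    mul_mem (star (⟨_, hF'⟩ : Matrix.specialOrthogonalGroup (Fin 3) ℝ)).2 hF, ?_⟩
  intro u u' h1 h2 h3
  have e : Matrix.of ![e₁, e₂, n] *ᵥ u = Matrix.of ![e₁', e₂', n'] *ᵥ u' := by
    ext i
    change (![e₁, e₂, n] i) ⬝ᵥ u = (![e₁', e₂', n'] i) ⬝ᵥ u'
    fin_cases i
    · simpa [dotProduct_comm] using h1
    · simpa [dotProduct_comm] using h2
    · simpa [dotProduct_comm] using h3
  rw [← Matrix.mulVec_mulVec, e, Matrix.mulVec_mulVec]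
  have := transpose_mul_self_of_mem hF'
  change ((Matrix.of ![e₁', e₂', n'])ᵀ * Matrix.of ![e₁', e₂', n']) *ᵥ u' = u'
  rw [this, Matrix.one_mulVec]

/-- The larger principal radius of a normalized triangle of shape height `t`. -/
noncomputable def majorRadius (t : ℝ) : ℝ := √((1 + √(1 - t ^ 2)) / 2)

/-- The smaller principal radius, with the sign of the orientation. -/
noncomputable def minorRadius (t : ℝ) : ℝ := t / (2 * majorRadius t)

lemma majorRadius_pos (t : ℝ) : 0 < majorRadius t :=
  Real.sqrt_pos.2 (by have := Real.sqrt_nonneg (1 - t ^ 2); linarith)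

lemma majorRadius_sq (t : ℝ) : majorRadius t ^ 2 = (1 + √(1 - t ^ 2)) / 2 :=
  Real.sq_sqrt (by have := Real.sqrt_nonneg (1 - t ^ 2); linarith)

lemma two_mul_major_mul_minor (t : ℝ) : 2 * majorRadius t * minorRadius t = t := by
  have := (majorRadius_pos t).ne'
  rw [minorRadius]; field_simp

lemma minorRadius_sq {t : ℝ} (ht : |t| < 1) : minorRadius t ^ 2 = (1 - √(1 - t ^ 2)) / 2 := by
  have h1 := majorRadius_sq t
  have h2 := two_mul_major_mul_minor t
  have h3 := Real.sq_sqrt (one_sub_sq_pos ht).le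
  have h4 := majorRadius_pos t
  have h5 : majorRadius t ^ 2 * minorRadius t ^ 2 =
      majorRadius t ^ 2 * ((1 - √(1 - t ^ 2)) / 2) := by
    conv_rhs => rw [h1]
    have : majorRadius t ^ 2 * minorRadius t ^ 2 = t ^ 2 / 4 := by
      linear_combination (1 / 4) * (2 * majorRadius t * minorRadius t + t) * h2
    rw [this]
    linarith
  exact mul_left_cancel₀ (by positivity) h5

section PrincipalForm

variable {m : Fin 3 → ℝ} {k : Vec}

/-- The oriented triangle `z` has, in a frame of its principal axes, the Jacobi vectors and the
components of `k` prescribed by the coordinates `b = (z₁, θ₁, z₂, θ₂)`; the first axis is the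
longer one. -/
def IsPrincipalForm (m : Fin 3 → ℝ) (k : Vec) (z : (Fin 3 → Vec) × Vec)
    (b : EuclideanSpace ℝ (Fin 4)) : Prop :=
  |b 0| < 1 ∧ |b 2| < 1 ∧ k ⬝ᵥ z.2 = b 2 ∧ ∃ e₁ e₂ : Vec, IsRightFrame e₁ e₂ z.2 ∧
    k ⬝ᵥ e₁ = √(1 - b 2 ^ 2) * Real.cos (b 3) ∧ k ⬝ᵥ e₂ = -(√(1 - b 2 ^ 2) * Real.sin (b 3)) ∧
    jacobi₁ m z.1 = (majorRadius (b 0) * Real.cos (b 1 / 2)) • e₁ +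
      (minorRadius (b 0) * Real.sin (b 1 / 2)) • e₂ ∧
    jacobi₂ m z.1 = (-(majorRadius (b 0) * Real.sin (b 1 / 2))) • e₁ +
      (minorRadius (b 0) * Real.cos (b 1 / 2)) • e₂

/-- A triangle in principal form has eigenframe coordinates: both principal radii are read off from
the shape sphere. -/
lemma IsPrincipalForm.hasEigenframeCoordinatesAt (hm : ∀ a, 0 < m a) {J₀ : Vec} (hJ₀ : J₀ ≠ 0)
    (hJ : J₀ = vecLength J₀ • k) {z : (Fin 3 → Vec) × Vec} (hz : z ∈ sFive m)
    {b : EuclideanSpace ℝ (Fin 4)} (h : IsPrincipalForm m k z b) :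
    HasEigenframeCoordinatesAt m J₀ z b := by
  obtain ⟨h0, h2, hk, e₁, e₂, hf, hk1, hk2, hζ₁, hζ₂⟩ := h
  have ha := majorRadius_sq (b 0)
  have hb := minorRadius_sq h0
  have hab := two_mul_major_mul_minor (b 0)
  have hcs := Real.sin_sq_add_cos_sq (b 1 / 2)
  have hcos : Real.cos (b 1) = Real.cos (b 1 / 2) ^ 2 - Real.sin (b 1 / 2) ^ 2 := by
    rw [← Real.cos_two_mul']; congr 1; ring
  have hsin : Real.sin (b 1) = 2 * Real.sin (b 1 / 2) * Real.cos (b 1 / 2) := by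
    rw [← Real.sin_two_mul]; congr 1; ring
  have hJu : ∀ u, J₀ ⬝ᵥ u = vecLength J₀ * (k ⬝ᵥ u) := fun u => by
    conv_lhs => rw [hJ]
    rw [smul_dotProduct, smul_eq_mul]
  set a := majorRadius (b 0)
  set β := minorRadius (b 0)
  set C := Real.cos (b 1 / 2)
  set S := Real.sin (b 1 / 2)
  have x1 : jacobi₁ m z.1 ⬝ᵥ e₁ = a * C := by
    rw [hζ₁]; simp [hf.fst, hf.perp']
  have y1 : jacobi₁ m z.1 ⬝ᵥ e₂ = β * S := by
    rw [hζ₁]; simp [hf.snd, hf.perp]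
  have x2 : jacobi₂ m z.1 ⬝ᵥ e₁ = -(a * S) := by
    rw [hζ₂]; simp [hf.fst, hf.perp']
  have y2 : jacobi₂ m z.1 ⬝ᵥ e₂ = β * C := by
    rw [hζ₂]; simp [hf.snd, hf.perp]
  have n1 : jacobi₁ m z.1 ⬝ᵥ z.2 = 0 := by rw [dotProduct_comm, (dot_jacobi hz.1.2.2).1]
  have n2 : jacobi₂ m z.1 ⬝ᵥ z.2 = 0 := by rw [dotProduct_comm, (dot_jacobi hz.1.2.2).2]
  refine ⟨?_, h0, ?_, ?_, ?_, h2, e₁, e₂, ⟨hf.fst, hf.snd, hf.perp, hf.cross, ⟨β ^ 2, ?_⟩,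
    ⟨a ^ 2, ?_⟩⟩, ?_, ?_⟩
  · rw [shapeHeight_eq_jacobi hm, hz.2, hf.cross_dot_normal, x1, y1, x2, y2, div_one]
    linear_combination -hab - 2 * a * β * hcs
  · rw [shapeW₁, hz.2, hf.dot_eq (jacobi₁ m z.1) (jacobi₁ m z.1),
      hf.dot_eq (jacobi₂ m z.1) (jacobi₂ m z.1), x1, y1, x2, y2, n1, n2, div_one, hcos]
    linear_combination (1 / 2 * (C ^ 2 - S ^ 2)) * (ha - hb)
  · rw [shapeW₂, hz.2, hf.dot_eq (jacobi₁ m z.1) (jacobi₂ m z.1), x1, y1, x2, y2, n1, n2,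
      div_one, hsin]
    linear_combination (-S * C) * (ha - hb)
  · rw [momentumHeight_eq hJ₀ hJ, hk]
  · rw [inertiaTensor_mulVec_eq_jacobi hm hz.1.1]
    refine hf.ext_dot ?_ ?_ ?_ <;>
    simp only [cross_cross_eq_smul_sub_smul', add_dotProduct, sub_dotProduct, smul_dotProduct,
      hf.dot_eq (jacobi₁ m z.1) (jacobi₁ m z.1), hf.dot_eq (jacobi₂ m z.1) (jacobi₂ m z.1),
      dotProduct_comm e₁ (jacobi₁ m z.1), dotProduct_comm e₁ (jacobi₂ m z.1),
      x1, y1, x2, y2, n1, n2, hf.fst, hf.perp, hf.fst_normal, smul_eq_mul]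
    · linear_combination β ^ 2 * hcs
    · ring
    · ring
  · rw [inertiaTensor_mulVec_eq_jacobi hm hz.1.1]
    refine hf.ext_dot ?_ ?_ ?_ <;>
    simp only [cross_cross_eq_smul_sub_smul', add_dotProduct, sub_dotProduct, smul_dotProduct,
      hf.dot_eq (jacobi₁ m z.1) (jacobi₁ m z.1), hf.dot_eq (jacobi₂ m z.1) (jacobi₂ m z.1),
      dotProduct_comm e₂ (jacobi₁ m z.1), dotProduct_comm e₂ (jacobi₂ m z.1),
      x1, y1, x2, y2, n1, n2, hf.snd, hf.perp', hf.snd_normal, smul_eq_mul]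
    · ring
    · linear_combination a ^ 2 * hcs
    · ring
  · rw [hJu, hk1]; ring
  · rw [hJu, hk2]; ring

/-- The coordinates determine the class: the rotation that takes one principal frame to the other
fixes `k`. -/
lemma IsPrincipalForm.reducedClass_eq (hm : ∀ a, 0 < m a) {J₀ : Vec} {l : ℝ} (hJ : J₀ = l • k)
    {x x' : sFive m} {b : EuclideanSpace ℝ (Fin 4)} (h : IsPrincipalForm m k x.1 b)
    (h' : IsPrincipalForm m k x'.1 b) : reducedClass m J₀ x = reducedClass m J₀ x' := by
  obtain ⟨-, -, hk, e₁, e₂, hf, hk1, hk2, hζ₁, hζ₂⟩ := h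
  obtain ⟨-, -, hk', e₁', e₂', hf', hk1', hk2', hζ₁', hζ₂'⟩ := h'
  obtain ⟨R, hR, H⟩ := hf.exists_rotation hf'
  have r1 : R *ᵥ e₁ = e₁' := H _ _ (by rw [hf.fst, hf'.fst]) (by rw [hf.perp, hf'.perp])
    (by rw [hf.fst_normal, hf'.fst_normal])
  have r2 : R *ᵥ e₂ = e₂' := H _ _ (by rw [hf.perp', hf'.perp']) (by rw [hf.snd, hf'.snd])
    (by rw [hf.snd_normal, hf'.snd_normal])
  have r3 : R *ᵥ x.1.2 = x'.1.2 := H _ _ (by rw [hf.normal_fst, hf'.normal_fst])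
    (by rw [hf.normal_snd, hf'.normal_snd]) (by rw [hf.normal, hf'.normal])
  have rk : R *ᵥ k = k := H _ _ (by rw [hk1, hk1']) (by rw [hk2, hk2']) (by rw [hk, hk'])
  have j1 : jacobi₁ m (fun a => R *ᵥ x.1.1 a) = jacobi₁ m x'.1.1 := by
    rw [jacobi₁_mulVec, hζ₁, hζ₁', Matrix.mulVec_add, Matrix.mulVec_smul, Matrix.mulVec_smul,
      r1, r2]
  have j2 : jacobi₂ m (fun a => R *ᵥ x.1.1 a) = jacobi₂ m x'.1.1 := by
    rw [jacobi₂_mulVec, hζ₂, hζ₂', Matrix.mulVec_add, Matrix.mulVec_smul, Matrix.mulVec_smul,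
      r1, r2]
  have hsum : ∑ a, m a • (fun a => R *ᵥ x.1.1 a) a = 0 := by
    have h1 := congrArg (fun u => R *ᵥ u) x.2.1.1
    simpa only [Matrix.mulVec_sum, Matrix.mulVec_smul, Matrix.mulVec_zero] using h1
  have hq := triangleOfJacobi_jacobi hm hsum
  rw [j1, j2, triangleOfJacobi_jacobi hm x'.2.1.1] at hq
  exact Quotient.sound ⟨R, hR, by rw [hJ, Matrix.mulVec_smul, rk],
    fun a => (congrFun hq a).symm, r3⟩

end PrincipalForm

/-! ### Angles from complex phases -/

/-- The branch of the argument with values in `(t₀ - π, t₀ + π]`. -/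
noncomputable def argNear (t₀ : ℝ) (w : ℂ) : ℝ := t₀ + (w * Complex.exp (-(t₀ * Complex.I))).arg

/-- The plane cut along the ray of argument `t₀ + π`. -/
def cutPlane (t₀ : ℝ) : Set ℂ := {w | w * Complex.exp (-(t₀ * Complex.I)) ∈ Complex.slitPlane}

lemma eq_norm_mul_exp_argNear (t₀ : ℝ) (w : ℂ) :
    w = ‖w‖ * Complex.exp (argNear t₀ w * Complex.I) := by
  have h := Complex.norm_mul_exp_arg_mul_I (w * Complex.exp (-(t₀ * Complex.I)))
  have h1 : ‖w * Complex.exp (-(t₀ * Complex.I))‖ = ‖w‖ := by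
    rw [norm_mul, ← neg_mul, ← Complex.ofReal_neg, Complex.norm_exp_ofReal_mul_I, mul_one]
  rw [h1] at h
  rw [argNear, Complex.ofReal_add, add_mul, Complex.exp_add, mul_left_comm, h, mul_left_comm,
    ← Complex.exp_add, add_neg_cancel, Complex.exp_zero, mul_one]

lemma abs_argNear_sub_lt {t₀ : ℝ} {w : ℂ} (hw : w ∈ cutPlane t₀) :
    |argNear t₀ w - t₀| < Real.pi := by
  rw [argNear, add_sub_cancel_left]
  have h1 : (w * Complex.exp (-(t₀ * Complex.I))).arg ≠ Real.pi :=
    (Complex.mem_slitPlane_iff_arg.1 hw).1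
  exact abs_lt.2 ⟨Complex.neg_pi_lt_arg _, lt_of_le_of_ne (Complex.arg_le_pi _) h1⟩

lemma argNear_mul_exp {t₀ t r : ℝ} (hr : 0 < r) (ht : |t - t₀| < Real.pi) :
    (r * Complex.exp (t * Complex.I) : ℂ) ∈ cutPlane t₀ ∧
      argNear t₀ (r * Complex.exp (t * Complex.I)) = t := by
  have e : (r * Complex.exp (t * Complex.I) : ℂ) * Complex.exp (-(t₀ * Complex.I)) =
      r * (Complex.cos ((t - t₀ : ℝ) : ℂ) + Complex.sin ((t - t₀ : ℝ) : ℂ) * Complex.I) := by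
    rw [← Complex.exp_mul_I, mul_assoc, ← Complex.exp_add]
    congr 2
    push_cast
    ring
  have ha := Complex.arg_mul_cos_add_sin_mul_I hr (θ := t - t₀)
    ⟨(abs_lt.1 ht).1, (abs_lt.1 ht).2.le⟩
  refine ⟨?_, ?_⟩
  · rw [cutPlane, Set.mem_ofPred_eq, e, Complex.mem_slitPlane_iff_arg, ha]
    refine ⟨(abs_lt.1 ht).2.ne, ?_⟩
    rw [← Complex.exp_mul_I]
    exact mul_ne_zero (by exact_mod_cast hr.ne') (Complex.exp_ne_zero _)
  · rw [argNear, e, ha]; ring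

lemma mem_cutPlane_arg {w : ℂ} (hw : w ≠ 0) : w ∈ cutPlane w.arg := by
  have := (argNear_mul_exp (t₀ := w.arg) (t := w.arg) (norm_pos_iff.2 hw)
    (by simpa using Real.pi_pos)).1
  rwa [Complex.norm_mul_exp_arg_mul_I] at this

lemma isOpen_cutPlane (t₀ : ℝ) : IsOpen (cutPlane t₀) :=
  Complex.isOpen_slitPlane.preimage (continuous_id.mul continuous_const)

lemma ContDiffAt.argNear {E : Type*} [NormedAddCommGroup E] [NormedSpace ℝ E] {f : E → ℂ} {x : E}
    {t₀ : ℝ} (hf : ContDiffAt ℝ ∞ f x) (hx : f x ∈ cutPlane t₀) :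
    ContDiffAt ℝ ∞ (fun y => _root_.argNear t₀ (f y)) x := by
  have h1 : ContDiffAt ℝ ∞ (fun y => f y * Complex.exp (-(t₀ * Complex.I))) x :=
    hf.mul contDiffAt_const
  have h2 : ContDiffAt ℝ ∞ Complex.log (f x * Complex.exp (-(t₀ * Complex.I))) :=
    (Complex.contDiffAt_log hx).restrict_scalars ℝ
  have h3 : ContDiffAt ℝ ∞
      (fun y => (Complex.log (f y * Complex.exp (-(t₀ * Complex.I)))).im) x :=
    Complex.imCLM.contDiff.contDiffAt.comp x (ContDiffAt.comp x (g := Complex.log) h2 h1)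
  simp only [Complex.log_im] at h3
  exact contDiffAt_const.add h3

/-! ### The angles of an oriented triangle -/

/-- The components of `u` along `k` and `n ⨯₃ k`, as a complex number.  The two vectors project to
orthogonal vectors of the plane with normal `n`, of the same length `√(1 - (k ⬝ᵥ n) ^ 2)`, which is
not divided out. -/
noncomputable def axisCoord (k n u : Vec) : ℂ :=
  ((u ⬝ᵥ k : ℝ) : ℂ) + ((u ⬝ᵥ (n ⨯₃ k) : ℝ) : ℂ) * Complex.I

/-- The quadratic form of the triangle: its phase is twice the angle from the long principal axis to
the axis `k`. -/
noncomputable def axisQuad (m : Fin 3 → ℝ) (k : Vec) (z : (Fin 3 → Vec) × Vec) : ℂ :=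
  axisCoord k z.2 (jacobi₁ m z.1) ^ 2 + axisCoord k z.2 (jacobi₂ m z.1) ^ 2

/-- The component of the triangle along the principal axis of azimuth `θ`: its phase is half of the
azimuth on the shape sphere. -/
noncomputable def principalPhase (m : Fin 3 → ℝ) (k : Vec) (θ : ℝ) (z : (Fin 3 → Vec) × Vec) : ℂ :=
  (((axisCoord k z.2 (jacobi₁ m z.1) * Complex.exp (-(θ * Complex.I))).re : ℝ) : ℂ) -
    (((axisCoord k z.2 (jacobi₂ m z.1) * Complex.exp (-(θ * Complex.I))).re : ℝ) : ℂ) * Complex.I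

/-- The branch of the angle `θ₂` near `θ₀`. -/
noncomputable def axisAngle (m : Fin 3 → ℝ) (k : Vec) (θ₀ : ℝ) (z : (Fin 3 → Vec) × Vec) : ℝ :=
  argNear (2 * θ₀) (axisQuad m k z) / 2

/-- The eigenframe coordinates `(z₁, θ₁, z₂, θ₂)` with `θ₂` near `θ₀` and `θ₁` near `2 ψ₀`. -/
noncomputable def frameCoords (m : Fin 3 → ℝ) (k : Vec) (θ₀ ψ₀ : ℝ) (z : (Fin 3 → Vec) × Vec) :
    EuclideanSpace ℝ (Fin 4) :=
  !₂[shapeHeight m z.1 z.2, 2 * argNear ψ₀ (principalPhase m k (axisAngle m k θ₀ z) z), k ⬝ᵥ z.2,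
    axisAngle m k θ₀ z]

/-- The domain on which `frameCoords` are smooth coordinates. -/
def frameDomain (m : Fin 3 → ℝ) (k : Vec) (θ₀ ψ₀ : ℝ) : Set ((Fin 3 → Vec) × Vec) :=
  {z | |shapeHeight m z.1 z.2| < 1 ∧ |k ⬝ᵥ z.2| < 1 ∧ axisQuad m k z ∈ cutPlane (2 * θ₀) ∧
    principalPhase m k (axisAngle m k θ₀ z) z ∈ cutPlane ψ₀}

/-- The range of `frameCoords`.  A half-turn of the principal frame shifts both `θ₁ / 2` and `θ₂` by
`π`, so a triangle determines the pair `(θ₁ / 2, θ₂)` up to multiples of `2 π` and this shift; the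
box, of widths `2 π` and `π`, contains at most one of the possible values. -/
def frameBox (θ₀ ψ₀ : ℝ) : Set (EuclideanSpace ℝ (Fin 4)) :=
  {b | |b 0| < 1 ∧ |b 2| < 1 ∧ |2 * b 3 - 2 * θ₀| < Real.pi ∧ |b 1 / 2 - ψ₀| < Real.pi}

section FrameCoords

variable {m : Fin 3 → ℝ} {k : Vec}

lemma IsRightFrame.axisCoord_eq {e₁ e₂ n : Vec} (hf : IsRightFrame e₁ e₂ n) {s θ : ℝ}
    (h1 : k ⬝ᵥ e₁ = s * Real.cos θ) (h2 : k ⬝ᵥ e₂ = -(s * Real.sin θ)) {u : Vec}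
    (hu : u ⬝ᵥ n = 0) :
    axisCoord k n u = s * (((u ⬝ᵥ e₁ : ℝ) : ℂ) + ((u ⬝ᵥ e₂ : ℝ) : ℂ) * Complex.I) *
      Complex.exp (θ * Complex.I) := by
  have hk : n ⨯₃ k = (s * Real.cos θ) • e₂ + (s * Real.sin θ) • e₁ := by
    conv_lhs => rw [hf.expand k]
    rw [h1, h2, map_add, map_add, map_smul, map_smul, map_smul, cross_self, hf.normal_cross_fst,
      hf.normal_cross_snd]
    module
  have e1 : u ⬝ᵥ k = s * ((u ⬝ᵥ e₁) * Real.cos θ - (u ⬝ᵥ e₂) * Real.sin θ) := by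
    rw [hf.dot_eq u k, h1, h2, hu]; ring
  have e2 : u ⬝ᵥ (n ⨯₃ k) = s * ((u ⬝ᵥ e₂) * Real.cos θ + (u ⬝ᵥ e₁) * Real.sin θ) := by
    rw [hk]; simp only [dotProduct_add, dotProduct_smul, smul_eq_mul]; ring
  rw [axisCoord, e1, e2, Complex.exp_mul_I, ← Complex.ofReal_cos, ← Complex.ofReal_sin]
  push_cast
  linear_combination (-(s : ℂ) * ((u ⬝ᵥ e₂ : ℝ) : ℂ) * Complex.sin θ) * Complex.I_sq

lemma cexp_mul_exp_neg (θ : ℝ) :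
    Complex.exp (θ * Complex.I) * Complex.exp (-(θ * Complex.I)) = 1 := by
  rw [← Complex.exp_add, add_neg_cancel, Complex.exp_zero]

lemma IsRightFrame.principalPhase_eq {z : (Fin 3 → Vec) × Vec} (hz : ∀ a, z.2 ⬝ᵥ z.1 a = 0)
    {e₁ e₂ : Vec} (hf : IsRightFrame e₁ e₂ z.2) {s θ : ℝ}
    (h1 : k ⬝ᵥ e₁ = s * Real.cos θ) (h2 : k ⬝ᵥ e₂ = -(s * Real.sin θ)) :
    principalPhase m k θ z = s * (((jacobi₁ m z.1 ⬝ᵥ e₁ : ℝ) : ℂ) -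
      ((jacobi₂ m z.1 ⬝ᵥ e₁ : ℝ) : ℂ) * Complex.I) := by
  have n1 : jacobi₁ m z.1 ⬝ᵥ z.2 = 0 := by rw [dotProduct_comm, (dot_jacobi hz).1]
  have n2 : jacobi₂ m z.1 ⬝ᵥ z.2 = 0 := by rw [dotProduct_comm, (dot_jacobi hz).2]
  rw [principalPhase, hf.axisCoord_eq h1 h2 n1, hf.axisCoord_eq h1 h2 n2, mul_assoc _ _
    (Complex.exp (-_)), mul_assoc _ _ (Complex.exp (-_)), cexp_mul_exp_neg, mul_one, mul_one]
  simp
  ring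

lemma IsRightFrame.axisQuad_eq {z : (Fin 3 → Vec) × Vec} (hz : ∀ a, z.2 ⬝ᵥ z.1 a = 0)
    {e₁ e₂ : Vec} (hf : IsRightFrame e₁ e₂ z.2) {s θ : ℝ}
    (h1 : k ⬝ᵥ e₁ = s * Real.cos θ) (h2 : k ⬝ᵥ e₂ = -(s * Real.sin θ)) :
    axisQuad m k z = s ^ 2 * (
      (((jacobi₁ m z.1 ⬝ᵥ e₁) ^ 2 + (jacobi₂ m z.1 ⬝ᵥ e₁) ^ 2 - (jacobi₁ m z.1 ⬝ᵥ e₂) ^ 2 -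
        (jacobi₂ m z.1 ⬝ᵥ e₂) ^ 2 : ℝ) : ℂ) +
      ((2 * ((jacobi₁ m z.1 ⬝ᵥ e₁) * (jacobi₁ m z.1 ⬝ᵥ e₂) +
        (jacobi₂ m z.1 ⬝ᵥ e₁) * (jacobi₂ m z.1 ⬝ᵥ e₂)) : ℝ) : ℂ) * Complex.I) *
      Complex.exp ((2 * θ : ℝ) * Complex.I) := by
  have n1 : jacobi₁ m z.1 ⬝ᵥ z.2 = 0 := by rw [dotProduct_comm, (dot_jacobi hz).1]
  have n2 : jacobi₂ m z.1 ⬝ᵥ z.2 = 0 := by rw [dotProduct_comm, (dot_jacobi hz).2]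
  have e : Complex.exp ((2 * θ : ℝ) * Complex.I) = Complex.exp (θ * Complex.I) ^ 2 := by
    rw [← Complex.exp_nat_mul]; congr 1; push_cast; ring
  rw [axisQuad, hf.axisCoord_eq h1 h2 n1, hf.axisCoord_eq h1 h2 n2, e]
  push_cast
  generalize Complex.exp (θ * Complex.I) = w
  linear_combination (w ^ 2 * s ^ 2 * (((jacobi₁ m z.1 ⬝ᵥ e₂ : ℝ) : ℂ) ^ 2 +
    ((jacobi₂ m z.1 ⬝ᵥ e₂ : ℝ) : ℂ) ^ 2)) * Complex.I_sq

/-- A normalized triangle and its shape height in a frame adapted to its plane. -/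
lemma sFive_frame (hm : ∀ a, 0 < m a) {z : (Fin 3 → Vec) × Vec} (hz : z ∈ sFive m) {e₁ e₂ : Vec}
    (hf : IsRightFrame e₁ e₂ z.2) :
    (jacobi₁ m z.1 ⬝ᵥ e₁) ^ 2 + (jacobi₂ m z.1 ⬝ᵥ e₁) ^ 2 + (jacobi₁ m z.1 ⬝ᵥ e₂) ^ 2 +
        (jacobi₂ m z.1 ⬝ᵥ e₂) ^ 2 = 1 ∧
      shapeHeight m z.1 z.2 = 2 * ((jacobi₁ m z.1 ⬝ᵥ e₁) * (jacobi₂ m z.1 ⬝ᵥ e₂) -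
        (jacobi₁ m z.1 ⬝ᵥ e₂) * (jacobi₂ m z.1 ⬝ᵥ e₁)) := by
  have n1 : jacobi₁ m z.1 ⬝ᵥ z.2 = 0 := by rw [dotProduct_comm, (dot_jacobi hz.1.2.2).1]
  have n2 : jacobi₂ m z.1 ⬝ᵥ z.2 = 0 := by rw [dotProduct_comm, (dot_jacobi hz.1.2.2).2]
  refine ⟨?_, ?_⟩
  · have := polarInertia_eq_jacobi hm hz.1.1
    rw [hz.2, hf.dot_eq (jacobi₁ m z.1) (jacobi₁ m z.1),
      hf.dot_eq (jacobi₂ m z.1) (jacobi₂ m z.1), n1, n2] at this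
    rw [this]; ring
  · rw [shapeHeight_eq_jacobi hm, hz.2, hf.cross_dot_normal, div_one]

/-- A frame of the plane of a triangle in which the axis `k` has a prescribed azimuth. -/
lemma exists_frame_azimuth (hk : k ⬝ᵥ k = 1) {n : Vec} (hn : n ⬝ᵥ n = 1) (hkn : |k ⬝ᵥ n| < 1)
    (θ : ℝ) : ∃ e₁ e₂ : Vec, IsRightFrame e₁ e₂ n ∧
      k ⬝ᵥ e₁ = √(1 - (k ⬝ᵥ n) ^ 2) * Real.cos θ ∧
      k ⬝ᵥ e₂ = -(√(1 - (k ⬝ᵥ n) ^ 2) * Real.sin θ) := by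
  have hs := one_sub_sq_pos hkn
  have hs2 := Real.sq_sqrt hs.le
  have hs1 := Real.sqrt_pos.2 hs
  set s := √(1 - (k ⬝ᵥ n) ^ 2)
  set P : Vec := s⁻¹ • (k - (k ⬝ᵥ n) • n)
  have hP : P ⬝ᵥ P = 1 := by
    simp only [P, dotProduct_smul, smul_dotProduct, dotProduct_sub, sub_dotProduct, hk, hn,
      dotProduct_comm n k, smul_eq_mul]
    field_simp
    linear_combination -hs2
  have hnP : n ⬝ᵥ P = 0 := by
    simp [P, hn, dotProduct_comm n k]
  have hkP : k ⬝ᵥ P = s := by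
    simp only [P, dotProduct_smul, dotProduct_sub, hk, smul_eq_mul]
    field_simp
    linear_combination -hs2
  have hkN : k ⬝ᵥ (n ⨯₃ P) = 0 := by
    simp [P]
  refine ⟨_, _, (isRightFrame_of_perp hn hP hnP).rotate θ, ?_, ?_⟩
  · simp [hkP, hkN]; ring
  · simp [hkP, hkN]; ring

/-- The quadratic form vanishes only at the poles of the two spheres. -/
lemma normSq_axisQuad (hm : ∀ a, 0 < m a) (hk : k ⬝ᵥ k = 1) {z : (Fin 3 → Vec) × Vec}
    (hz : z ∈ sFive m) (hkn : |k ⬝ᵥ z.2| < 1) :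
    ‖axisQuad m k z‖ ^ 2 = (1 - (k ⬝ᵥ z.2) ^ 2) ^ 2 * (1 - shapeHeight m z.1 z.2 ^ 2) := by
  obtain ⟨e₁, e₂, hf, h1, h2⟩ := exists_frame_azimuth hk hz.1.2.1 hkn 0
  obtain ⟨hI, hh⟩ := sFive_frame hm hz hf
  have hs2 := Real.sq_sqrt (one_sub_sq_pos hkn).le
  rw [hf.axisQuad_eq hz.1.2.2 h1 h2, norm_mul, norm_mul, Complex.norm_exp_ofReal_mul_I, mul_one,
    mul_pow, Complex.sq_norm (_ + _), Complex.normSq_add_mul_I, ← Complex.ofReal_pow,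
    Complex.norm_real, hs2, Real.norm_eq_abs, sq_abs, hh]
  congr 1
  linear_combination ((jacobi₁ m z.1 ⬝ᵥ e₁) ^ 2 + (jacobi₂ m z.1 ⬝ᵥ e₁) ^ 2 +
    (jacobi₁ m z.1 ⬝ᵥ e₂) ^ 2 + (jacobi₂ m z.1 ⬝ᵥ e₂) ^ 2 + 1) * hI

lemma abs_shapeHeight_le (hm : ∀ a, 0 < m a) {z : (Fin 3 → Vec) × Vec} (hz : z ∈ sFive m) :
    |shapeHeight m z.1 z.2| ≤ 1 := by
  obtain ⟨e₁, e₂, hf⟩ := exists_isRightFrame hz.1.2.1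
  obtain ⟨hI, hh⟩ := sFive_frame hm hz hf
  rw [← sq_le_one_iff_abs_le_one, hh]
  nlinarith [sq_nonneg ((jacobi₁ m z.1 ⬝ᵥ e₁) ^ 2 + (jacobi₂ m z.1 ⬝ᵥ e₁) ^ 2 -
    (jacobi₁ m z.1 ⬝ᵥ e₂) ^ 2 - (jacobi₂ m z.1 ⬝ᵥ e₂) ^ 2),
    sq_nonneg ((jacobi₁ m z.1 ⬝ᵥ e₁) * (jacobi₁ m z.1 ⬝ᵥ e₂) +
        (jacobi₂ m z.1 ⬝ᵥ e₁) * (jacobi₂ m z.1 ⬝ᵥ e₂))]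

lemma abs_dot_le_one {n : Vec} (hk : k ⬝ᵥ k = 1) (hn : n ⬝ᵥ n = 1) : |k ⬝ᵥ n| ≤ 1 := by
  rw [← sq_le_one_iff_abs_le_one]
  have := vec_dot_self_nonneg (k ⨯₃ n)
  rw [cross_dot_cross, hk, hn, dotProduct_comm n k] at this
  linarith

/-- In the frame of azimuth `θ`, where `2 θ` is the phase of the quadratic form, the triangle is in
principal position. -/
lemma exists_principal_frame (hm : ∀ a, 0 < m a) (hk : k ⬝ᵥ k = 1) {z : (Fin 3 → Vec) × Vec}
    (hz : z ∈ sFive m) (hh : |shapeHeight m z.1 z.2| < 1) (hkn : |k ⬝ᵥ z.2| < 1) {θ : ℝ}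
    (hθ : axisQuad m k z = ‖axisQuad m k z‖ * Complex.exp ((2 * θ : ℝ) * Complex.I)) :
    ∃ e₁ e₂ : Vec, IsRightFrame e₁ e₂ z.2 ∧
      k ⬝ᵥ e₁ = √(1 - (k ⬝ᵥ z.2) ^ 2) * Real.cos θ ∧
      k ⬝ᵥ e₂ = -(√(1 - (k ⬝ᵥ z.2) ^ 2) * Real.sin θ) ∧
      (jacobi₁ m z.1 ⬝ᵥ e₁) ^ 2 + (jacobi₂ m z.1 ⬝ᵥ e₁) ^ 2 =
        majorRadius (shapeHeight m z.1 z.2) ^ 2 ∧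
      (jacobi₁ m z.1 ⬝ᵥ e₁) * (jacobi₁ m z.1 ⬝ᵥ e₂) +
        (jacobi₂ m z.1 ⬝ᵥ e₁) * (jacobi₂ m z.1 ⬝ᵥ e₂) = 0 ∧
      2 * ((jacobi₁ m z.1 ⬝ᵥ e₁) * (jacobi₂ m z.1 ⬝ᵥ e₂) -
        (jacobi₁ m z.1 ⬝ᵥ e₂) * (jacobi₂ m z.1 ⬝ᵥ e₁)) = shapeHeight m z.1 z.2 := by
  obtain ⟨e₁, e₂, hf, h1, h2⟩ := exists_frame_azimuth hk hz.1.2.1 hkn θ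
  obtain ⟨hI, hhe⟩ := sFive_frame hm hz hf
  have hQ := normSq_axisQuad hm hk hz hkn
  have hs := one_sub_sq_pos hkn
  have ht := one_sub_sq_pos hh
  have hnorm : ‖axisQuad m k z‖ =
      (1 - (k ⬝ᵥ z.2) ^ 2) * √(1 - shapeHeight m z.1 z.2 ^ 2) := by
    rw [← Real.sqrt_sq (norm_nonneg _), hQ, Real.sqrt_mul (sq_nonneg _), Real.sqrt_sq hs.le]
  rw [hf.axisQuad_eq hz.1.2.2 h1 h2] at hθ
  have hθ' := mul_right_cancel₀ (Complex.exp_ne_zero _) hθ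
  rw [← hf.axisQuad_eq hz.1.2.2 h1 h2, hnorm] at hθ'
  have hs2 := Real.sq_sqrt hs.le
  rw [← Complex.ofReal_pow, hs2, Complex.ofReal_mul (1 - _) √_] at hθ'
  have hθ₂ := mul_left_cancel₀ (Complex.ofReal_ne_zero.2 hs.ne') hθ'
  have hre := congrArg Complex.re hθ₂
  have him := congrArg Complex.im hθ₂
  simp only [Complex.add_re, Complex.add_im, Complex.ofReal_re, Complex.ofReal_im,
    Complex.re_ofReal_mul, Complex.im_ofReal_mul, Complex.I_re, Complex.I_im, mul_zero, mul_one,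
    add_zero, zero_add] at hre him
  refine ⟨e₁, e₂, hf, h1, h2, ?_, by linarith, hhe.symm⟩
  rw [majorRadius_sq, ← hre]
  linarith

/-- On its domain, `frameCoords` puts a triangle in principal form. -/
lemma isPrincipalForm_frameCoords (hm : ∀ a, 0 < m a) (hk : k ⬝ᵥ k = 1) {θ₀ ψ₀ : ℝ}
    {z : (Fin 3 → Vec) × Vec} (hz : z ∈ sFive m) (hd : z ∈ frameDomain m k θ₀ ψ₀) :
    IsPrincipalForm m k z (frameCoords m k θ₀ ψ₀ z) ∧
      frameCoords m k θ₀ ψ₀ z ∈ frameBox θ₀ ψ₀ := by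
  obtain ⟨hh, hkn, hQ, hV⟩ := hd
  have hθ : axisQuad m k z =
      ‖axisQuad m k z‖ * Complex.exp ((2 * axisAngle m k θ₀ z : ℝ) * Complex.I) := by
    rw [axisAngle, mul_div_cancel₀ _ two_ne_zero]
    exact eq_norm_mul_exp_argNear _ _
  obtain ⟨e₁, e₂, hf, h1, h2, ha, hxy, hD⟩ := exists_principal_frame hm hk hz hh hkn hθ
  have hs := Real.sqrt_pos.2 (one_sub_sq_pos hkn)
  have hVe := hf.principalPhase_eq (m := m) hz.1.2.2 h1 h2
  have hVp := eq_norm_mul_exp_argNear ψ₀ (principalPhase m k (axisAngle m k θ₀ z) z)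
  have hapos := majorRadius_pos (shapeHeight m z.1 z.2)
  have hab := two_mul_major_mul_minor (shapeHeight m z.1 z.2)
  have n1 : jacobi₁ m z.1 ⬝ᵥ z.2 = 0 := by rw [dotProduct_comm, (dot_jacobi hz.1.2.2).1]
  have n2 : jacobi₂ m z.1 ⬝ᵥ z.2 = 0 := by rw [dotProduct_comm, (dot_jacobi hz.1.2.2).2]
  have b0 : frameCoords m k θ₀ ψ₀ z 0 = shapeHeight m z.1 z.2 := rfl
  have b1 : frameCoords m k θ₀ ψ₀ z 1 / 2 =
      argNear ψ₀ (principalPhase m k (axisAngle m k θ₀ z) z) :=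
    mul_div_cancel_left₀ _ two_ne_zero
  have b2 : frameCoords m k θ₀ ψ₀ z 2 = k ⬝ᵥ z.2 := rfl
  have b3 : frameCoords m k θ₀ ψ₀ z 3 = axisAngle m k θ₀ z := rfl
  refine ⟨?_, ?_⟩
  · rw [IsPrincipalForm, b0, b1, b2, b3]
    refine ⟨hh, hkn, rfl, e₁, e₂, hf, h1, h2, ?_⟩
    set s := √(1 - (k ⬝ᵥ z.2) ^ 2)
    set ψ := argNear ψ₀ (principalPhase m k (axisAngle m k θ₀ z) z)
    set a := majorRadius (shapeHeight m z.1 z.2)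
    set β := minorRadius (shapeHeight m z.1 z.2)
    have hnV : ‖principalPhase m k (axisAngle m k θ₀ z) z‖ = s * a := by
      have : ‖principalPhase m k (axisAngle m k θ₀ z) z‖ ^ 2 = (s * a) ^ 2 := by
        rw [hVe, sub_eq_add_neg, ← neg_mul, ← Complex.ofReal_neg, norm_mul, mul_pow,
          Complex.sq_norm (_ + _), Complex.normSq_add_mul_I, neg_sq, ha, Complex.norm_real,
          Real.norm_eq_abs, sq_abs, mul_pow]
      exact (sq_eq_sq₀ (norm_nonneg _) (by positivity)).1 this
    rw [hnV, hVe, Complex.ofReal_mul, mul_assoc] at hVp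
    have hVp' := mul_left_cancel₀ (by exact_mod_cast hs.ne') hVp
    rw [Complex.exp_mul_I, ← Complex.ofReal_cos, ← Complex.ofReal_sin] at hVp'
    have x1 := congrArg Complex.re hVp'
    have x2 := congrArg Complex.im hVp'
    simp only [Complex.add_re, Complex.add_im, Complex.sub_re, Complex.sub_im, Complex.ofReal_re,
      Complex.ofReal_im, Complex.re_ofReal_mul, Complex.im_ofReal_mul, Complex.I_re, Complex.I_im,
      mul_zero, mul_one, add_zero, zero_add, sub_zero, zero_sub] at x1 x2
    have x2' : jacobi₂ m z.1 ⬝ᵥ e₁ = -(a * Real.sin ψ) := by linarith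
    have hcs := Real.sin_sq_add_cos_sq ψ
    rw [x1, x2'] at hxy hD
    -- the short components solve a linear system of determinant one
    have r1 : (jacobi₁ m z.1 ⬝ᵥ e₂) * Real.cos ψ - (jacobi₂ m z.1 ⬝ᵥ e₂) * Real.sin ψ = 0 :=
      mul_left_cancel₀ hapos.ne' (by linear_combination hxy)
    have r2 : (jacobi₂ m z.1 ⬝ᵥ e₂) * Real.cos ψ + (jacobi₁ m z.1 ⬝ᵥ e₂) * Real.sin ψ = β :=
      mul_left_cancel₀ (mul_pos two_pos hapos).ne' (by linear_combination hD - hab)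
    have y1 : jacobi₁ m z.1 ⬝ᵥ e₂ = β * Real.sin ψ := by
      linear_combination Real.cos ψ * r1 + Real.sin ψ * r2 - (jacobi₁ m z.1 ⬝ᵥ e₂) * hcs
    have y2 : jacobi₂ m z.1 ⬝ᵥ e₂ = β * Real.cos ψ := by
      linear_combination Real.cos ψ * r2 - Real.sin ψ * r1 - (jacobi₂ m z.1 ⬝ᵥ e₂) * hcs
    refine ⟨?_, ?_⟩
    · rw [hf.expand (jacobi₁ m z.1), x1, y1, n1, zero_smul, add_zero]
    · rw [hf.expand (jacobi₂ m z.1), x2', y2, n2, zero_smul, add_zero]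
  · refine ⟨hh, hkn, ?_, ?_⟩
    · rw [b3, axisAngle, mul_div_cancel₀ _ two_ne_zero]
      exact abs_argNear_sub_lt hQ
    · rw [b1]
      exact abs_argNear_sub_lt hV

/-- The coordinates of a triangle in principal form are recovered by `frameCoords`. -/
lemma IsPrincipalForm.frameCoords_eq (hm : ∀ a, 0 < m a) {θ₀ ψ₀ : ℝ}
    {z : (Fin 3 → Vec) × Vec} (hz : z ∈ sFive m) {b : EuclideanSpace ℝ (Fin 4)}
    (h : IsPrincipalForm m k z b) (hb : b ∈ frameBox θ₀ ψ₀) :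
    z ∈ frameDomain m k θ₀ ψ₀ ∧ frameCoords m k θ₀ ψ₀ z = b := by
  obtain ⟨-, -, hk, e₁, e₂, hf, hk1, hk2, hζ₁, hζ₂⟩ := h
  obtain ⟨hb0, hb2, hb3, hb1⟩ := hb
  have hs := Real.sqrt_pos.2 (one_sub_sq_pos hb2)
  have hcs := Real.sin_sq_add_cos_sq (b 1 / 2)
  have hab := two_mul_major_mul_minor (b 0)
  have ha := majorRadius_sq (b 0)
  have hβ := minorRadius_sq hb0
  have hapos := majorRadius_pos (b 0)
  have x1 : jacobi₁ m z.1 ⬝ᵥ e₁ = majorRadius (b 0) * Real.cos (b 1 / 2) := by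
    rw [hζ₁]; simp [hf.fst, hf.perp']
  have y1 : jacobi₁ m z.1 ⬝ᵥ e₂ = minorRadius (b 0) * Real.sin (b 1 / 2) := by
    rw [hζ₁]; simp [hf.snd, hf.perp]
  have x2 : jacobi₂ m z.1 ⬝ᵥ e₁ = -(majorRadius (b 0) * Real.sin (b 1 / 2)) := by
    rw [hζ₂]; simp [hf.fst, hf.perp']
  have y2 : jacobi₂ m z.1 ⬝ᵥ e₂ = minorRadius (b 0) * Real.cos (b 1 / 2) := by
    rw [hζ₂]; simp [hf.snd, hf.perp]
  have hh : shapeHeight m z.1 z.2 = b 0 := by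
    rw [(sFive_frame hm hz hf).2, x1, y1, x2, y2]
    linear_combination hab + 2 * majorRadius (b 0) * minorRadius (b 0) * hcs
  have hQ : axisQuad m k z = ((√(1 - b 2 ^ 2) ^ 2 * √(1 - b 0 ^ 2) : ℝ) : ℂ) *
      Complex.exp ((2 * b 3 : ℝ) * Complex.I) := by
    rw [hf.axisQuad_eq hz.1.2.2 hk1 hk2, x1, y1, x2, y2]
    have e1 : (majorRadius (b 0) * Real.cos (b 1 / 2)) ^ 2 +
        (-(majorRadius (b 0) * Real.sin (b 1 / 2))) ^ 2 -
        (minorRadius (b 0) * Real.sin (b 1 / 2)) ^ 2 -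
        (minorRadius (b 0) * Real.cos (b 1 / 2)) ^ 2 = √(1 - b 0 ^ 2) := by
      linear_combination ha - hβ + (majorRadius (b 0) ^ 2 - minorRadius (b 0) ^ 2) * hcs
    have e2 : 2 * (majorRadius (b 0) * Real.cos (b 1 / 2) *
        (minorRadius (b 0) * Real.sin (b 1 / 2)) +
        -(majorRadius (b 0) * Real.sin (b 1 / 2)) *
        (minorRadius (b 0) * Real.cos (b 1 / 2))) = 0 := by ring
    rw [e1, e2, Complex.ofReal_zero, zero_mul, add_zero]
    push_cast
    ring
  have hQa := argNear_mul_exp (r := √(1 - b 2 ^ 2) ^ 2 * √(1 - b 0 ^ 2))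
    (by have := Real.sqrt_pos.2 (one_sub_sq_pos hb0); positivity) hb3
  rw [← hQ] at hQa
  have hA : axisAngle m k θ₀ z = b 3 := by
    rw [axisAngle, hQa.2, mul_div_cancel_left₀ _ two_ne_zero]
  have hV : principalPhase m k (axisAngle m k θ₀ z) z =
      ((√(1 - b 2 ^ 2) * majorRadius (b 0) : ℝ) : ℂ) *
        Complex.exp ((b 1 / 2 : ℝ) * Complex.I) := by
    rw [hA, hf.principalPhase_eq hz.1.2.2 hk1 hk2, x1, x2, Complex.exp_mul_I,
      ← Complex.ofReal_cos, ← Complex.ofReal_sin]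
    push_cast
    ring
  have hVa := argNear_mul_exp (r := √(1 - b 2 ^ 2) * majorRadius (b 0)) (by positivity) hb1
  rw [← hV] at hVa
  refine ⟨⟨by rwa [hh], by rwa [hk], hQa.1, hVa.1⟩, ?_⟩
  rw [frameCoords, hVa.2, hh, hk, hA]
  ext i
  fin_cases i
  · rfl
  · exact mul_div_cancel₀ _ two_ne_zero
  · rfl
  · rfl

lemma exists_mem_frameDomain (hm : ∀ a, 0 < m a) (hk : k ⬝ᵥ k = 1) {z : (Fin 3 → Vec) × Vec}
    (hz : z ∈ sFive m) (hh : |shapeHeight m z.1 z.2| < 1) (hkn : |k ⬝ᵥ z.2| < 1) :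
    ∃ θ₀ ψ₀ : ℝ, z ∈ frameDomain m k θ₀ ψ₀ := by
  have hQ0 : axisQuad m k z ≠ 0 := by
    intro h0
    have := normSq_axisQuad hm hk hz hkn
    rw [h0, norm_zero, zero_pow two_ne_zero] at this
    exact (mul_pos (pow_pos (one_sub_sq_pos hkn) 2) (one_sub_sq_pos hh)).ne this
  obtain ⟨θ₀, hθ₀⟩ : ∃ θ₀, 2 * θ₀ = (axisQuad m k z).arg :=
    ⟨(axisQuad m k z).arg / 2, by ring⟩
  have hθ : axisQuad m k z =
      ‖axisQuad m k z‖ * Complex.exp ((2 * axisAngle m k θ₀ z : ℝ) * Complex.I) := by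
    rw [axisAngle, mul_div_cancel₀ _ two_ne_zero]
    exact eq_norm_mul_exp_argNear _ _
  obtain ⟨e₁, e₂, hf, h1, h2, ha, -, -⟩ := exists_principal_frame hm hk hz hh hkn hθ
  have hV0 : principalPhase m k (axisAngle m k θ₀ z) z ≠ 0 := by
    intro h0
    rw [hf.principalPhase_eq hz.1.2.2 h1 h2] at h0
    have h3 := (mul_eq_zero.1 h0).resolve_left
      (by exact_mod_cast (Real.sqrt_pos.2 (one_sub_sq_pos hkn)).ne')
    have x1 := congrArg Complex.re h3
    have x2 := congrArg Complex.im h3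
    simp only [Complex.sub_re, Complex.sub_im, Complex.ofReal_re,
      Complex.ofReal_im, Complex.re_ofReal_mul, Complex.im_ofReal_mul, Complex.I_re, Complex.I_im,
      mul_zero, mul_one, sub_zero, zero_sub, Complex.zero_re, Complex.zero_im,
      neg_eq_zero] at x1 x2
    rw [x1, x2] at ha
    have := majorRadius_pos (shapeHeight m z.1 z.2)
    nlinarith
  refine ⟨θ₀, (principalPhase m k (axisAngle m k θ₀ z) z).arg, hh, hkn, ?_, mem_cutPlane_arg hV0⟩
  rw [hθ₀]
  exact mem_cutPlane_arg hQ0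

end FrameCoords

/-! ### Charts of eigenframe coordinates -/

section ChartExistence

variable {m : Fin 3 → ℝ} {k : Vec}

lemma frameCoords_rotation (hm : ∀ a, 0 < m a) {R : Matrix (Fin 3) (Fin 3) ℝ}
    (hR : R ∈ Matrix.specialOrthogonalGroup (Fin 3) ℝ) (hk : R *ᵥ k = k) (θ₀ ψ₀ : ℝ)
    (q : Fin 3 → Vec) (n : Vec) :
    frameCoords m k θ₀ ψ₀ (fun a => R *ᵥ q a, R *ᵥ n) = frameCoords m k θ₀ ψ₀ (q, n) ∧
      ((fun a => R *ᵥ q a, R *ᵥ n) ∈ frameDomain m k θ₀ ψ₀ ↔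
        (q, n) ∈ frameDomain m k θ₀ ψ₀) := by
  have hax : ∀ u, axisCoord k (R *ᵥ n) (R *ᵥ u) = axisCoord k n u := by
    intro u
    have h1 : (R *ᵥ u) ⬝ᵥ k = u ⬝ᵥ k := by
      conv_lhs => rw [← hk]
      exact rotation_dot hR _ _
    have h2 : (R *ᵥ u) ⬝ᵥ ((R *ᵥ n) ⨯₃ k) = u ⬝ᵥ (n ⨯₃ k) := by
      conv_lhs => rw [← hk]
      rw [rotation_cross hR, rotation_dot hR]
    rw [axisCoord, h1, h2, axisCoord]
  have hn : k ⬝ᵥ (R *ᵥ n) = k ⬝ᵥ n := rotation_dot_axis hR hk n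
  have hQ : axisQuad m k (fun a => R *ᵥ q a, R *ᵥ n) = axisQuad m k (q, n) := by
    simp only [axisQuad, jacobi₁_mulVec, jacobi₂_mulVec, hax]
  have hA : axisAngle m k θ₀ (fun a => R *ᵥ q a, R *ᵥ n) = axisAngle m k θ₀ (q, n) := by
    rw [axisAngle, hQ, axisAngle]
  have hV : ∀ θ, principalPhase m k θ (fun a => R *ᵥ q a, R *ᵥ n) =
      principalPhase m k θ (q, n) := by
    intro θ
    simp only [principalPhase, jacobi₁_mulVec, jacobi₂_mulVec, hax]
  refine ⟨?_, ?_⟩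
  · simp only [frameCoords, shapeHeight_rotation hm hR, hn, hA, hV]
  · simp only [frameDomain, Set.mem_ofPred_eq, shapeHeight_rotation hm hR, hn, hA, hV, hQ]

/-- The coordinates depend only on the class of an oriented triangle. -/
lemma frameCoords_congr (hm : ∀ a, 0 < m a) {J₀ : Vec} {l : ℝ} (hl : l ≠ 0) (hJ : J₀ = l • k)
    (θ₀ ψ₀ : ℝ) {x y : sFive m} (h : reducedClass m J₀ x = reducedClass m J₀ y) :
    frameCoords m k θ₀ ψ₀ x.1 = frameCoords m k θ₀ ψ₀ y.1 ∧
      (x.1 ∈ frameDomain m k θ₀ ψ₀ ↔ y.1 ∈ frameDomain m k θ₀ ψ₀) := by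
  obtain ⟨R, hR, hRJ, h1, h2⟩ := Quotient.exact h
  have hk : R *ᵥ k = k := by
    rw [hJ, Matrix.mulVec_smul] at hRJ
    exact smul_right_injective _ hl hRJ
  have hy : (y.1 : (Fin 3 → Vec) × Vec) = (fun a => R *ᵥ x.1.1 a, R *ᵥ x.1.2) :=
    Prod.ext (funext fun a => (h1 a).symm) h2.symm
  have := frameCoords_rotation hm hR hk θ₀ ψ₀ x.1.1 x.1.2
  rw [hy]
  exact ⟨this.1.symm, this.2.symm⟩

section Smoothness

variable {E : Type*} [NormedAddCommGroup E] [NormedSpace ℝ E] {z : E → (Fin 3 → Vec) × Vec} {x : E}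

lemma ContDiffAt.axisCoord {n u : E → Vec} (hn : ContDiffAt ℝ ∞ n x) (hu : ContDiffAt ℝ ∞ u x) :
    ContDiffAt ℝ ∞ (fun y => _root_.axisCoord k (n y) (u y)) x :=
  (Complex.ofRealCLM.contDiff.contDiffAt.comp x (hu.dotProduct contDiffAt_const)).add
    ((Complex.ofRealCLM.contDiff.contDiffAt.comp x
      (hu.dotProduct (hn.crossProduct contDiffAt_const))).mul contDiffAt_const)

lemma ContDiffAt.axisQuad (hz : ContDiffAt ℝ ∞ z x) :
    ContDiffAt ℝ ∞ (fun y => _root_.axisQuad m k (z y)) x :=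
  ((hz.snd.axisCoord hz.fst.jacobi₁).pow 2).add ((hz.snd.axisCoord hz.fst.jacobi₂).pow 2)

lemma ContDiffAt.principalPhase {θ : E → ℝ} (hθ : ContDiffAt ℝ ∞ θ x) (hz : ContDiffAt ℝ ∞ z x) :
    ContDiffAt ℝ ∞ (fun y => _root_.principalPhase m k (θ y) (z y)) x := by
  have he : ContDiffAt ℝ ∞ (fun y => Complex.exp (-(θ y * Complex.I))) x :=
    ((Complex.ofRealCLM.contDiff.contDiffAt.comp x hθ).mul contDiffAt_const).neg.cexp
  have key : ∀ {f : E → ℂ}, ContDiffAt ℝ ∞ f x → ContDiffAt ℝ ∞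
      (fun y => (((f y * Complex.exp (-(θ y * Complex.I))).re : ℝ) : ℂ)) x := fun hf =>
    Complex.ofRealCLM.contDiff.contDiffAt.comp x
      (Complex.reCLM.contDiff.contDiffAt.comp x (hf.mul he))
  exact (key (hz.snd.axisCoord hz.fst.jacobi₁)).sub
    ((key (hz.snd.axisCoord hz.fst.jacobi₂)).mul contDiffAt_const)

lemma contDiffAt_shapeHeight (hm : ∀ a, 0 < m a) (hz : ContDiffAt ℝ ∞ z x)
    (hx : polarInertia m (z x).1 ≠ 0) :
    ContDiffAt ℝ ∞ (fun y => shapeHeight m (z y).1 (z y).2) x := by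
  simp only [shapeHeight_eq_jacobi hm]
  exact (contDiffAt_const.mul (hz.snd.dotProduct
    (hz.fst.jacobi₁.crossProduct hz.fst.jacobi₂))).div (hz.fst.polarInertia m) hx

lemma contDiffAt_axisAngle (hz : ContDiffAt ℝ ∞ z x) {θ₀ : ℝ}
    (hx : axisQuad m k (z x) ∈ cutPlane (2 * θ₀)) :
    ContDiffAt ℝ ∞ (fun y => axisAngle m k θ₀ (z y)) x :=
  (hz.axisQuad.argNear hx).div_const 2

lemma contDiffAt_frameCoords (hm : ∀ a, 0 < m a) (hz : ContDiffAt ℝ ∞ z x)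
    (hI : polarInertia m (z x).1 ≠ 0) {θ₀ ψ₀ : ℝ} (hx : z x ∈ frameDomain m k θ₀ ψ₀) :
    ContDiffAt ℝ ∞ (fun y => frameCoords m k θ₀ ψ₀ (z y)) x := by
  have hA := contDiffAt_axisAngle hz hx.2.2.1
  rw [contDiffAt_piLp]
  intro i
  fin_cases i
  · exact contDiffAt_shapeHeight hm hz hI
  · exact contDiffAt_const.mul ((hA.principalPhase hz).argNear hx.2.2.2)
  · exact contDiffAt_const.dotProduct hz.snd
  · exact hA

lemma eventually_mem_frameDomain (hm : ∀ a, 0 < m a) (hz : ContDiffAt ℝ ∞ z x)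
    (hI : polarInertia m (z x).1 ≠ 0) {θ₀ ψ₀ : ℝ} (hx : z x ∈ frameDomain m k θ₀ ψ₀) :
    ∀ᶠ y in 𝓝 x, z y ∈ frameDomain m k θ₀ ψ₀ := by
  have hA := contDiffAt_axisAngle hz hx.2.2.1
  have c1 := (contDiffAt_shapeHeight hm hz hI).continuousAt.abs
  have c2 := (contDiffAt_const (c := k)).dotProduct hz.snd |>.continuousAt.abs
  have c3 := (hz.axisQuad (m := m) (k := k)).continuousAt
  have c4 := (hA.principalPhase (m := m) (k := k) hz).continuousAt
  filter_upwards [c1.eventually_lt continuousAt_const hx.1,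
    c2.eventually_lt continuousAt_const hx.2.1,
    c3.eventually ((isOpen_cutPlane _).mem_nhds hx.2.2.1),
    c4.eventually ((isOpen_cutPlane _).mem_nhds hx.2.2.2)] with y h1 h2 h3 h4
  exact ⟨h1, h2, h3, h4⟩

end Smoothness

/-- The normal of the oriented triangle with coordinates `b`, whose projection orthogonal to the
axis `k` is directed along `E₁`. -/
noncomputable def coordNormal (E₁ k : Vec) (b : EuclideanSpace ℝ (Fin 4)) : Vec :=
  b 2 • k + √(1 - b 2 ^ 2) • E₁

/-- The first principal axis of the oriented triangle with coordinates `b`. -/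
noncomputable def coordFst (E₁ E₂ k : Vec) (b : EuclideanSpace ℝ (Fin 4)) : Vec :=
  Real.cos (b 3) • (√(1 - b 2 ^ 2) • k - b 2 • E₁) + Real.sin (b 3) • -E₂

/-- The second principal axis of the oriented triangle with coordinates `b`. -/
noncomputable def coordSnd (E₁ E₂ k : Vec) (b : EuclideanSpace ℝ (Fin 4)) : Vec :=
  Real.cos (b 3) • -E₂ - Real.sin (b 3) • (√(1 - b 2 ^ 2) • k - b 2 • E₁)

/-- An oriented triangle with coordinates `b`: a section of the quotient map over a chart. -/
noncomputable def coordTriangle (m : Fin 3 → ℝ) (E₁ E₂ k : Vec) (b : EuclideanSpace ℝ (Fin 4)) :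
    (Fin 3 → Vec) × Vec :=
  (triangleOfJacobi m
    ((majorRadius (b 0) * Real.cos (b 1 / 2)) • coordFst E₁ E₂ k b +
      (minorRadius (b 0) * Real.sin (b 1 / 2)) • coordSnd E₁ E₂ k b)
    ((-(majorRadius (b 0) * Real.sin (b 1 / 2))) • coordFst E₁ E₂ k b +
      (minorRadius (b 0) * Real.cos (b 1 / 2)) • coordSnd E₁ E₂ k b), coordNormal E₁ k b)

lemma isRightFrame_coord {E₁ E₂ : Vec} (hE : IsRightFrame E₁ E₂ k)
    {b : EuclideanSpace ℝ (Fin 4)} (hb : |b 2| < 1) :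
    IsRightFrame (coordFst E₁ E₂ k b) (coordSnd E₁ E₂ k b) (coordNormal E₁ k b) := by
  have hs := Real.sq_sqrt (one_sub_sq_pos hb).le
  refine IsRightFrame.rotate ⟨?_, ?_, ?_, ?_⟩ (b 3)
  · simp [hE.normal, hE.fst, hE.normal_fst, hE.fst_normal]
    linear_combination hs
  · simp [hE.snd]
  · simp [hE.normal_snd, hE.perp]
  · have h1 := hE.normal_cross_snd
    simp only [map_sub, map_neg, map_smul, LinearMap.sub_apply, LinearMap.smul_apply, h1, hE.cross,
      coordNormal]
    module

/-- The section takes values in normalized oriented triangles in principal form. -/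
lemma coordTriangle_spec (hm : ∀ a, 0 < m a) {E₁ E₂ : Vec} (hE : IsRightFrame E₁ E₂ k)
    {b : EuclideanSpace ℝ (Fin 4)} (hb0 : |b 0| < 1) (hb : |b 2| < 1) :
    coordTriangle m E₁ E₂ k b ∈ sFive m ∧ IsPrincipalForm m k (coordTriangle m E₁ E₂ k b) b := by
  have hf := isRightFrame_coord hE hb
  have hs := Real.sq_sqrt (one_sub_sq_pos hb).le
  have hcs := Real.sin_sq_add_cos_sq (b 1 / 2)
  refine ⟨⟨⟨sum_smul_triangleOfJacobi hm _ _, hf.normal, fun a => ?_⟩, ?_⟩, hb0, hb, ?_, _, _, hf,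
    ?_, ?_, jacobi₁_triangleOfJacobi hm _ _, jacobi₂_triangleOfJacobi hm _ _⟩
  · fin_cases a <;> simp [coordTriangle, triangleOfJacobi, hf.normal_fst, hf.normal_snd]
  · change polarInertia m (triangleOfJacobi m _ _) = 1
    rw [polarInertia_eq_jacobi hm (sum_smul_triangleOfJacobi hm _ _), jacobi₁_triangleOfJacobi hm,
      jacobi₂_triangleOfJacobi hm]
    simp only [dotProduct_add, add_dotProduct, dotProduct_smul, smul_dotProduct, smul_eq_mul,
      hf.fst, hf.snd, hf.perp, hf.perp']
    linear_combination (majorRadius (b 0) ^ 2 + minorRadius (b 0) ^ 2) * hcs +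
      majorRadius_sq (b 0) + minorRadius_sq hb0
  · simp [coordTriangle, coordNormal, hE.normal, hE.normal_fst]
  · simp [coordFst, hE.normal, hE.normal_fst, hE.normal_snd]; ring
  · simp [coordSnd, hE.normal, hE.normal_fst, hE.normal_snd]; ring

section Smoothness

variable {E : Type*} [NormedAddCommGroup E] [NormedSpace ℝ E] {x : E}

lemma contDiffAt_majorRadius {f : E → ℝ} (hf : ContDiffAt ℝ ∞ f x) (hx : |f x| < 1) :
    ContDiffAt ℝ ∞ (fun y => majorRadius (f y)) x := by
  have h1 : ContDiffAt ℝ ∞ (fun y => √(1 - f y ^ 2)) x :=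
    (contDiffAt_const.sub (hf.pow 2)).sqrt (one_sub_sq_pos hx).ne'
  refine ((contDiffAt_const.add h1).div_const 2).sqrt ?_
  have := Real.sqrt_nonneg (1 - f x ^ 2)
  positivity

lemma contDiffAt_minorRadius {f : E → ℝ} (hf : ContDiffAt ℝ ∞ f x) (hx : |f x| < 1) :
    ContDiffAt ℝ ∞ (fun y => minorRadius (f y)) x :=
  hf.div (contDiffAt_const.mul (contDiffAt_majorRadius hf hx))
    (mul_pos two_pos (majorRadius_pos _)).ne'

lemma ContDiffAt.triangleOfJacobi {u v : E → Vec} (hu : ContDiffAt ℝ ∞ u x)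
    (hv : ContDiffAt ℝ ∞ v x) :
    ContDiffAt ℝ ∞ (fun y => _root_.triangleOfJacobi m (u y) (v y)) x := by
  rw [contDiffAt_pi]
  intro a
  fin_cases a
  · exact ((hv.const_smul _).const_smul _).add ((hu.const_smul _).const_smul _)
  · exact (hv.const_smul _).const_smul _
  · exact ((hv.const_smul _).const_smul _).sub ((hu.const_smul _).const_smul _)

lemma contDiffAt_coordTriangle (E₁ E₂ : Vec) {c : E → EuclideanSpace ℝ (Fin 4)}
    (hc : ContDiffAt ℝ ∞ c x) (h0 : |c x 0| < 1) (h2 : |c x 2| < 1) :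
    ContDiffAt ℝ ∞ (fun y => coordTriangle m E₁ E₂ k (c y)) x := by
  have hci : ∀ i, ContDiffAt ℝ ∞ (fun y => c y i) x := (contDiffAt_piLp 2).1 hc
  have hs : ContDiffAt ℝ ∞ (fun y => √(1 - c y 2 ^ 2)) x :=
    (contDiffAt_const.sub ((hci 2).pow 2)).sqrt (one_sub_sq_pos h2).ne'
  have hP : ContDiffAt ℝ ∞ (fun y => √(1 - c y 2 ^ 2) • k - c y 2 • E₁) x :=
    (hs.smul contDiffAt_const).sub ((hci 2).smul contDiffAt_const)
  have hF : ContDiffAt ℝ ∞ (fun y => coordFst E₁ E₂ k (c y)) x :=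
    ((hci 3).cos.smul hP).add ((hci 3).sin.smul contDiffAt_const)
  have hS : ContDiffAt ℝ ∞ (fun y => coordSnd E₁ E₂ k (c y)) x :=
    ((hci 3).cos.smul contDiffAt_const).sub ((hci 3).sin.smul hP)
  have hN : ContDiffAt ℝ ∞ (fun y => coordNormal E₁ k (c y)) x :=
    ((hci 2).smul contDiffAt_const).add (hs.smul contDiffAt_const)
  have ha := contDiffAt_majorRadius (hci 0) h0
  have hb := contDiffAt_minorRadius (hci 0) h0
  have hh := (hci 1).div_const 2
  exact (ContDiffAt.triangleOfJacobi
    (((ha.mul hh.cos).smul hF).add ((hb.mul hh.sin).smul hS))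
    (((ha.mul hh.sin).neg.smul hF).add ((hb.mul hh.cos).smul hS))).prodMk hN

end Smoothness

lemma isOpen_frameBox (θ₀ ψ₀ : ℝ) : IsOpen (frameBox θ₀ ψ₀) := by
  have hc : ∀ i : Fin 4, Continuous fun b : EuclideanSpace ℝ (Fin 4) => b i := fun i =>
    (EuclideanSpace.proj (𝕜 := ℝ) i).continuous
  exact ((isOpen_lt (hc 0).abs continuous_const).inter
    ((isOpen_lt (hc 2).abs continuous_const).inter
      ((isOpen_lt ((continuous_const.mul (hc 3)).sub continuous_const).abs continuous_const).inter
        (isOpen_lt (((hc 1).div_const 2).sub continuous_const).abs continuous_const))))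

/-- Eigenframe coordinates exist near every class off the poles of the two spheres. -/
lemma exists_eigenframeChart (hm : ∀ a, 0 < m a) {J₀ : Vec} (hJ₀ : J₀ ≠ 0) (x₀ : sFive m)
    (h₁ : |shapeHeight m x₀.1.1 x₀.1.2| ≠ 1) (h₂ : |momentumHeight J₀ x₀.1.2| ≠ 1) :
    ∃ (W : Set (ReducedSphereBundle m J₀))
      (c : ReducedSphereBundle m J₀ → EuclideanSpace ℝ (Fin 4)),
      reducedClass m J₀ x₀ ∈ W ∧ IsEigenframeChart m J₀ W c := by
  obtain ⟨k, hk, hJ⟩ := exists_unit_axis hJ₀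
  have hl := (vecLength_pos hJ₀).ne'
  rw [momentumHeight_eq hJ₀ hJ] at h₂
  obtain ⟨θ₀, ψ₀, hx₀⟩ := exists_mem_frameDomain hm hk x₀.2
    (lt_of_le_of_ne (abs_shapeHeight_le hm x₀.2) h₁)
    (lt_of_le_of_ne (abs_dot_le_one hk x₀.2.1.2.1) h₂)
  obtain ⟨E₁, E₂, hE⟩ := exists_isRightFrame hk
  have hout : ∀ s : ReducedSphereBundle m J₀, reducedClass m J₀ (Quotient.out s) = s :=
    fun s => Quotient.out_eq s
  let W : Set (ReducedSphereBundle m J₀) :=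
    {s | (Quotient.out s : sFive m).1 ∈ frameDomain m k θ₀ ψ₀}
  let c : ReducedSphereBundle m J₀ → EuclideanSpace ℝ (Fin 4) :=
    fun s => frameCoords m k θ₀ ψ₀ (Quotient.out s : sFive m).1
  have hcong : ∀ y : sFive m, c (reducedClass m J₀ y) = frameCoords m k θ₀ ψ₀ y.1 ∧
      (reducedClass m J₀ y ∈ W ↔ y.1 ∈ frameDomain m k θ₀ ψ₀) :=
    fun y => frameCoords_congr hm hl hJ θ₀ ψ₀ (hout _)
  have hform : ∀ s ∈ W, IsPrincipalForm m k (Quotient.out s : sFive m).1 (c s) ∧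
      c s ∈ frameBox θ₀ ψ₀ :=
    fun s hs => isPrincipalForm_frameCoords hm hk (Quotient.out s : sFive m).2 hs
  have hI : ∀ y : sFive m, polarInertia m y.1.1 ≠ 0 := fun y => by
    rw [y.2.2]; exact one_ne_zero
  have hlift : ∀ {n : ℕ} {p : EuclideanSpace ℝ (Fin n) → ReducedSphereBundle m J₀}, IsPlot p →
      ∀ {x}, p x ∈ W → ∃ P : EuclideanSpace ℝ (Fin n) → sFive m,
        ContDiff ℝ ∞ (fun y => (P y : (Fin 3 → Vec) × Vec)) ∧ reducedClass m J₀ ∘ P =ᶠ[𝓝 x] p ∧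
          (P x).1 ∈ frameDomain m k θ₀ ψ₀ := by
    intro n p hp x hx
    obtain ⟨P, hP, he⟩ := exists_lift_sFive hp x
    refine ⟨P, hP, he, ?_⟩
    rw [← (hcong (P x)).2]
    have : reducedClass m J₀ (P x) = p x := he.self_of_nhds
    rwa [this]
  refine ⟨W, c, (hcong x₀).2.2 hx₀, ⟨?_, ?_, ?_, ?_, ?_⟩, fun s hs => ?_⟩
  · rw [isOpen_iff_preimages_plots]
    intro n p hp
    rw [isOpen_iff_mem_nhds]
    intro x hx
    obtain ⟨P, hP, he, hxP⟩ := hlift hp hx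
    filter_upwards [he, eventually_mem_frameDomain hm hP.contDiffAt (hI (P x)) hxP] with y hy hyd
    have : reducedClass m J₀ (P y) = p y := hy
    rw [Set.mem_preimage, ← this, (hcong (P y)).2]
    exact hyd
  · have : c '' W = frameBox θ₀ ψ₀ := by
      apply Set.Subset.antisymm
      · rintro _ ⟨s, hs, rfl⟩
        exact (hform s hs).2
      · intro b hb
        obtain ⟨hmem, hpf⟩ := coordTriangle_spec hm hE hb.1 hb.2.1
        obtain ⟨hd, he⟩ := hpf.frameCoords_eq hm hmem hb
        exact ⟨reducedClass m J₀ ⟨_, hmem⟩, (hcong ⟨_, hmem⟩).2.2 hd,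
          (hcong ⟨_, hmem⟩).1.trans he⟩
    rw [this]
    exact isOpen_frameBox θ₀ ψ₀
  · intro s hs s' hs' h
    have h1 := (hform s hs).1
    have h2 := (hform s' hs').1
    rw [← h] at h2
    rw [← hout s, ← hout s']
    exact h1.reducedClass_eq hm hJ h2
  · intro n p hp x hx
    obtain ⟨P, hP, he, hxP⟩ := hlift hp hx
    refine (contDiffAt_frameCoords hm hP.contDiffAt (hI (P x)) hxP).congr_of_eventuallyEq ?_
    filter_upwards [he] with y hy
    have : reducedClass m J₀ (P y) = p y := hy
    rw [Function.comp_apply, ← this]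
    exact (hcong (P y)).1
  · intro n p hpW hcp x
    have hb : ∀ y, |c (p y) 0| < 1 ∧ |c (p y) 2| < 1 := fun y =>
      ⟨(hform _ (hpW y)).2.1, (hform _ (hpW y)).2.2.1⟩
    have hspec := fun y => coordTriangle_spec hm hE (hb y).1 (hb y).2
    refine ⟨fun y => ⟨coordTriangle m E₁ E₂ k (c (p y)), (hspec y).1⟩, ?_,
      Filter.Eventually.of_forall fun y => ?_⟩
    · exact contDiff_iff_contDiffAt.2 fun y =>
        contDiffAt_coordTriangle E₁ E₂ hcp.contDiffAt (hb y).1 (hb y).2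
    · exact (IsPrincipalForm.reducedClass_eq (J₀ := J₀) hm hJ
        (x := ⟨coordTriangle m E₁ E₂ k (c (p y)), (hspec y).1⟩) (hspec y).2
        (hform _ (hpW y)).1).trans (hout _)
  · refine ⟨Quotient.out s, hout s, ?_⟩
    exact (hform s hs).1.hasEigenframeCoordinatesAt hm hJ₀ hJ (Quotient.out s : sFive m).2

end ChartExistence

/-! ### The reduced two-form on the sphere bundle -/

theorem theorem4 (m : Fin 3 → ℝ) (hm : ∀ a, 0 < m a) (J₀ : Vec) (hJ₀ : J₀ ≠ 0) :
    ∃ α : DForm (qStar m) 1,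
      -- `α = J₀ ⬝ A` makes sense as a smooth one-form on all of `Q̃*`, in exactly one way
      IsConnectionComponent m J₀ α ∧
      (∀ β : DForm (qStar m) 1, IsConnectionComponent m J₀ β → β = α) ∧
      -- `dα` descends to a unique two-form `Ω`, which is closed
      ∃ Ω : DForm (ReducedSphereBundle m J₀) 2,
        Ω.pullback (reducedProj m hm J₀) (dSmooth_reducedProj m hm J₀) = α.d ∧
        (∀ Ω' : DForm (ReducedSphereBundle m J₀) 2,
          Ω'.pullback (reducedProj m hm J₀) (dSmooth_reducedProj m hm J₀) = α.d → Ω' = Ω) ∧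
        Ω.Closed ∧
        -- eigenframe coordinates exist near every point off the poles of the two spheres
        (∀ x : sFive m, |shapeHeight m x.1.1 x.1.2| ≠ 1 → |momentumHeight J₀ x.1.2| ≠ 1 →
          ∃ (W : Set (ReducedSphereBundle m J₀))
            (c : ReducedSphereBundle m J₀ → EuclideanSpace ℝ (Fin 4)),
            reducedClass m J₀ x ∈ W ∧ IsEigenframeChart m J₀ W c) ∧
        -- and in all such coordinates `Ω = J₀ {½ d(z₁ z₂) ∧ dθ₁ + dz₂ ∧ dθ₂}`
        ∀ (W : Set (ReducedSphereBundle m J₀))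
          (c : ReducedSphereBundle m J₀ → EuclideanSpace ℝ (Fin 4)), IsEigenframeChart m J₀ W c →
          ∀ (n : ℕ) (p : EuclideanSpace ℝ (Fin n) → ReducedSphereBundle m J₀) (hp : IsPlot p)
            (x : EuclideanSpace ℝ (Fin n)), p x ∈ W →
            ∀ v : Fin 2 → EuclideanSpace ℝ (Fin n),
              Ω.toFun p hp x v = vecLength J₀ *
                (1 / 2 * wedge (fderiv ℝ (fun y => c (p y) 0 * c (p y) 2) x)
                    (fderiv ℝ (fun y => c (p y) 1) x) v +
                  wedge (fderiv ℝ (fun y => c (p y) 2) x) (fderiv ℝ (fun y => c (p y) 3) x) v) := by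
  have hα : IsConnectionComponent m J₀ (extendedConnection m hm J₀) :=
    isConnectionComponent_extendedConnection hm J₀
  obtain ⟨Ω, hΩ⟩ := exists_reducedForm hm hJ₀
  have hpull : Ω.pullback (reducedProj m hm J₀) (dSmooth_reducedProj m hm J₀) =
      (extendedConnection m hm J₀).d := by
    ext n P hP x : 5
    exact hΩ _ _ P hP x Filter.EventuallyEq.rfl
  refine ⟨extendedConnection m hm J₀, hα, fun β hβ => IsConnectionComponent.eq hm hβ hα, Ω, hpull,
    fun Ω' hΩ' => ?_, fun p hp x => ?_, fun x => exists_eigenframeChart hm hJ₀ x,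
    fun W c hWc n p hp x hx v => reducedForm_eigenframeChart hm hJ₀ hpull hWc p hp x hx v⟩
  · ext n p hp x : 5
    obtain ⟨P, hP, he⟩ := exists_lift_sFive hp x
    rw [toFun_eq_of_lift hΩ' hp hP he, toFun_eq_of_lift hpull hp hP he]
  · obtain ⟨P, hP, he⟩ := exists_lift_sFive hp x
    have h1 : Ω.toFun p hp =ᶠ[𝓝 x] (extendedConnection m hm J₀).d.toFun (sFiveInclusion m ∘ P)
        (isPlot_sFiveInclusion hP) := by
      filter_upwards [he.eventuallyEq_nhds] with y hy
      exact toFun_eq_of_lift hpull hp hP hy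
    change extDeriv (Ω.toFun p hp) x = 0
    rw [h1.extDeriv_eq]
    exact (extendedConnection m hm J₀).closed_d _ (isPlot_sFiveInclusion hP) x
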